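/- Let $\lambda\in\mathbb{C}$ with $\lambda\neq 0$, and let $\mathcal{M}$ be the (non-projected) complex supermanifold of dimension $2|2$ with reduced manifold $\mathbb{P}^2$ and fermionic sheaf $\Pi\mathcal{O}_{\mathbb{P}^2}(-1)\oplus\Pi\mathcal{O}_{\mathbb{P}^2}(-2)$ which is glued from three charts $\mathcal{U}_i\cong\mathbb{C}^{2|2}$, $i=0,1,2$, over the standard open sets $\{X_i\neq 0\}$ of $\mathbb{P}^2$, with coordinates $(z_{1i},z_{2i}\,|\,\theta_{1i},\theta_{2i})$, by the holomorphic transition functions $$\begin{aligned} \mathcal{U}_0\cap\mathcal{U}_1:&\quad z_{10}=\frac{1}{z_{11}},\quad z_{20}=\frac{z_{21}}{z_{11}}+\lambda\frac{\theta_{11}\theta_{21}}{z_{11}^2},\quad \theta_{10}=\frac{\theta_{11}}{z_{11}},\quad \theta_{20}=\frac{\theta_{21}}{z_{11}^2};\\ \mathcal{U}_1\cap\mathcal{U}_2:&\quad z_{11}=\frac{z_{12}}{z_{22}}+\lambda\frac{\theta_{12}\theta_{22}}{z_{22}^2},\quad z_{21}=\frac{1}{z_{22}},\quad \theta_{11}=\frac{\theta_{12}}{z_{22}},\quad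 \theta_{21}=\frac{\theta_{22}}{z_{22}^2};\\ \mathcal{U}_2\cap\mathcal{U}_0:&\quad z_{12}=\frac{1}{z_{20}},\quad z_{22}=\frac{z_{10}}{z_{20}}+\lambda\frac{\theta_{10}\theta_{20}}{z_{20}^2},\quad \theta_{12}=\frac{\theta_{10}}{z_{20}},\quad \theta_{22}=\frac{\theta_{20}}{z_{20}^2}. \end{aligned}$$ Here $\lambda$ represents the non-zero class $\omega\in H^1(\mathcal{T}_{\mathbb{P}^2}(-3))\cong\mathbb{C}$ attached to $\mathcal{M}$. Let $\mathcal{T}_{\mathcal{M}}$ be the tangent sheaf of $\mathcal{M}$, that is, the sheaf of $\mathbb{C}$-linear superderivations of the structure sheaf $\mathcal{O}_{\mathcal{M}}$. **Theorem.** The super vector space $H^0(\mathcal{T}_{\mathcal{M}})$ has dimension $12|12$. It has a homogeneous basis $\{\mathcal{V}_1,\dots,\mathcal{V}_{12}\,|\,\Xi_1,\dots,\Xi_{12}\}$ (the $\mathcal{V}_k$ even, the $\Xi_k$ odd) whose elements are given in the chart $\mathcal{U}_0$ by $$\begin{aligned} &\mathcal{V}_1=\partial_{z_{10}},\quad \mathcal{V}_2=\partial_{z_{20}},\quad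 \mathcal{V}_3=z_{20}\partial_{z_{10}},\quad \mathcal{V}_4=z_{10}\partial_{z_{20}},\quad \mathcal{V}_5=z_{10}\partial_{z_{10}}-z_{20}\partial_{z_{20}},\\ &\mathcal{V}_6=\theta_{10}\partial_{\theta_{20}},\quad \mathcal{V}_7=z_{10}\theta_{10}\partial_{\theta_{20}},\quad \mathcal{V}_8=z_{20}\theta_{10}\partial_{\theta_{20}},\\ &\mathcal{V}_9=\theta_{10}\partial_{\theta_{10}}+z_{20}\partial_{z_{20}},\quad \mathcal{V}_{10}=\theta_{20}\partial_{\theta_{20}}+z_{20}\partial_{z_{20}},\\ &\mathcal{V}_{11}=z_{10}^2\partial_{z_{10}}+(z_{10}z_{20}+\lambda\theta_{10}\theta_{20})\partial_{z_{20}}+z_{10}\theta_{10}\partial_{\theta_{10}}+2z_{10}\theta_{20}\partial_{\theta_{20}},\\ &\mathcal{V}_{12}=(z_{10}z_{20}-\lambda\theta_{10}\theta_{20})\partial_{z_{10}}+z_{20}^2\partial_{z_{20}}+z_{20}\theta_{10}\partial_{\theta_{10}}+2z_{20}\theta_{20}\partial_{\theta_{20}},\\[4pt] &\Xi_1=\partial_{\theta_{10}},\quad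 \Xi_2=\partial_{\theta_{20}},\quad \Xi_3=\theta_{10}\partial_{z_{10}},\quad \Xi_4=\theta_{10}\partial_{z_{20}},\quad \Xi_5=z_{10}\partial_{\theta_{20}},\quad \Xi_6=z_{20}\partial_{\theta_{20}},\\ &\Xi_7=z_{10}^2\partial_{\theta_{20}}-\lambda z_{10}\theta_{10}\partial_{z_{20}},\quad \Xi_8=z_{20}^2\partial_{\theta_{20}}+\lambda z_{20}\theta_{10}\partial_{z_{10}},\\ &\Xi_9=z_{10}\partial_{\theta_{10}}+\lambda\theta_{20}\partial_{z_{20}},\quad \Xi_{10}=-z_{20}\partial_{\theta_{10}}+\lambda\theta_{20}\partial_{z_{10}},\\ &\Xi_{11}=z_{10}\theta_{10}\partial_{z_{10}}+z_{20}\theta_{10}\partial_{z_{20}}+2\theta_{10}\theta_{20}\partial_{\theta_{20}},\\ &\Xi_{12}=(z_{10}z_{20}-\lambda\theta_{10}\theta_{20})\partial_{\theta_{20}}-\lambda z_{20}\theta_{10}\partial_{z_{20}}, \end{aligned}$$ where the odd partial derivatives are left derivatives. -/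

import Mathlib

noncomputable section

namespace SuperPlane

/-! ### The Grassmann algebra on two odd generators -/

/-- The complex Grassmann algebra `ℂ[θ₁, θ₂]`; the element `⟨a, b, c, d⟩` is
`a + b θ₁ + c θ₂ + d θ₁θ₂`. -/
@[ext] structure Grass where
  body : ℂ
  c1 : ℂ
  c2 : ℂ
  c12 : ℂ

namespace Grass

instance : Zero Grass := ⟨⟨0, 0, 0, 0⟩⟩
instance : One Grass := ⟨⟨1, 0, 0, 0⟩⟩
instance : Add Grass := ⟨fun f g => ⟨f.body + g.body, f.c1 + g.c1, f.c2 + g.c2, f.c12 + g.c12⟩⟩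
instance : Neg Grass := ⟨fun f => ⟨-f.body, -f.c1, -f.c2, -f.c12⟩⟩
instance : Mul Grass := ⟨fun f g =>
  ⟨f.body * g.body, f.body * g.c1 + f.c1 * g.body, f.body * g.c2 + f.c2 * g.body,
    f.body * g.c12 + f.c12 * g.body + f.c1 * g.c2 - f.c2 * g.c1⟩⟩
instance : SMul ℂ Grass := ⟨fun r f => ⟨r * f.body, r * f.c1, r * f.c2, r * f.c12⟩⟩

@[simp] theorem zero_body : (0 : Grass).body = 0 := rfl
@[simp] theorem zero_c1 : (0 : Grass).c1 = 0 := rfl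
@[simp] theorem zero_c2 : (0 : Grass).c2 = 0 := rfl
@[simp] theorem zero_c12 : (0 : Grass).c12 = 0 := rfl
@[simp] theorem one_body : (1 : Grass).body = 1 := rfl
@[simp] theorem one_c1 : (1 : Grass).c1 = 0 := rfl
@[simp] theorem one_c2 : (1 : Grass).c2 = 0 := rfl
@[simp] theorem one_c12 : (1 : Grass).c12 = 0 := rfl
@[simp] theorem add_body (f g : Grass) : (f + g).body = f.body + g.body := rfl
@[simp] theorem add_c1 (f g : Grass) : (f + g).c1 = f.c1 + g.c1 := rfl
@[simp] theorem add_c2 (f g : Grass) : (f + g).c2 = f.c2 + g.c2 := rfl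
@[simp] theorem add_c12 (f g : Grass) : (f + g).c12 = f.c12 + g.c12 := rfl
@[simp] theorem neg_body (f : Grass) : (-f).body = -f.body := rfl
@[simp] theorem neg_c1 (f : Grass) : (-f).c1 = -f.c1 := rfl
@[simp] theorem neg_c2 (f : Grass) : (-f).c2 = -f.c2 := rfl
@[simp] theorem neg_c12 (f : Grass) : (-f).c12 = -f.c12 := rfl
@[simp] theorem mul_body (f g : Grass) : (f * g).body = f.body * g.body := rfl
@[simp] theorem mul_c1 (f g : Grass) : (f * g).c1 = f.body * g.c1 + f.c1 * g.body := rfl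
@[simp] theorem mul_c2 (f g : Grass) : (f * g).c2 = f.body * g.c2 + f.c2 * g.body := rfl
@[simp] theorem mul_c12 (f g : Grass) : (f * g).c12 =
    f.body * g.c12 + f.c12 * g.body + f.c1 * g.c2 - f.c2 * g.c1 := rfl
@[simp] theorem smul_body (r : ℂ) (f : Grass) : (r • f).body = r * f.body := rfl
@[simp] theorem smul_c1 (r : ℂ) (f : Grass) : (r • f).c1 = r * f.c1 := rfl
@[simp] theorem smul_c2 (r : ℂ) (f : Grass) : (r • f).c2 = r * f.c2 := rfl
@[simp] theorem smul_c12 (r : ℂ) (f : Grass) : (r • f).c12 = r * f.c12 := rfl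

instance : Ring Grass where
  add_assoc _ _ _ := by ext <;> simp <;> ring
  zero_add _ := by ext <;> simp
  add_zero _ := by ext <;> simp
  add_comm _ _ := by ext <;> simp <;> ring
  neg_add_cancel _ := by ext <;> simp
  mul_assoc _ _ _ := by ext <;> simp <;> ring
  one_mul _ := by ext <;> simp
  mul_one _ := by ext <;> simp
  left_distrib _ _ _ := by ext <;> simp <;> ring
  right_distrib _ _ _ := by ext <;> simp <;> ring
  zero_mul _ := by ext <;> simp
  mul_zero _ := by ext <;> simp
  nsmul := nsmulRec
  zsmul := zsmulRec

instance : Algebra ℂ Grass where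
  algebraMap :=
    { toFun := fun r => ⟨r, 0, 0, 0⟩
      map_one' := rfl
      map_mul' := fun _ _ => by ext <;> simp
      map_zero' := rfl
      map_add' := fun _ _ => by ext <;> simp }
  commutes' _ _ := by ext <;> simp <;> ring
  smul_def' _ _ := by ext <;> simp

@[simp] theorem algebraMap_body (r : ℂ) : (algebraMap ℂ Grass r).body = r := rfl
@[simp] theorem algebraMap_c1 (r : ℂ) : (algebraMap ℂ Grass r).c1 = 0 := rfl
@[simp] theorem algebraMap_c2 (r : ℂ) : (algebraMap ℂ Grass r).c2 = 0 := rfl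
@[simp] theorem algebraMap_c12 (r : ℂ) : (algebraMap ℂ Grass r).c12 = 0 := rfl

@[simp] theorem sub_body (f g : Grass) : (f - g).body = f.body - g.body := by
  simp [sub_eq_add_neg]
@[simp] theorem sub_c1 (f g : Grass) : (f - g).c1 = f.c1 - g.c1 := by
  simp [sub_eq_add_neg]
@[simp] theorem sub_c2 (f g : Grass) : (f - g).c2 = f.c2 - g.c2 := by
  simp [sub_eq_add_neg]
@[simp] theorem sub_c12 (f g : Grass) : (f - g).c12 = f.c12 - g.c12 := by
  simp [sub_eq_add_neg]

/-- `f` is homogeneous of parity `q` (even for `q = 0`, odd for `q = 1`). -/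
def IsHomog (q : ZMod 2) (f : Grass) : Prop :=
  if q = 0 then f.c1 = 0 ∧ f.c2 = 0 else f.body = 0 ∧ f.c12 = 0

end Grass

/-! ### The projective plane and its three standard charts -/

/-- The complex projective plane. -/
def P2 : Type := Projectivization ℂ (Fin 3 → ℂ)

/-- The quotient topology from `ℂ³ ∖ {0}`. -/
instance : TopologicalSpace P2 :=
  TopologicalSpace.coinduced
    (Projectivization.mk' ℂ : {v : Fin 3 → ℂ // v ≠ 0} → Projectivization ℂ (Fin 3 → ℂ))
    inferInstance

/-- Homogeneous coordinates of the point of `{X_i ≠ 0}` with affine coordinates `x`. -/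
def chartVec : Fin 3 → ℂ × ℂ → Fin 3 → ℂ
  | 0, x => ![1, x.1, x.2]
  | 1, x => ![x.1, 1, x.2]
  | 2, x => ![x.1, x.2, 1]

theorem chartVec_self (i : Fin 3) (x : ℂ × ℂ) : chartVec i x i = 1 := by
  fin_cases i <;> rfl

theorem chartVec_ne_zero (i : Fin 3) (x : ℂ × ℂ) : chartVec i x ≠ 0 := fun h => by
  have := congrFun h i
  rw [chartVec_self] at this
  exact one_ne_zero this

/-- The affine chart `ℂ² ≃ {X_i ≠ 0} ⊆ ℙ²`. -/
def chart (i : Fin 3) (x : ℂ × ℂ) : P2 := Projectivization.mk ℂ (chartVec i x) (chartVec_ne_zero i x)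

theorem continuous_chart (i : Fin 3) : Continuous (chart i) := by
  have h1 : Continuous (Y := P2)
      (fun v : {v : Fin 3 → ℂ // v ≠ 0} => Projectivization.mk' ℂ v) := continuous_coinduced_rng
  have h2 : Continuous (fun x => (⟨chartVec i x, chartVec_ne_zero i x⟩ :
      {v : Fin 3 → ℂ // v ≠ 0})) := by
    refine Continuous.subtype_mk ?_ _
    refine continuous_pi fun j => ?_
    fin_cases i <;> fin_cases j <;> simp [chartVec] <;> fun_prop
  exact h1.comp h2

/-- The open subset of `ℂ²` that corresponds to `V ∩ {X_i ≠ 0}`. -/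
def dom (V : TopologicalSpace.Opens P2) (i : Fin 3) : Set (ℂ × ℂ) := chart i ⁻¹' V

theorem isOpen_dom (V : TopologicalSpace.Opens P2) (i : Fin 3) : IsOpen (dom V i) :=
  V.isOpen.preimage (continuous_chart i)

theorem dom_mono {V' V : TopologicalSpace.Opens P2} (h : V' ≤ V) (i : Fin 3) :
    dom V' i ⊆ dom V i := fun _ hx => h hx

/-- Two points of two charts that have proportional homogeneous coordinates lie in the same open
sets. -/
theorem mem_dom_of_smul {V : TopologicalSpace.Opens P2} {i j : Fin 3} {x y : ℂ × ℂ} (t : ℂˣ)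
    (h : t • chartVec j y = chartVec i x) (hx : x ∈ dom V i) : y ∈ dom V j := by
  have : chart i x = chart j y := (Projectivization.mk_eq_mk_iff ℂ _ _ _ _).2 ⟨t, h⟩
  change chart j y ∈ V
  rw [← this]
  exact hx

/-! ### Superfunctions on open subsets of `ℂ^{2|2}` -/

/-- Extension by zero, so that Mathlib's differential calculus on `ℂ²` applies. -/
def ext0 {W : Set (ℂ × ℂ)} (f : W → Grass) : ℂ × ℂ → Grass := Function.extend Subtype.val f 0

theorem ext0_apply {W : Set (ℂ × ℂ)} (f : W → Grass) {x : ℂ × ℂ} (hx : x ∈ W) :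
    ext0 f x = f ⟨x, hx⟩ :=
  Subtype.val_injective.extend_apply f 0 ⟨x, hx⟩

/-- All four components of a Grassmann-valued function are holomorphic at `x`. -/
structure HolAt (F : ℂ × ℂ → Grass) (x : ℂ × ℂ) : Prop where
  body : AnalyticAt ℂ (fun y => (F y).body) x
  c1 : AnalyticAt ℂ (fun y => (F y).c1) x
  c2 : AnalyticAt ℂ (fun y => (F y).c2) x
  c12 : AnalyticAt ℂ (fun y => (F y).c12) x

/-- `f` is a superfunction on `W`: an element of `𝒪(W) ⊗ ℂ[θ₁, θ₂]`. -/
def IsHol {W : Set (ℂ × ℂ)} (f : W → Grass) : Prop := ∀ x ∈ W, HolAt (ext0 f) x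

/-- The value of `F (y + ν θ₁θ₂ | a θ₁, b θ₂)`, where the dependence on the nilpotent part of the
even arguments is, as usual, given by the (terminating) Taylor expansion. -/
def pull (F : ℂ × ℂ → Grass) (y ν : ℂ × ℂ) (a b : ℂ) : Grass where
  body := (F y).body
  c1 := a * (F y).c1
  c2 := b * (F y).c2
  c12 := a * b * (F y).c12 + fderiv ℂ (fun u => (F u).body) y ν

theorem HolAt.congr {F G : ℂ × ℂ → Grass} {x : ℂ × ℂ} (hF : HolAt F x) (h : F =ᶠ[nhds x] G) :
    HolAt G x where
  body := hF.body.congr (h.fun_comp Grass.body)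
  c1 := hF.c1.congr (h.fun_comp Grass.c1)
  c2 := hF.c2.congr (h.fun_comp Grass.c2)
  c12 := hF.c12.congr (h.fun_comp Grass.c12)

theorem pull_congr {F G : ℂ × ℂ → Grass} {y : ℂ × ℂ} (h : F =ᶠ[nhds y] G) (ν : ℂ × ℂ) (a b : ℂ) :
    pull F y ν a b = pull G y ν a b := by
  have h1 : F y = G y := h.eq_of_nhds
  have h2 : fderiv ℂ (fun u => (F u).body) y = fderiv ℂ (fun u => (G u).body) y :=
    (h.fun_comp Grass.body).fderiv_eq
  simp only [pull, h1, h2]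

theorem HolAt.algebraMap (r : ℂ) (x : ℂ × ℂ) : HolAt (fun _ => algebraMap ℂ Grass r) x :=
  ⟨analyticAt_const, analyticAt_const, analyticAt_const, analyticAt_const⟩

theorem HolAt.add {F G : ℂ × ℂ → Grass} {x : ℂ × ℂ} (hF : HolAt F x) (hG : HolAt G x) :
    HolAt (fun y => F y + G y) x :=
  ⟨hF.body.fun_add hG.body, hF.c1.fun_add hG.c1, hF.c2.fun_add hG.c2, hF.c12.fun_add hG.c12⟩

theorem HolAt.mul {F G : ℂ × ℂ → Grass} {x : ℂ × ℂ} (hF : HolAt F x) (hG : HolAt G x) :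
    HolAt (fun y => F y * G y) x :=
  ⟨hF.body.fun_mul hG.body, (hF.body.fun_mul hG.c1).fun_add (hF.c1.fun_mul hG.body),
    (hF.body.fun_mul hG.c2).fun_add (hF.c2.fun_mul hG.body),
    (((hF.body.fun_mul hG.c12).fun_add (hF.c12.fun_mul hG.body)).fun_add
      (hF.c1.fun_mul hG.c2)).fun_sub (hF.c2.fun_mul hG.c1)⟩

theorem pull_algebraMap (r : ℂ) (y ν : ℂ × ℂ) (a b : ℂ) :
    pull (fun _ => algebraMap ℂ Grass r) y ν a b = algebraMap ℂ Grass r := by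
  ext <;> simp [pull]

theorem pull_add {F G : ℂ × ℂ → Grass} {y : ℂ × ℂ} (hF : HolAt F y) (hG : HolAt G y)
    (ν : ℂ × ℂ) (a b : ℂ) :
    pull (fun u => F u + G u) y ν a b = pull F y ν a b + pull G y ν a b := by
  ext
  · simp [pull]
  · simp [pull, mul_add]
  · simp [pull, mul_add]
  · simp only [pull, Grass.add_c12, Grass.add_body]
    rw [fderiv_fun_add hF.body.differentiableAt hG.body.differentiableAt]
    simp only [add_apply]
    ring

theorem pull_mul {F G : ℂ × ℂ → Grass} {y : ℂ × ℂ} (hF : HolAt F y) (hG : HolAt G y)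
    (ν : ℂ × ℂ) (a b : ℂ) :
    pull (fun u => F u * G u) y ν a b = pull F y ν a b * pull G y ν a b := by
  ext
  · simp [pull]
  · simp only [pull, Grass.mul_c1]; ring
  · simp only [pull, Grass.mul_c2]; ring
  · simp only [pull, Grass.mul_c12, Grass.mul_body]
    rw [fderiv_fun_mul hF.body.differentiableAt hG.body.differentiableAt]
    simp only [add_apply, smul_apply, smul_eq_mul]
    ring

theorem ext0_eventuallyEq {W : Set (ℂ × ℂ)} (hW : IsOpen W) {f : W → Grass} {G : ℂ × ℂ → Grass}
    (h : ∀ x : W, f x = G x) {y : ℂ × ℂ} (hy : y ∈ W) : G =ᶠ[nhds y] ext0 f := by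
  filter_upwards [hW.mem_nhds hy] with u hu
  rw [ext0_apply f hu, h]

/-! ### The structure sheaf -/

/-- The conditions that a triple of Grassmann-valued functions, `s i` being the expression in the
coordinates `(z_{1i}, z_{2i} | θ_{1i}, θ_{2i})` of the `i`-th chart, has to satisfy in order to be a
section over `V` of the structure sheaf of the supermanifold glued from three copies of `ℂ^{2|2}` by
* `z₁₀ = 1 / z₁₁`, `z₂₀ = z₂₁ / z₁₁ + λ θ₁₁θ₂₁ / z₁₁²`, `θ₁₀ = θ₁₁ / z₁₁`, `θ₂₀ = θ₂₁ / z₁₁²`;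
* `z₁₁ = z₁₂ / z₂₂ + λ θ₁₂θ₂₂ / z₂₂²`, `z₂₁ = 1 / z₂₂`, `θ₁₁ = θ₁₂ / z₂₂`, `θ₂₁ = θ₂₂ / z₂₂²`;
* `z₁₂ = 1 / z₂₀`, `z₂₂ = z₁₀ / z₂₀ + λ θ₁₀θ₂₀ / z₂₀²`, `θ₁₂ = θ₁₀ / z₂₀`, `θ₂₂ = θ₂₀ / z₂₀²`. -/
structure IsSection (lam : ℂ) (V : TopologicalSpace.Opens P2) (s : ∀ i, dom V i → Grass) :
    Prop where
  hol : ∀ i, IsHol (s i)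
  glue01 : ∀ x : dom V 1, x.1.1 ≠ 0 → s 1 x =
    pull (ext0 (s 0)) (1 / x.1.1, x.1.2 / x.1.1) (0, lam / x.1.1 ^ 2) (1 / x.1.1) (1 / x.1.1 ^ 2)
  glue12 : ∀ x : dom V 2, x.1.2 ≠ 0 → s 2 x =
    pull (ext0 (s 1)) (x.1.1 / x.1.2, 1 / x.1.2) (lam / x.1.2 ^ 2, 0) (1 / x.1.2) (1 / x.1.2 ^ 2)
  glue20 : ∀ x : dom V 0, x.1.2 ≠ 0 → s 0 x =
    pull (ext0 (s 2)) (1 / x.1.2, x.1.1 / x.1.2) (0, lam / x.1.2 ^ 2) (1 / x.1.2) (1 / x.1.2 ^ 2)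

theorem mem_dom01 {V : TopologicalSpace.Opens P2} {x : ℂ × ℂ} (hx : x ∈ dom V 1) (h : x.1 ≠ 0) :
    ((1 / x.1, x.2 / x.1) : ℂ × ℂ) ∈ dom V 0 := by
  refine mem_dom_of_smul (Units.mk0 x.1 h) ?_ hx
  funext j
  fin_cases j <;> simp [chartVec, Units.smul_def] <;> field_simp

theorem mem_dom12 {V : TopologicalSpace.Opens P2} {x : ℂ × ℂ} (hx : x ∈ dom V 2) (h : x.2 ≠ 0) :
    ((x.1 / x.2, 1 / x.2) : ℂ × ℂ) ∈ dom V 1 := by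
  refine mem_dom_of_smul (Units.mk0 x.2 h) ?_ hx
  funext j
  fin_cases j <;> simp [chartVec, Units.smul_def] <;> field_simp

theorem mem_dom20 {V : TopologicalSpace.Opens P2} {x : ℂ × ℂ} (hx : x ∈ dom V 0) (h : x.2 ≠ 0) :
    ((1 / x.2, x.1 / x.2) : ℂ × ℂ) ∈ dom V 2 := by
  refine mem_dom_of_smul (Units.mk0 x.2 h) ?_ hx
  funext j
  fin_cases j <;> simp [chartVec, Units.smul_def] <;> field_simp

/-- The `ℂ`-algebra `𝒪_M(V)` of sections over `V` of the structure sheaf of `M`. -/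
def structureSheaf (lam : ℂ) (V : TopologicalSpace.Opens P2) :
    Subalgebra ℂ (∀ i, dom V i → Grass) where
  carrier := {s | IsSection lam V s}
  algebraMap_mem' r :=
    have key : ∀ i, ∀ y ∈ dom V i,
        (fun _ => algebraMap ℂ Grass r) =ᶠ[nhds y]
          ext0 (algebraMap ℂ (∀ i, dom V i → Grass) r i) := fun i _ hy =>
      ext0_eventuallyEq (isOpen_dom V i) (fun _ => rfl) hy
    { hol := fun i y hy => (HolAt.algebraMap r y).congr (key i y hy)
      glue01 := fun x hx => by
        rw [← pull_congr (key 0 _ (mem_dom01 x.2 hx)), pull_algebraMap]; rfl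
      glue12 := fun x hx => by
        rw [← pull_congr (key 1 _ (mem_dom12 x.2 hx)), pull_algebraMap]; rfl
      glue20 := fun x hx => by
        rw [← pull_congr (key 2 _ (mem_dom20 x.2 hx)), pull_algebraMap]; rfl }
  add_mem' {s t} hs ht :=
    have key : ∀ i, ∀ y ∈ dom V i,
        (fun u => ext0 (s i) u + ext0 (t i) u) =ᶠ[nhds y] ext0 ((s + t) i) := fun i _ hy =>
      ext0_eventuallyEq (isOpen_dom V i)
        (fun x => by rw [ext0_apply _ x.2, ext0_apply _ x.2]; rfl) hy
    { hol := fun i y hy => ((hs.hol i y hy).add (ht.hol i y hy)).congr (key i y hy)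
      glue01 := fun x hx => by
        have hy := mem_dom01 x.2 hx
        rw [← pull_congr (key 0 _ hy), pull_add (hs.hol 0 _ hy) (ht.hol 0 _ hy),
          ← hs.glue01 x hx, ← ht.glue01 x hx]; rfl
      glue12 := fun x hx => by
        have hy := mem_dom12 x.2 hx
        rw [← pull_congr (key 1 _ hy), pull_add (hs.hol 1 _ hy) (ht.hol 1 _ hy),
          ← hs.glue12 x hx, ← ht.glue12 x hx]; rfl
      glue20 := fun x hx => by
        have hy := mem_dom20 x.2 hx
        rw [← pull_congr (key 2 _ hy), pull_add (hs.hol 2 _ hy) (ht.hol 2 _ hy),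
          ← hs.glue20 x hx, ← ht.glue20 x hx]; rfl }
  mul_mem' {s t} hs ht :=
    have key : ∀ i, ∀ y ∈ dom V i,
        (fun u => ext0 (s i) u * ext0 (t i) u) =ᶠ[nhds y] ext0 ((s * t) i) := fun i _ hy =>
      ext0_eventuallyEq (isOpen_dom V i)
        (fun x => by rw [ext0_apply _ x.2, ext0_apply _ x.2]; rfl) hy
    { hol := fun i y hy => ((hs.hol i y hy).mul (ht.hol i y hy)).congr (key i y hy)
      glue01 := fun x hx => by
        have hy := mem_dom01 x.2 hx
        rw [← pull_congr (key 0 _ hy), pull_mul (hs.hol 0 _ hy) (ht.hol 0 _ hy),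
          ← hs.glue01 x hx, ← ht.glue01 x hx]; rfl
      glue12 := fun x hx => by
        have hy := mem_dom12 x.2 hx
        rw [← pull_congr (key 1 _ hy), pull_mul (hs.hol 1 _ hy) (ht.hol 1 _ hy),
          ← hs.glue12 x hx, ← ht.glue12 x hx]; rfl
      glue20 := fun x hx => by
        have hy := mem_dom20 x.2 hx
        rw [← pull_congr (key 2 _ hy), pull_mul (hs.hol 2 _ hy) (ht.hol 2 _ hy),
          ← hs.glue20 x hx, ← ht.glue20 x hx]; rfl }

/-- The restriction maps `𝒪_M(V) → 𝒪_M(V')` for `V' ⊆ V`. -/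
def res {lam : ℂ} {V' V : TopologicalSpace.Opens P2} (h : V' ≤ V) :
    structureSheaf lam V →ₗ[ℂ] structureSheaf lam V' where
  toFun s := ⟨fun i x => s.1 i ⟨x.1, dom_mono h i x.2⟩,
    have key : ∀ i, ∀ y ∈ dom V' i, ext0 (s.1 i) =ᶠ[nhds y]
        ext0 (fun x : dom V' i => s.1 i ⟨x.1, dom_mono h i x.2⟩) := fun i _ hy =>
      ext0_eventuallyEq (isOpen_dom V' i) (fun x => (ext0_apply _ (dom_mono h i x.2)).symm) hy
    { hol := fun i y hy => (s.2.hol i y (dom_mono h i hy)).congr (key i y hy)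
      glue01 := fun x hx => by
        rw [← pull_congr (key 0 _ (mem_dom01 x.2 hx))]; exact s.2.glue01 ⟨x.1, _⟩ hx
      glue12 := fun x hx => by
        rw [← pull_congr (key 1 _ (mem_dom12 x.2 hx))]; exact s.2.glue12 ⟨x.1, _⟩ hx
      glue20 := fun x hx => by
        rw [← pull_congr (key 2 _ (mem_dom20 x.2 hx))]; exact s.2.glue20 ⟨x.1, _⟩ hx }⟩
  map_add' _ _ := rfl
  map_smul' _ _ := rfl

/-- A section of the structure sheaf is homogeneous of parity `q`. -/
def IsHomogSection {lam : ℂ} {V : TopologicalSpace.Opens P2} (q : ZMod 2)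
    (s : structureSheaf lam V) : Prop :=
  ∀ i x, (s.1 i x).IsHomog q

theorem IsHomogSection.zero {lam : ℂ} {V : TopologicalSpace.Opens P2} (q : ZMod 2) :
    IsHomogSection q (0 : structureSheaf lam V) := fun i x => by
  change Grass.IsHomog q 0
  unfold Grass.IsHomog; split_ifs <;> simp

theorem IsHomogSection.add {lam : ℂ} {V : TopologicalSpace.Opens P2} {q : ZMod 2}
    {s t : structureSheaf lam V} (hs : IsHomogSection q s) (ht : IsHomogSection q t) :
    IsHomogSection q (s + t) := fun i x => by
  have h1 := hs i x
  have h2 := ht i x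
  change Grass.IsHomog q (s.1 i x + t.1 i x)
  unfold Grass.IsHomog at *
  split_ifs at * <;> simp [h1, h2]

theorem IsHomogSection.smul {lam : ℂ} {V : TopologicalSpace.Opens P2} {q : ZMod 2} (r : ℂ)
    {s : structureSheaf lam V} (hs : IsHomogSection q s) : IsHomogSection q (r • s) :=
  fun i x => by
  have h1 := hs i x
  change Grass.IsHomog q (r • s.1 i x)
  unfold Grass.IsHomog at *
  split_ifs at * <;> simp [h1]

/-! ### The tangent sheaf -/

/-- The sections over `U` of parity `p` of the tangent sheaf `𝒯_M = Der(𝒪_M)`: the `ℂ`-linear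
endomorphisms of the sheaf `𝒪_M` restricted to `U` that are homogeneous of parity `p` and satisfy
the graded Leibniz rule `D (f g) = D f · g + (-1)^{p |f|} f · D g`. -/
def tangentSheaf (lam : ℂ) (U : TopologicalSpace.Opens P2) (p : ZMod 2) :
    Submodule ℂ (∀ V : {V : TopologicalSpace.Opens P2 // V ≤ U},
      Module.End ℂ (structureSheaf lam V.1)) where
  carrier := {D |
    (∀ (V V' : {V : TopologicalSpace.Opens P2 // V ≤ U}) (h : V'.1 ≤ V.1)
      (f : structureSheaf lam V.1), res h (D V f) = D V' (res h f)) ∧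
    (∀ V (q : ZMod 2) (f : structureSheaf lam V.1),
      IsHomogSection q f → IsHomogSection (p + q) (D V f)) ∧
    (∀ V (q : ZMod 2) (f g : structureSheaf lam V.1), IsHomogSection q f →
      D V (f * g) = D V f * g + (-1 : ℂ) ^ (p * q).val • (f * D V g))}
  zero_mem' := by
    refine ⟨fun V V' h f => ?_, fun V q f _ => IsHomogSection.zero _, fun V q f g _ => ?_⟩
    · simp
    · simp
  add_mem' := by
    rintro D E ⟨h1, h2, h3⟩ ⟨k1, k2, k3⟩
    refine ⟨fun V V' h f => ?_, fun V q f hf => (h2 V q f hf).add (k2 V q f hf),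
      fun V q f g hf => ?_⟩
    · simp [h1 V V' h f, k1 V V' h f]
    · simp only [Pi.add_apply, LinearMap.add_apply, h3 V q f g hf, k3 V q f g hf, add_mul,
        mul_add, smul_add]
      abel
  smul_mem' := by
    rintro r D ⟨h1, h2, h3⟩
    refine ⟨fun V V' h f => ?_, fun V q f hf => (h2 V q f hf).smul r, fun V q f g hf => ?_⟩
    · simp [h1 V V' h f]
    · simp only [Pi.smul_apply, LinearMap.smul_apply, h3 V q f g hf, smul_add, smul_mul_assoc,
        mul_smul_comm]
      rw [smul_comm]

/-- The homogeneous part of parity `p` of `H⁰(𝒯_M)`. -/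
abbrev H0T (lam : ℂ) (p : ZMod 2) := tangentSheaf lam ⊤ p

/-! ### Vector fields in the chart `U₀` -/

/-- The four coordinates `z₁, z₂ | θ₁, θ₂` of `ℂ^{2|2}`. -/
def z₁ : ℂ × ℂ → Grass := fun x => ⟨x.1, 0, 0, 0⟩
def z₂ : ℂ × ℂ → Grass := fun x => ⟨x.2, 0, 0, 0⟩
def θ₁ : ℂ × ℂ → Grass := fun _ => ⟨0, 1, 0, 0⟩
def θ₂ : ℂ × ℂ → Grass := fun _ => ⟨0, 0, 1, 0⟩

/-- The partial derivatives of a superfunction along `z₁, z₂ | θ₁, θ₂` (left derivatives in the odd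
directions). -/
def partialDeriv (F : ℂ × ℂ → Grass) (x : ℂ × ℂ) : Fin 4 → Grass :=
  let dz (e : ℂ × ℂ) : Grass :=
    ⟨fderiv ℂ (fun u => (F u).body) x e, fderiv ℂ (fun u => (F u).c1) x e,
      fderiv ℂ (fun u => (F u).c2) x e, fderiv ℂ (fun u => (F u).c12) x e⟩
  ![dz (1, 0), dz (0, 1), ⟨(F x).c1, 0, (F x).c12, 0⟩, ⟨(F x).c2, -(F x).c12, 0, 0⟩]

/-- A vector field on `ℂ^{2|2}`, given by its coefficients: `X` stands for
`X 0 ∂_{z₁} + X 1 ∂_{z₂} + X 2 ∂_{θ₁} + X 3 ∂_{θ₂}`. -/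
abbrev VectorField : Type := Fin 4 → ℂ × ℂ → Grass

/-- The value at `x` of the vector field `X` applied to the superfunction `F`. -/
def VectorField.apply (X : VectorField) (F : ℂ × ℂ → Grass) (x : ℂ × ℂ) : Grass :=
  ∑ a, X a x * partialDeriv F x a

/-- The coordinate vector fields `∂_{z₁}, ∂_{z₂} | ∂_{θ₁}, ∂_{θ₂}`. -/
def dz₁ : VectorField := Pi.single 0 1
def dz₂ : VectorField := Pi.single 1 1
def dθ₁ : VectorField := Pi.single 2 1
def dθ₂ : VectorField := Pi.single 3 1

/-- In the chart `U₀`, the global vector field `D` is given by `X`. -/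
def IsGivenInU0 {lam : ℂ} {p : ZMod 2} (D : H0T lam p) (X : VectorField) : Prop :=
  ∀ (V : TopologicalSpace.Opens P2) (f : structureSheaf lam V) (x : dom V 0),
    (D.1 ⟨V, le_top⟩ f).1 0 x = X.apply (ext0 (f.1 0)) x

/-- The even vector fields `𝒱₁, …, 𝒱₁₂`. -/
def evenField (lam : ℂ) : Fin 12 → VectorField :=
  ![dz₁,
    dz₂,
    z₂ • dz₁,
    z₁ • dz₂,
    z₁ • dz₁ - z₂ • dz₂,
    θ₁ • dθ₂,
    (z₁ * θ₁) • dθ₂,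
    (z₂ * θ₁) • dθ₂,
    θ₁ • dθ₁ + z₂ • dz₂,
    θ₂ • dθ₂ + z₂ • dz₂,
    z₁ ^ 2 • dz₁ + (z₁ * z₂ + lam • (θ₁ * θ₂)) • dz₂ + (z₁ * θ₁) • dθ₁ + (2 * z₁ * θ₂) • dθ₂,
    (z₁ * z₂ - lam • (θ₁ * θ₂)) • dz₁ + z₂ ^ 2 • dz₂ + (z₂ * θ₁) • dθ₁ + (2 * z₂ * θ₂) • dθ₂]

/-- The odd vector fields `Ξ₁, …, Ξ₁₂`. -/
def oddField (lam : ℂ) : Fin 12 → VectorField :=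
  ![dθ₁,
    dθ₂,
    θ₁ • dz₁,
    θ₁ • dz₂,
    z₁ • dθ₂,
    z₂ • dθ₂,
    z₁ ^ 2 • dθ₂ - (lam • (z₁ * θ₁)) • dz₂,
    z₂ ^ 2 • dθ₂ + (lam • (z₂ * θ₁)) • dz₁,
    z₁ • dθ₁ + (lam • θ₂) • dz₂,
    -(z₂ • dθ₁) + (lam • θ₂) • dz₁,
    (z₁ * θ₁) • dz₁ + (z₂ * θ₁) • dz₂ + (2 * θ₁ * θ₂) • dθ₂,
    (z₁ * z₂ - lam • (θ₁ * θ₂)) • dθ₂ - (lam • (z₂ * θ₁)) • dz₂]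

end SuperPlane

end

noncomputable section

namespace SuperPlane

open Filter Topology

/-! ### Hadamard's lemma -/

/-! A global derivation is the same thing as three vector fields on `ℂ^{2|2}`, one for each chart,
that match under the transition functions. Computing `H⁰(𝒯_M)` thereby becomes a problem about
entire functions on the chart `U₀` with prescribed behaviour at infinity.

The translation rests on `IsDerivAlong.eq_zero`: a superderivation along a morphism is determined by
its values on the four coordinates. Along the identity this gives `H0T.apply_eq`, by which the
abstract sheaf endomorphism is the vector field whose coefficients are its values on the
coordinates. Along a transition map it gives `apply_pull_of_coord`, so that matching only has to be
tested on coordinates; hence compatible triples define elements of `H⁰` (`IsGlobal.toH0T`). By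
density of `U₀` the first chart determines everything (`H0T.ext_of_coeff`).

For the upper bound, split the matching equations into Grassmann components. The leading components
have poles of order at most 0, 1 or 2 at infinity, so by Cauchy's estimate and Liouville's theorem
they are polynomials of that degree. Regularity on the line `w₁ = 0` of chart 1 then yields linear
relations between their coefficients. Once an explicit field with the same leading part is
subtracted, the remaining components decay at infinity and vanish by `eq_zero_of_decay`.

In the even case the leading data have thirteen parameters: eight from `H⁰(𝒯_{ℙ²})`, three from
`H⁰(𝒪(1))` (the fields sending `θ₂` to a multiple of `θ₁`), and two for the scalings of `θ₁` and
`θ₂`. In the split case `λ = 0` all of them would survive. For `λ ≠ 0` a rescaling of the odd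
coordinates also rescales the class `ω`, and this must be compensated by the trace of the linear
part in `z`. That single condition, extracted in `coeff_eq_zero_of_even`, leaves twelve.

In the odd case there are `3 + 6` parameters for the `∂_{θ₁}`- and `∂_{θ₂}`-coefficients (sections
of `𝒪(1)` and `𝒪(2)`) and three for `θ₁` times an even field. Here `λ` only produces correction
terms and no condition, so the count is twelve for every `λ`.

For the lower bound, `evenGlobal` and `oddGlobal` exhibit the general solution in all three charts,
and matching is a finite list of rational identities. -/

/-- Hadamard's lemma for analytic functions. -/
theorem _root_.AnalyticAt.exists_clm_sub {E F : Type*} [NormedAddCommGroup E] [NormedSpace ℂ E]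
    [NormedAddCommGroup F] [NormedSpace ℂ F] [CompleteSpace F] {f : E → F} {y : E}
    (hf : AnalyticAt ℂ f y) :
    ∃ g : E → E →L[ℂ] F, AnalyticAt ℂ g y ∧ ∀ᶠ u in 𝓝 y, f u = f y + g u (u - y) := by
  obtain ⟨p, r, hp⟩ := hf
  have hrad : 0 < p.shift.radius := by
    rw [FormalMultilinearSeries.radius_shift]; exact hp.r_pos.trans_le hp.r_le
  have h1 := p.shift.hasFPowerSeriesOnBall hrad
  have h2 := (h1.comp_sub y)
  rw [zero_add] at h2
  refine ⟨_, h2.analyticAt, ?_⟩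
  have h3 := h2.unshift (z := f y)
  -- Shifting the series of `f` and unshifting it with constant term `f y` gives the same series
  -- back. Hence both sides of the claim are sums of one series near `y`.
  have h4 : p.shift.unshift (f y) = p := by
    ext n v
    cases n with
    | zero =>
      have := hp.coeff_zero v
      simp [FormalMultilinearSeries.unshift, this]
    | succ n => simp [FormalMultilinearSeries.unshift, FormalMultilinearSeries.shift]
  rw [h4] at h3
  have h5 := hp.hasFPowerSeriesAt
  have h6 := h3.hasFPowerSeriesAt
  filter_upwards [h5.eventually_hasSum_sub, h6.eventually_hasSum_sub] with u a b
  exact a.unique b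

theorem _root_.AnalyticAt.clm_apply_const {E F G : Type*} [NormedAddCommGroup E] [NormedSpace ℂ E]
    [NormedAddCommGroup F] [NormedSpace ℂ F] [NormedAddCommGroup G] [NormedSpace ℂ G]
    {g : E → F →L[ℂ] G} {y : E} (hg : AnalyticAt ℂ g y) (v : F) :
    AnalyticAt ℂ (fun u => g u v) y :=
  ((ContinuousLinearMap.apply ℂ G v).analyticAt (g y)).comp hg

theorem exists_hadamard {f : ℂ × ℂ → ℂ} {y : ℂ × ℂ} (hf : AnalyticAt ℂ f y) :
    ∃ g₁ g₂ : ℂ × ℂ → ℂ, AnalyticAt ℂ g₁ y ∧ AnalyticAt ℂ g₂ y ∧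
      ∀ᶠ u in 𝓝 y, f u = f y + (g₁ u * (u.1 - y.1) + g₂ u * (u.2 - y.2)) := by
  obtain ⟨g, hg, h⟩ := hf.exists_clm_sub
  refine ⟨fun u => g u (1, 0), fun u => g u (0, 1), hg.clm_apply_const _, hg.clm_apply_const _, ?_⟩
  filter_upwards [h] with u hu
  rw [hu]
  have : u - y = (u.1 - y.1) • ((1, 0) : ℂ × ℂ) + (u.2 - y.2) • ((0, 1) : ℂ × ℂ) := by
    ext <;> simp
  rw [this, map_add, map_smul, map_smul]
  simp only [smul_eq_mul]
  ring

/-! ### Derivations along a morphism are determined by the coordinates -/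

/-- The superfunction without odd part given by an ordinary function. -/
def ofBody (f : ℂ × ℂ → ℂ) : ℂ × ℂ → Grass := fun u => algebraMap ℂ Grass (f u)

theorem HolAt.ofBody {f : ℂ × ℂ → ℂ} {y : ℂ × ℂ} (hf : AnalyticAt ℂ f y) :
    HolAt (ofBody f) y :=
  ⟨hf, analyticAt_const, analyticAt_const, analyticAt_const⟩

theorem HolAt.add_fun {F G : ℂ × ℂ → Grass} {x : ℂ × ℂ} (hF : HolAt F x) (hG : HolAt G x) :
    HolAt (F + G) x := hF.add hG

theorem HolAt.mul_fun {F G : ℂ × ℂ → Grass} {x : ℂ × ℂ} (hF : HolAt F x) (hG : HolAt G x) :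
    HolAt (F * G) x := hF.mul hG

theorem holAt_z₁ (y : ℂ × ℂ) : HolAt z₁ y := HolAt.ofBody analyticAt_fst
theorem holAt_z₂ (y : ℂ × ℂ) : HolAt z₂ y := HolAt.ofBody analyticAt_snd
theorem holAt_θ₁ (y : ℂ × ℂ) : HolAt θ₁ y :=
  ⟨analyticAt_const, analyticAt_const, analyticAt_const, analyticAt_const⟩
theorem holAt_θ₂ (y : ℂ × ℂ) : HolAt θ₂ y :=
  ⟨analyticAt_const, analyticAt_const, analyticAt_const, analyticAt_const⟩

/-- A derivation of germs at `y` with values in the Grassmann algebra, along the morphism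
`F ↦ pull F y ν a b`; the Leibniz rule is only demanded if the first factor has no odd part. -/
structure IsDerivAlong (E : (ℂ × ℂ → Grass) → Grass) (y ν : ℂ × ℂ) (a b : ℂ) : Prop where
  congr : ∀ {F G}, HolAt F y → F =ᶠ[𝓝 y] G → E F = E G
  add : ∀ {F G}, HolAt F y → HolAt G y → E (F + G) = E F + E G
  leibniz : ∀ {f G}, AnalyticAt ℂ f y → HolAt G y →
    E (ofBody f * G) = E (ofBody f) * pull G y ν a b + pull (ofBody f) y ν a b * E G
  odd_mul : E θ₁ = 0 → E θ₂ = 0 → E (θ₁ * θ₂) = 0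
  const : ∀ c : ℂ, E (ofBody fun _ => c) = 0

/-- Hadamard's lemma writes a function as a constant plus multiples of `z₁ - y₁` and `z₂ - y₂`.
Along the morphism these factors do not pull back to zero but to `νᵢ θ₁θ₂`, so one application only
pushes the value of `E` into the ideal of `θ₁θ₂`. A second application, to the Hadamard quotients,
finishes because `(θ₁θ₂)² = 0`. Odd parts are reduced to this case by expanding in `θ₁, θ₂`. -/
theorem IsDerivAlong.eq_zero {E : (ℂ × ℂ → Grass) → Grass} {y ν : ℂ × ℂ} {a b : ℂ}
    (hE : IsDerivAlong E y ν a b) (h1 : E z₁ = 0) (h2 : E z₂ = 0) (h3 : E θ₁ = 0) (h4 : E θ₂ = 0)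
    {F : ℂ × ℂ → Grass} (hF : HolAt F y) : E F = 0 := by
  have sub (f : ℂ × ℂ → ℂ) (c : ℂ) (hf : AnalyticAt ℂ f y) (h : E (ofBody f) = 0) :
      E (ofBody fun u => f u - c) = 0 := by
    have : (ofBody fun u => f u - c) = ofBody f + ofBody fun _ => -c := by
      funext u; simp [ofBody, sub_eq_add_neg]
    rw [this, hE.add (.ofBody hf) (.ofBody analyticAt_const), h, hE.const, add_zero]
  have step (f : ℂ × ℂ → ℂ) (hf : AnalyticAt ℂ f y) : ∃ g₁ g₂ : ℂ × ℂ → ℂ,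
      AnalyticAt ℂ g₁ y ∧ AnalyticAt ℂ g₂ y ∧
      E (ofBody f) = E (ofBody g₁) * ⟨0, 0, 0, ν.1⟩ + E (ofBody g₂) * ⟨0, 0, 0, ν.2⟩ := by
    obtain ⟨g₁, g₂, hg₁, hg₂, h⟩ := exists_hadamard hf
    refine ⟨g₁, g₂, hg₁, hg₂, ?_⟩
    have a1 : AnalyticAt ℂ (fun u : ℂ × ℂ => u.1 - y.1) y := analyticAt_fst.sub analyticAt_const
    have a2 : AnalyticAt ℂ (fun u : ℂ × ℂ => u.2 - y.2) y := analyticAt_snd.sub analyticAt_const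
    have e : ofBody f =ᶠ[𝓝 y] (ofBody fun _ => f y) +
        (ofBody g₁ * (ofBody fun u => u.1 - y.1) + ofBody g₂ * (ofBody fun u => u.2 - y.2)) := by
      filter_upwards [h] with u hu
      simp [ofBody, hu]
    have p1 : pull (ofBody fun u => u.1 - y.1) y ν a b = ⟨0, 0, 0, ν.1⟩ := by
      have : HasFDerivAt (fun u : ℂ × ℂ => u.1 - y.1) (ContinuousLinearMap.fst ℂ ℂ ℂ) y :=
        hasFDerivAt_fst.sub_const _
      ext <;> simp [pull, ofBody, this.fderiv]
    have p2 : pull (ofBody fun u => u.2 - y.2) y ν a b = ⟨0, 0, 0, ν.2⟩ := by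
      have : HasFDerivAt (fun u : ℂ × ℂ => u.2 - y.2) (ContinuousLinearMap.snd ℂ ℂ ℂ) y :=
        hasFDerivAt_snd.sub_const _
      ext <;> simp [pull, ofBody, this.fderiv]
    rw [hE.congr (.ofBody hf) e, hE.add (.ofBody analyticAt_const)
      (((HolAt.ofBody hg₁).mul_fun (.ofBody a1)).add_fun ((HolAt.ofBody hg₂).mul_fun (.ofBody a2))), hE.const,
      hE.add ((HolAt.ofBody hg₁).mul_fun (.ofBody a1)) ((HolAt.ofBody hg₂).mul_fun (.ofBody a2)),
      hE.leibniz hg₁ (.ofBody a1), hE.leibniz hg₂ (.ofBody a2),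
      sub _ y.1 analyticAt_fst h1, sub _ y.2 analyticAt_snd h2, p1, p2]
    simp
  -- The second round of Hadamard: the values on the quotients `g₁, g₂` are themselves multiples of
  -- `θ₁θ₂`, so their products with `νᵢ θ₁θ₂` vanish.
  have body (f : ℂ × ℂ → ℂ) (hf : AnalyticAt ℂ f y) : E (ofBody f) = 0 := by
    obtain ⟨g₁, g₂, hg₁, hg₂, h⟩ := step f hf
    obtain ⟨k₁, k₂, -, -, h'⟩ := step g₁ hg₁
    obtain ⟨l₁, l₂, -, -, h''⟩ := step g₂ hg₂
    rw [h, h', h'']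
    ext <;> simp
  have dec : F = ofBody (fun u => (F u).body) + (ofBody (fun u => (F u).c1) * θ₁ +
      (ofBody (fun u => (F u).c2) * θ₂ + ofBody (fun u => (F u).c12) * (θ₁ * θ₂))) := by
    funext u
    ext <;> simp [ofBody, θ₁, θ₂]
  have h12 : E (θ₁ * θ₂) = 0 := hE.odd_mul h3 h4
  have b0 := HolAt.ofBody hF.body
  have b1 := (HolAt.ofBody hF.c1).mul_fun (holAt_θ₁ y)
  have b2 := (HolAt.ofBody hF.c2).mul_fun (holAt_θ₂ y)
  have b3 := (HolAt.ofBody hF.c12).mul_fun ((holAt_θ₁ y).mul_fun (holAt_θ₂ y))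
  rw [dec, hE.add b0 (b1.add_fun (b2.add_fun b3)), hE.add b1 (b2.add_fun b3), hE.add b2 b3,
    hE.leibniz hF.c1 (holAt_θ₁ y), hE.leibniz hF.c2 (holAt_θ₂ y),
    hE.leibniz hF.c12 ((holAt_θ₁ y).mul_fun (holAt_θ₂ y)), body _ hF.body, body _ hF.c1,
    body _ hF.c2, body _ hF.c12, h3, h4, h12]
  simp

/-! ### Entire functions with poles at infinity -/

/-- An entire function on `ℂ²` that extends to the line at infinity of `ℙ²` with a pole of order at
most `k` grows at most like the `k`-th power. -/
theorem exists_growth_bound {f g h : ℂ × ℂ → ℂ} (hf : Continuous f) (hg : Continuous g)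
    (hh : Continuous h) (k : ℕ)
    (h1 : ∀ z : ℂ × ℂ, z.1 ≠ 0 → f z = z.1 ^ k * g (1 / z.1, z.2 / z.1))
    (h2 : ∀ z : ℂ × ℂ, z.2 ≠ 0 → f z = z.2 ^ k * h (1 / z.2, z.1 / z.2)) :
    ∃ C, ∀ z, ‖f z‖ ≤ C * (1 + ‖z‖) ^ k := by
  have bd (F : ℂ × ℂ → ℂ) (hF : Continuous F) : ∃ C, 0 ≤ C ∧ ∀ z, ‖z‖ ≤ 1 → ‖F z‖ ≤ C := by
    obtain ⟨C, hC⟩ := (isCompact_closedBall (0 : ℂ × ℂ) 1).exists_bound_of_continuousOn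
      hF.continuousOn
    exact ⟨max C 0, le_max_right _ _, fun z hz => (hC z (by simpa using hz)).trans (le_max_left _ _)⟩
  obtain ⟨A, hA0, hA⟩ := bd f hf
  obtain ⟨B, hB0, hB⟩ := bd g hg
  obtain ⟨C, hC0, hC⟩ := bd h hh
  refine ⟨A + B + C, fun z => ?_⟩
  have hp : 1 ≤ (1 + ‖z‖) ^ k := one_le_pow₀ (by linarith [norm_nonneg z])
  -- Outside the unit ball, divide by the coordinate of larger modulus: the point then lies in the
  -- closed unit ball of the corresponding chart at infinity, where the other expression is bounded
  -- by compactness.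
  have key (x y F : ℂ) (D : ℝ) (hD0 : 0 ≤ D) (hx : 1 < ‖x‖) (hyx : ‖y‖ ≤ ‖x‖) (hxz : ‖x‖ = ‖z‖)
      (G : ℂ × ℂ → ℂ) (hG : ∀ z, ‖z‖ ≤ 1 → ‖G z‖ ≤ D) (hF : F = x ^ k * G (1 / x, y / x)) :
      ‖F‖ ≤ D * (1 + ‖z‖) ^ k := by
    have hx0 : 0 < ‖x‖ := by linarith
    have hn : ‖((1 / x, y / x) : ℂ × ℂ)‖ ≤ 1 := by
      rw [Prod.norm_def]
      refine max_le ?_ ?_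
      · simp only [norm_div, norm_one]; rw [div_le_one hx0]; exact hx.le
      · simp only [norm_div]; rw [div_le_one hx0]; exact hyx
    rw [hF, norm_mul, norm_pow, mul_comm]
    have : ‖x‖ ^ k ≤ (1 + ‖z‖) ^ k := by rw [hxz]; gcongr; linarith
    exact mul_le_mul (hG _ hn) this (by positivity) hD0
  have hz : ‖z‖ = max ‖z.1‖ ‖z.2‖ := Prod.norm_def z
  have mono (D : ℝ) (hD : D ≤ A + B + C) : D * (1 + ‖z‖) ^ k ≤ (A + B + C) * (1 + ‖z‖) ^ k := by
    gcongr
  rcases le_or_gt ‖z‖ 1 with hz1 | hz1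
  · have := hA z hz1
    nlinarith
  · rcases le_total ‖z.2‖ ‖z.1‖ with h12 | h12
    · rw [max_eq_left h12] at hz
      have hx : 1 < ‖z.1‖ := hz ▸ hz1
      exact (key z.1 z.2 _ B hB0 hx h12 hz.symm g hB
        (h1 z (norm_pos_iff.1 (by linarith)))).trans (mono _ (by linarith))
    · rw [max_eq_right h12] at hz
      have hx : 1 < ‖z.2‖ := hz ▸ hz1
      exact (key z.2 z.1 _ C hC0 hx h12 hz.symm h hC
        (h2 z (norm_pos_iff.1 (by linarith)))).trans (mono _ (by linarith))

theorem hasDerivAt_comp_line {f : ℂ × ℂ → ℂ} (hf : Differentiable ℂ f) (z e : ℂ × ℂ) (t : ℂ) :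
    HasDerivAt (fun t : ℂ => f (z + t • e)) (fderiv ℂ f (z + t • e) e) t := by
  have h1 : HasDerivAt (fun t : ℂ => z + t • e) e t := by
    simpa using ((hasDerivAt_id t).smul_const e).const_add z
  exact (hf _).hasFDerivAt.comp_hasDerivAt t h1

/-- Cauchy's estimate on the circle of radius `1 + ‖z‖` in the complex line through `z` with
direction `e`. Dividing by the radius lowers the order of growth by one. -/
theorem norm_fderiv_le_of_growth {f : ℂ × ℂ → ℂ} (hf : Differentiable ℂ f) {C : ℝ} {k : ℕ}
    (hC : ∀ z, ‖f z‖ ≤ C * (1 + ‖z‖) ^ (k + 1)) {e : ℂ × ℂ} (he : ‖e‖ ≤ 1) (z : ℂ × ℂ) :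
    ‖fderiv ℂ f z e‖ ≤ C * 2 ^ (k + 1) * (1 + ‖z‖) ^ k := by
  have hR : 0 < 1 + ‖z‖ := by positivity
  have hC0 : 0 ≤ C := by
    have := (norm_nonneg _).trans (hC 0)
    simpa using this
  have hd := fun t => hasDerivAt_comp_line hf z e t
  have h0 := (hd 0).deriv
  simp only [zero_smul, add_zero] at h0
  rw [← h0]
  have hdiff : Differentiable ℂ (fun t : ℂ => f (z + t • e)) := fun t => (hd t).differentiableAt
  refine (Complex.norm_deriv_le_of_forall_mem_sphere_norm_le hR hdiff.diffContOnCl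
    (C := C * (2 * (1 + ‖z‖)) ^ (k + 1)) fun t ht => ?_).trans_eq ?_
  · refine (hC _).trans ?_
    have ht' : ‖t‖ = 1 + ‖z‖ := by simpa using ht
    have : ‖z + t • e‖ ≤ ‖z‖ + (1 + ‖z‖) := by
      refine (norm_add_le _ _).trans ?_
      rw [norm_smul, ht']
      nlinarith
    gcongr
    linarith
  · rw [mul_pow]
    field_simp
    ring

theorem eq_const_of_growth {f : ℂ × ℂ → ℂ} (hf : Differentiable ℂ f) {C : ℝ}
    (hC : ∀ z, ‖f z‖ ≤ C * (1 + ‖z‖) ^ 0) : ∃ c, ∀ z, f z = c := by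
  refine ⟨f 0, fun z => hf.apply_eq_apply_of_bounded ?_ z 0⟩
  rw [isBounded_iff_forall_norm_le]
  refine ⟨C, ?_⟩
  rintro _ ⟨z, rfl⟩
  simpa using hC z

/-- Integration along the ray `t ↦ t z`. Symmetry of the second derivative is not used, so the mixed
coefficient appears as the mean of `c₁` and `b₂`. -/
theorem eq_of_fderiv_eq {f : ℂ × ℂ → ℂ} (hf : Differentiable ℂ f) {a₁ a₂ b₁ b₂ c₁ c₂ : ℂ}
    (h1 : ∀ z, fderiv ℂ f z (1, 0) = a₁ + b₁ * z.1 + c₁ * z.2)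
    (h2 : ∀ z, fderiv ℂ f z (0, 1) = a₂ + b₂ * z.1 + c₂ * z.2) (z : ℂ × ℂ) :
    f z = f 0 + a₁ * z.1 + a₂ * z.2 + b₁ / 2 * z.1 ^ 2 + (c₁ + b₂) / 2 * (z.1 * z.2)
      + c₂ / 2 * z.2 ^ 2 := by
  let g : ℂ → ℂ := fun t => f (0 + t • z) - ((a₁ * z.1 + a₂ * z.2) * t +
    (b₁ * z.1 ^ 2 + (c₁ + b₂) * (z.1 * z.2) + c₂ * z.2 ^ 2) * (t ^ 2 / 2))
  have hg (t : ℂ) : HasDerivAt g 0 t := by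
    have h3 := (hasDerivAt_comp_line hf 0 z t).sub
      (((hasDerivAt_id t).const_mul (a₁ * z.1 + a₂ * z.2)).add
        (((hasDerivAt_pow 2 t).div_const 2).const_mul
          (b₁ * z.1 ^ 2 + (c₁ + b₂) * (z.1 * z.2) + c₂ * z.2 ^ 2)))
    refine h3.congr_deriv ?_
    have hz : z = z.1 • ((1, 0) : ℂ × ℂ) + z.2 • ((0, 1) : ℂ × ℂ) := by ext <;> simp
    have : fderiv ℂ f (0 + t • z) z = z.1 * (a₁ + b₁ * (t * z.1) + c₁ * (t * z.2)) +
        z.2 * (a₂ + b₂ * (t * z.1) + c₂ * (t * z.2)) := by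
      conv_lhs => rw [show fderiv ℂ f (0 + t • z) z = fderiv ℂ f (0 + t • z)
        (z.1 • ((1, 0) : ℂ × ℂ) + z.2 • ((0, 1) : ℂ × ℂ)) from congrArg _ hz]
      rw [map_add, map_smul, map_smul, h1, h2]
      simp
    rw [this]
    push_cast
    ring
  have := is_const_of_deriv_eq_zero (fun t => (hg t).differentiableAt) (fun t => (hg t).deriv) 1 0
  simp only [g, one_smul, zero_add, zero_smul] at this
  linear_combination this

/-- The partial derivatives are bounded by Cauchy's estimate, hence constant by Liouville. The
quadratic case below repeats the argument one degree higher. -/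
theorem eq_affine_of_growth {f : ℂ × ℂ → ℂ} (hf : ∀ z, AnalyticAt ℂ f z) {C : ℝ}
    (hC : ∀ z, ‖f z‖ ≤ C * (1 + ‖z‖) ^ 1) : ∃ a b c, ∀ z, f z = a + b * z.1 + c * z.2 := by
  have hd : Differentiable ℂ f := fun z => (hf z).differentiableAt
  have hd' (e : ℂ × ℂ) : Differentiable ℂ (fun z => fderiv ℂ f z e) := fun z =>
    ((hf z).fderiv.clm_apply_const e).differentiableAt
  obtain ⟨b, hb⟩ := eq_const_of_growth (hd' (1, 0))
    (fun z => norm_fderiv_le_of_growth (k := 0) hd hC (by simp [Prod.norm_def]) z)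
  obtain ⟨c, hc⟩ := eq_const_of_growth (hd' (0, 1))
    (fun z => norm_fderiv_le_of_growth (k := 0) hd hC (by simp [Prod.norm_def]) z)
  refine ⟨f 0, b, c, fun z => ?_⟩
  rw [eq_of_fderiv_eq hd (a₁ := b) (a₂ := c) (b₁ := 0) (b₂ := 0) (c₁ := 0) (c₂ := 0)
    (by simpa using hb) (by simpa using hc) z]
  ring

theorem eq_quadratic_of_growth {f : ℂ × ℂ → ℂ} (hf : ∀ z, AnalyticAt ℂ f z) {C : ℝ}
    (hC : ∀ z, ‖f z‖ ≤ C * (1 + ‖z‖) ^ 2) : ∃ a b c d e l, ∀ z,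
      f z = a + b * z.1 + c * z.2 + d * z.1 ^ 2 + e * (z.1 * z.2) + l * z.2 ^ 2 := by
  have hd : Differentiable ℂ f := fun z => (hf z).differentiableAt
  have hd' (e : ℂ × ℂ) : ∀ z, AnalyticAt ℂ (fun z => fderiv ℂ f z e) z := fun z =>
    (hf z).fderiv.clm_apply_const e
  obtain ⟨a₁, b₁, c₁, h1⟩ := eq_affine_of_growth (hd' (1, 0))
    (fun z => norm_fderiv_le_of_growth (k := 1) hd hC (by simp [Prod.norm_def]) z)
  obtain ⟨a₂, b₂, c₂, h2⟩ := eq_affine_of_growth (hd' (0, 1))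
    (fun z => norm_fderiv_le_of_growth (k := 1) hd hC (by simp [Prod.norm_def]) z)
  exact ⟨f 0, a₁, a₂, b₁ / 2, (c₁ + b₂) / 2, c₂ / 2, eq_of_fderiv_eq hd h1 h2⟩

/-- Continuous functions on `ℂ²` that agree where the first coordinate does not vanish agree. -/
theorem eq_of_eq_off_line {g h : ℂ × ℂ → ℂ} (hg : Continuous g) (hh : Continuous h)
    (H : ∀ w : ℂ × ℂ, w.1 ≠ 0 → g w = h w) : g = h := by
  have hd : Dense {w : ℂ × ℂ | w.1 ≠ 0} := by
    have : Dense ({0}ᶜ : Set ℂ) := dense_compl_singleton 0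
    exact this.preimage isOpenMap_fst
  exact hg.ext_on hd hh H

/-- This is the vanishing of `H⁰(𝒪(-1))`. Absorbing the factor `1 / zᵢ` into `g` and `h` gives
growth of order zero, so `f` is constant, and the constant is its value at infinity. -/
theorem eq_zero_of_decay {f g h : ℂ × ℂ → ℂ} (hf : ∀ z, AnalyticAt ℂ f z) (hg : Continuous g)
    (hh : Continuous h)
    (h1 : ∀ z : ℂ × ℂ, z.1 ≠ 0 → f z = 1 / z.1 * g (1 / z.1, z.2 / z.1))
    (h2 : ∀ z : ℂ × ℂ, z.2 ≠ 0 → f z = 1 / z.2 * h (1 / z.2, z.1 / z.2)) (z : ℂ × ℂ) : f z = 0 := by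
  have hfc : Differentiable ℂ f := fun z => (hf z).differentiableAt
  obtain ⟨C, hC⟩ := exists_growth_bound (f := f) (g := fun w => w.1 * g w)
    (h := fun w => w.1 * h w) hfc.continuous (by fun_prop) (by fun_prop) 0
    (by simpa using h1) (by simpa using h2)
  obtain ⟨c, hc⟩ := eq_const_of_growth hfc hC
  -- The identity `w₁ g(w) = c` extends by continuity to `w₁ = 0`, where it reads `0 = c`.
  have := eq_of_eq_off_line (g := fun w => w.1 * g w) (h := fun _ => c) (by fun_prop) (by fun_prop)
    fun w hw => by
      have h3 := h1 (1 / w.1, w.2 / w.1) (by simpa using hw)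
      have e : ((1 / (1 / w.1), w.2 / w.1 / (1 / w.1)) : ℂ × ℂ) = w := by
        ext <;> simp [hw]
      simp only [e] at h3
      rw [hc] at h3
      simpa using h3.symm
  rw [hc, ← congrFun this 0]
  simp

/-! ### Transition functions -/

/-- The values of the coordinate functions `z₁, z₂ | θ₁, θ₂` of a chart under a change of
coordinates: `zᵢ = yᵢ + νᵢ θ₁θ₂`, `θ₁ = a θ₁`, `θ₂ = b θ₂`. -/
structure Subst where
  y : ℂ × ℂ
  ν : ℂ × ℂ
  a : ℂ
  b : ℂ

/-- Substitution in a superfunction. -/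
def Subst.pull (P : Subst) (F : ℂ × ℂ → Grass) : Grass := SuperPlane.pull F P.y P.ν P.a P.b

/-- The change of coordinates that expresses the coordinates of the `i`-th chart by those of the
`j`-th chart. -/
def tr (lam : ℂ) : Fin 3 → Fin 3 → ℂ × ℂ → Subst
  | 0, 0, x => ⟨x, 0, 1, 1⟩
  | 1, 1, x => ⟨x, 0, 1, 1⟩
  | 2, 2, x => ⟨x, 0, 1, 1⟩
  | 0, 1, x => ⟨(1 / x.1, x.2 / x.1), (0, lam / x.1 ^ 2), 1 / x.1, 1 / x.1 ^ 2⟩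
  | 1, 0, x => ⟨(1 / x.1, x.2 / x.1), (0, (-lam) / x.1 ^ 2), 1 / x.1, 1 / x.1 ^ 2⟩
  | 1, 2, x => ⟨(x.1 / x.2, 1 / x.2), (lam / x.2 ^ 2, 0), 1 / x.2, 1 / x.2 ^ 2⟩
  | 2, 1, x => ⟨(x.1 / x.2, 1 / x.2), ((-lam) / x.2 ^ 2, 0), 1 / x.2, 1 / x.2 ^ 2⟩
  | 2, 0, x => ⟨(1 / x.2, x.1 / x.2), (0, lam / x.2 ^ 2), 1 / x.2, 1 / x.2 ^ 2⟩
  | 0, 2, x => ⟨(x.2 / x.1, 1 / x.1), ((-lam) / x.1 ^ 2, 0), 1 / x.1, 1 / x.1 ^ 2⟩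

/-- The derivative of the reduced change of coordinates. -/
def dtr : Fin 3 → Fin 3 → ℂ × ℂ → ℂ × ℂ → ℂ × ℂ
  | 0, 0, _, v => v
  | 1, 1, _, v => v
  | 2, 2, _, v => v
  | 0, 1, x, v => (-(1 / x.1 ^ 2) * v.1, 1 / x.1 * v.2 - x.2 / x.1 ^ 2 * v.1)
  | 1, 0, x, v => (-(1 / x.1 ^ 2) * v.1, 1 / x.1 * v.2 - x.2 / x.1 ^ 2 * v.1)
  | 1, 2, x, v => (1 / x.2 * v.1 - x.1 / x.2 ^ 2 * v.2, -(1 / x.2 ^ 2) * v.2)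
  | 2, 1, x, v => (1 / x.2 * v.1 - x.1 / x.2 ^ 2 * v.2, -(1 / x.2 ^ 2) * v.2)
  | 2, 0, x, v => (-(1 / x.2 ^ 2) * v.2, 1 / x.2 * v.1 - x.1 / x.2 ^ 2 * v.2)
  | 0, 2, x, v => (1 / x.1 * v.2 - x.2 / x.1 ^ 2 * v.1, -(1 / x.1 ^ 2) * v.1)

section fderiv

variable {x : ℂ × ℂ}

theorem hasFDerivAt_one_div_fst (h : x.1 ≠ 0) : HasFDerivAt (fun u : ℂ × ℂ => 1 / u.1)
    (-(1 / x.1 ^ 2) • ContinuousLinearMap.fst ℂ ℂ ℂ) x := by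
  refine (((hasDerivAt_inv h).comp_hasFDerivAt x hasFDerivAt_fst).congr_of_eventuallyEq
    (.of_forall fun u => ?_)).congr_fderiv ?_
  · simp
  · simp

theorem hasFDerivAt_one_div_snd (h : x.2 ≠ 0) : HasFDerivAt (fun u : ℂ × ℂ => 1 / u.2)
    (-(1 / x.2 ^ 2) • ContinuousLinearMap.snd ℂ ℂ ℂ) x := by
  refine (((hasDerivAt_inv h).comp_hasFDerivAt x hasFDerivAt_snd).congr_of_eventuallyEq
    (.of_forall fun u => ?_)).congr_fderiv ?_
  · simp
  · simp

theorem hasFDerivAt_snd_div_fst (h : x.1 ≠ 0) : HasFDerivAt (fun u : ℂ × ℂ => u.2 / u.1)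
    ((1 / x.1) • ContinuousLinearMap.snd ℂ ℂ ℂ - (x.2 / x.1 ^ 2) • ContinuousLinearMap.fst ℂ ℂ ℂ)
    x := by
  have := (hasFDerivAt_snd (𝕜 := ℂ) (p := x)).mul (hasFDerivAt_one_div_fst h)
  refine (this.congr_of_eventuallyEq (.of_forall fun u => ?_)).congr_fderiv ?_
  · simp [div_eq_mul_inv]
  · ext <;> (simp; try ring)

theorem hasFDerivAt_fst_div_snd (h : x.2 ≠ 0) : HasFDerivAt (fun u : ℂ × ℂ => u.1 / u.2)
    ((1 / x.2) • ContinuousLinearMap.fst ℂ ℂ ℂ - (x.1 / x.2 ^ 2) • ContinuousLinearMap.snd ℂ ℂ ℂ)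
    x := by
  have := (hasFDerivAt_fst (𝕜 := ℂ) (p := x)).mul (hasFDerivAt_one_div_snd h)
  refine (this.congr_of_eventuallyEq (.of_forall fun u => ?_)).congr_fderiv ?_
  · simp [div_eq_mul_inv]
  · ext <;> (simp; try ring)

theorem hasFDerivAt_div_fst_sq (c : ℂ) (h : x.1 ≠ 0) : HasFDerivAt (fun u : ℂ × ℂ => c / u.1 ^ 2)
    (-(2 * c / x.1 ^ 3) • ContinuousLinearMap.fst ℂ ℂ ℂ) x := by
  have := ((hasFDerivAt_one_div_fst h).pow 2).const_mul c
  refine (this.congr_of_eventuallyEq (.of_forall fun u => ?_)).congr_fderiv ?_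
  · simp [div_eq_mul_inv]
  · ext <;> (simp; try field_simp)

theorem hasFDerivAt_div_snd_sq (c : ℂ) (h : x.2 ≠ 0) : HasFDerivAt (fun u : ℂ × ℂ => c / u.2 ^ 2)
    (-(2 * c / x.2 ^ 3) • ContinuousLinearMap.snd ℂ ℂ ℂ) x := by
  have := ((hasFDerivAt_one_div_snd h).pow 2).const_mul c
  refine (this.congr_of_eventuallyEq (.of_forall fun u => ?_)).congr_fderiv ?_
  · simp [div_eq_mul_inv]
  · ext <;> (simp; try field_simp)

end fderiv

/-- Recording the derivative only through its values `dtr` keeps the cocycle condition `tr_tr` a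
purely algebraic identity. -/
theorem exists_hasFDerivAt_tr (lam : ℂ) (i j : Fin 3) (x : ℂ × ℂ) (h : chartVec j x i ≠ 0) :
    ∃ L : ℂ × ℂ →L[ℂ] ℂ × ℂ, HasFDerivAt (fun u => (tr lam i j u).y) L x ∧
      ∀ v, L v = dtr i j x v := by
  fin_cases i <;> fin_cases j <;> simp [chartVec] at h <;> simp only [tr, dtr]
  · exact ⟨_, hasFDerivAt_id x, fun _ => rfl⟩
  · exact ⟨_, (hasFDerivAt_one_div_fst h).prodMk (hasFDerivAt_snd_div_fst h), fun v => by simp⟩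
  · exact ⟨_, (hasFDerivAt_snd_div_fst h).prodMk (hasFDerivAt_one_div_fst h), fun v => by simp⟩
  · exact ⟨_, (hasFDerivAt_one_div_fst h).prodMk (hasFDerivAt_snd_div_fst h), fun v => by simp⟩
  · exact ⟨_, hasFDerivAt_id x, fun _ => rfl⟩
  · exact ⟨_, (hasFDerivAt_fst_div_snd h).prodMk (hasFDerivAt_one_div_snd h), fun v => by simp⟩
  · exact ⟨_, (hasFDerivAt_one_div_snd h).prodMk (hasFDerivAt_fst_div_snd h), fun v => by simp⟩
  · exact ⟨_, (hasFDerivAt_fst_div_snd h).prodMk (hasFDerivAt_one_div_snd h), fun v => by simp⟩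
  · exact ⟨_, hasFDerivAt_id x, fun _ => rfl⟩

/-- Holomorphic dependence of a change of coordinates on the base point. -/
structure Subst.HolAt (φ : ℂ × ℂ → Subst) (x : ℂ × ℂ) : Prop where
  y : AnalyticAt ℂ (fun u => (φ u).y) x
  ν₁ : AnalyticAt ℂ (fun u => (φ u).ν.1) x
  ν₂ : AnalyticAt ℂ (fun u => (φ u).ν.2) x
  a : AnalyticAt ℂ (fun u => (φ u).a) x
  b : AnalyticAt ℂ (fun u => (φ u).b) x

theorem holAt_tr (lam : ℂ) (i j : Fin 3) (x : ℂ × ℂ) (h : chartVec j x i ≠ 0) :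
    Subst.HolAt (tr lam i j) x := by
  have p1 : AnalyticAt ℂ (fun u : ℂ × ℂ => u.1) x := analyticAt_fst
  have p2 : AnalyticAt ℂ (fun u : ℂ × ℂ => u.2) x := analyticAt_snd
  have c (r : ℂ) : AnalyticAt ℂ (fun _ : ℂ × ℂ => r) x := analyticAt_const
  have q1 (r : ℂ) (h : x.1 ≠ 0) := (c r).fun_div (p1.fun_pow 2) (pow_ne_zero 2 h)
  have q2 (r : ℂ) (h : x.2 ≠ 0) := (c r).fun_div (p2.fun_pow 2) (pow_ne_zero 2 h)
  fin_cases i <;> fin_cases j <;> simp [chartVec] at h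
  · exact ⟨analyticAt_id, c _, c _, c _, c _⟩
  · exact ⟨((c 1).fun_div p1 h).prod (p2.fun_div p1 h), c _, q1 _ h, (c 1).fun_div p1 h, q1 _ h⟩
  · exact ⟨(p2.fun_div p1 h).prod ((c 1).fun_div p1 h), q1 _ h, c _, (c 1).fun_div p1 h, q1 _ h⟩
  · exact ⟨((c 1).fun_div p1 h).prod (p2.fun_div p1 h), c _, q1 _ h, (c 1).fun_div p1 h, q1 _ h⟩
  · exact ⟨analyticAt_id, c _, c _, c _, c _⟩
  · exact ⟨(p1.fun_div p2 h).prod ((c 1).fun_div p2 h), q2 _ h, c _, (c 1).fun_div p2 h, q2 _ h⟩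
  · exact ⟨((c 1).fun_div p2 h).prod (p1.fun_div p2 h), c _, q2 _ h, (c 1).fun_div p2 h, q2 _ h⟩
  · exact ⟨(p1.fun_div p2 h).prod ((c 1).fun_div p2 h), q2 _ h, c _, (c 1).fun_div p2 h, q2 _ h⟩
  · exact ⟨analyticAt_id, c _, c _, c _, c _⟩

theorem clm_prod_apply {F : Type*} [NormedAddCommGroup F] [NormedSpace ℂ F] (L : ℂ × ℂ →L[ℂ] F)
    (v : ℂ × ℂ) : L v = v.1 • L (1, 0) + v.2 • L (0, 1) := by
  have hv : v = v.1 • ((1, 0) : ℂ × ℂ) + v.2 • ((0, 1) : ℂ × ℂ) := by ext <;> simp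
  conv_lhs => rw [hv, map_add, map_smul, map_smul]

theorem HolAt.pull {F : ℂ × ℂ → Grass} {φ : ℂ × ℂ → Subst} {x : ℂ × ℂ}
    (hF : HolAt F (φ x).y) (hφ : Subst.HolAt φ x) : HolAt (fun u => (φ u).pull F) x where
  body := hF.body.comp (f := fun u => (φ u).y) hφ.y
  c1 := hφ.a.fun_mul (hF.c1.comp (f := fun u => (φ u).y) hφ.y)
  c2 := hφ.b.fun_mul (hF.c2.comp (f := fun u => (φ u).y) hφ.y)
  c12 := by
    refine ((hφ.a.fun_mul hφ.b).fun_mul (hF.c12.comp (f := fun u => (φ u).y) hφ.y)).fun_add ?_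
    -- The direction `(φ u).ν` moves with `u`, so the derivative is treated in the two fixed basis
    -- directions and recombined afterwards.
    have h (e : ℂ × ℂ) : AnalyticAt ℂ (fun u => fderiv ℂ (fun w => (F w).body) (φ u).y e) x :=
      AnalyticAt.comp (g := fun w => fderiv ℂ (fun w => (F w).body) w e)
        (f := fun u => (φ u).y) (hF.body.fderiv.clm_apply_const e) hφ.y
    refine ((hφ.ν₁.fun_mul (h (1, 0))).fun_add (hφ.ν₂.fun_mul (h (0, 1)))).congr
      (.of_forall fun u => ?_)
    exact (clm_prod_apply (fderiv ℂ (fun w => (F w).body) (φ u).y) (φ u).ν).symm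

/-- The chain rule determines the nilpotent shift of a composite: the shift of `φ` is multiplied by
`ab` because `θ₁θ₂` is, and the outer shift `ν` is transported by the derivative of the reduced map.
-/
theorem pull_pull {F : ℂ × ℂ → Grass} {φ : ℂ × ℂ → Subst} {x ν : ℂ × ℂ} {a b : ℂ}
    {L : ℂ × ℂ →L[ℂ] ℂ × ℂ} (hF : HolAt F (φ x).y) (hφ : HasFDerivAt (fun u => (φ u).y) L x) :
    pull (fun u => (φ u).pull F) x ν a b =
      pull F (φ x).y ((a * b) • (φ x).ν + L ν) (a * (φ x).a) (b * (φ x).b) := by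
  have h := (hF.body.differentiableAt.hasFDerivAt.comp x hφ).fderiv
  simp only [Function.comp_def] at h
  ext <;> simp only [pull, Subst.pull]
  · ring
  · ring
  · rw [h]
    simp only [ContinuousLinearMap.comp_apply, map_add, map_smul, smul_eq_mul]
    ring

theorem chartVec_tr {lam : ℂ} {i j k : Fin 3} {x : ℂ × ℂ} (hj : chartVec k x j ≠ 0)
    (hi : chartVec k x i ≠ 0) : chartVec j (tr lam j k x).y i ≠ 0 := by
  fin_cases i <;> fin_cases j <;> fin_cases k <;> simp_all [chartVec, tr]

/-- The cocycle condition for the changes of coordinates. -/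
theorem tr_tr {lam : ℂ} {i j k : Fin 3} {x : ℂ × ℂ} (hj : chartVec k x j ≠ 0)
    (hi : chartVec k x i ≠ 0) :
    (tr lam i j (tr lam j k x).y).y = (tr lam i k x).y ∧
    ((tr lam j k x).a * (tr lam j k x).b) • (tr lam i j (tr lam j k x).y).ν +
      dtr i j (tr lam j k x).y (tr lam j k x).ν = (tr lam i k x).ν ∧
    (tr lam j k x).a * (tr lam i j (tr lam j k x).y).a = (tr lam i k x).a ∧
    (tr lam j k x).b * (tr lam i j (tr lam j k x).y).b = (tr lam i k x).b := by
  obtain ⟨x₁, x₂⟩ := x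
  fin_cases i <;> fin_cases j <;> fin_cases k <;> simp [chartVec] at hi hj <;>
    refine ⟨Prod.ext ?_ ?_, Prod.ext ?_ ?_, ?_, ?_⟩ <;>
    simp [tr, dtr] <;> field_simp <;> ring_nf

theorem pull_tr_tr {lam : ℂ} {i j k : Fin 3} {x : ℂ × ℂ} (hj : chartVec k x j ≠ 0)
    (hi : chartVec k x i ≠ 0) {F : ℂ × ℂ → Grass} (hF : HolAt F (tr lam i k x).y) :
    (tr lam j k x).pull (fun u => (tr lam i j u).pull F) = (tr lam i k x).pull F := by
  obtain ⟨h1, h2, h3, h4⟩ := tr_tr (lam := lam) hj hi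
  obtain ⟨L, hL, hL'⟩ := exists_hasFDerivAt_tr lam i j (tr lam j k x).y (chartVec_tr hj hi)
  rw [Subst.pull, pull_pull (h1 ▸ hF) hL, hL', h1, h2, h3, h4]
  rfl

/-! ### Open subsets of the plane that lie in a chart -/

theorem chart_injective (i : Fin 3) : Function.Injective (chart i) := fun x y h => by
  obtain ⟨t, ht⟩ := (Projectivization.mk_eq_mk_iff ℂ _ _ _ _).1 h
  have h1 := congrFun ht i
  simp only [Pi.smul_apply, chartVec_self, Units.smul_def, smul_eq_mul, mul_one] at h1
  rw [Units.val_eq_one.1 h1, one_smul] at ht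
  fin_cases i
  · exact Prod.ext (congrFun ht 1).symm (congrFun ht 2).symm
  · exact Prod.ext (congrFun ht 0).symm (congrFun ht 2).symm
  · exact Prod.ext (congrFun ht 0).symm (congrFun ht 1).symm

/-- The affine coordinates in the `i`-th chart. -/
def affineCoord : Fin 3 → (Fin 3 → ℂ) → ℂ × ℂ
  | 0, v => (v 1 / v 0, v 2 / v 0)
  | 1, v => (v 0 / v 1, v 2 / v 1)
  | 2, v => (v 0 / v 2, v 1 / v 2)

theorem smul_chartVec_affineCoord {i : Fin 3} {v : Fin 3 → ℂ} (h : v i ≠ 0) :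
    v i • chartVec i (affineCoord i v) = v := by
  funext j
  fin_cases i <;> fin_cases j <;> simp [chartVec, affineCoord] at h ⊢ <;> field_simp

theorem affineCoord_chartVec_eq_tr (lam : ℂ) (i j : Fin 3) (x : ℂ × ℂ) :
    affineCoord i (chartVec j x) = (tr lam i j x).y := by
  fin_cases i <;> fin_cases j <;> simp [chartVec, affineCoord, tr]

theorem continuousAt_affineCoord {i : Fin 3} {v : Fin 3 → ℂ} (h : v i ≠ 0) :
    ContinuousAt (affineCoord i) v := by
  have c (k : Fin 3) : ContinuousAt (fun v : Fin 3 → ℂ => v k) v := (continuous_apply k).continuousAt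
  fin_cases i
  · exact ((c 1).div (c 0) h).prodMk ((c 2).div (c 0) h)
  · exact ((c 0).div (c 1) h).prodMk ((c 2).div (c 1) h)
  · exact ((c 0).div (c 2) h).prodMk ((c 1).div (c 2) h)

/-- The open subset of `ℙ²` that corresponds to an open set of the `i`-th chart. -/
def chartOpen (i : Fin 3) (W : TopologicalSpace.Opens (ℂ × ℂ)) : TopologicalSpace.Opens P2 where
  carrier := chart i '' W
  is_open' := by
    refine isOpen_coinduced.2 ?_
    have : (Projectivization.mk' ℂ : {v : Fin 3 → ℂ // v ≠ 0} → Projectivization ℂ (Fin 3 → ℂ)) ⁻¹'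
        (chart i '' W) = {v | v.1 i ≠ 0 ∧ affineCoord i v.1 ∈ W} := by
      ext ⟨v, hv⟩
      constructor
      · rintro ⟨x, hx, h⟩
        obtain ⟨t, rfl⟩ := (Projectivization.mk_eq_mk_iff ℂ _ _ hv (chartVec_ne_zero i x)).1 h.symm
        have h0 : (t • chartVec i x) i ≠ 0 := by simp [chartVec_self, Units.smul_def]
        refine ⟨h0, ?_⟩
        suffices affineCoord i (t • chartVec i x) = x by
          change affineCoord i (t • chartVec i x) ∈ W
          rw [this]; exact hx
        have ht : (t : ℂ) ≠ 0 := t.ne_zero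
        fin_cases i <;> simp [affineCoord, chartVec, Units.smul_def, ht]
      · rintro ⟨h, hW⟩
        refine ⟨_, hW, ((Projectivization.mk_eq_mk_iff ℂ _ _ hv (chartVec_ne_zero i _)).2
          ⟨Units.mk0 _ h, smul_chartVec_affineCoord h⟩).symm⟩
    refine (congrArg IsOpen this).mpr (isOpen_iff_mem_nhds.2 ?_)
    rintro ⟨v, hv⟩ ⟨h, hW⟩
    have h1 : ∀ᶠ w : Fin 3 → ℂ in 𝓝 v, w i ≠ 0 ∧ affineCoord i w ∈ W :=
      ((continuous_apply i).continuousAt.eventually_ne h).and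
        ((continuousAt_affineCoord h).eventually (W.isOpen.mem_nhds hW))
    exact (continuous_subtype_val.tendsto (⟨v, hv⟩ : {v : Fin 3 → ℂ // v ≠ 0})).eventually h1

theorem mem_dom_chartOpen {i j : Fin 3} {W : TopologicalSpace.Opens (ℂ × ℂ)} {x : ℂ × ℂ} (lam : ℂ) :
    x ∈ dom (chartOpen i W) j ↔ chartVec j x i ≠ 0 ∧ (tr lam i j x).y ∈ W := by
  rw [← affineCoord_chartVec_eq_tr]
  constructor
  · rintro ⟨u, hu, h⟩
    obtain ⟨t, ht⟩ := (Projectivization.mk_eq_mk_iff ℂ _ _ _ _).1 h.symm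
    have ht0 : (t : ℂ) ≠ 0 := t.ne_zero
    rw [← ht]
    refine ⟨by simp [chartVec_self, Units.smul_def], ?_⟩
    suffices affineCoord i (t • chartVec i u) = u by rw [this]; exact hu
    fin_cases i <;> simp [affineCoord, chartVec, Units.smul_def, ht0]
  · rintro ⟨h, hW⟩
    exact ⟨_, hW, ((Projectivization.mk_eq_mk_iff ℂ _ _ (chartVec_ne_zero j x)
      (chartVec_ne_zero i _)).2 ⟨Units.mk0 _ h, smul_chartVec_affineCoord h⟩).symm⟩

theorem dom_chartOpen_self (i : Fin 3) (W : TopologicalSpace.Opens (ℂ × ℂ)) :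
    dom (chartOpen i W) i = W :=
  Set.preimage_image_eq _ (chart_injective i)

theorem chartOpen_le {i : Fin 3} {W : TopologicalSpace.Opens (ℂ × ℂ)}
    {V : TopologicalSpace.Opens P2} (h : (W : Set (ℂ × ℂ)) ⊆ dom V i) : chartOpen i W ≤ V := by
  rintro _ ⟨x, hx, rfl⟩
  exact h hx

/-! ### Sections of the structure sheaf over open subsets of a chart -/

theorem IsSection.glue {lam : ℂ} {V : TopologicalSpace.Opens P2} {s : ∀ i, dom V i → Grass}
    (hol : ∀ i, IsHol (s i))
    (h : ∀ j k, ∀ x : dom V k, chartVec k x j ≠ 0 → s k x = (tr lam j k x).pull (ext0 (s j))) :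
    IsSection lam V s :=
  ⟨hol, fun x hx => h 0 1 x hx, fun x hx => h 1 2 x hx, fun x hx => h 2 0 x hx⟩

theorem eventually_chartVec_ne {i j : Fin 3} {x : ℂ × ℂ} (h : chartVec j x i ≠ 0) :
    ∀ᶠ u in 𝓝 x, chartVec j u i ≠ 0 := by
  have : Continuous fun u => chartVec j u i := by
    fin_cases j <;> fin_cases i <;> simp [chartVec] <;> fun_prop
  exact this.continuousAt.eventually_ne h

/-- The section over an open subset of the `i`-th chart given there by `F`. -/
def ofHol (lam : ℂ) (i : Fin 3) (W : TopologicalSpace.Opens (ℂ × ℂ)) (F : ℂ × ℂ → Grass)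
    (hF : ∀ x ∈ W, HolAt F x) : structureSheaf lam (chartOpen i W) :=
  ⟨fun j x => (tr lam i j x).pull F, by
    have key (j : Fin 3) (x : ℂ × ℂ) (hx : x ∈ dom (chartOpen i W) j) :
        (fun u => (tr lam i j u).pull F) =ᶠ[𝓝 x]
          ext0 (W := dom (chartOpen i W) j) (fun x => (tr lam i j x).pull F) :=
      ext0_eventuallyEq (isOpen_dom _ j) (fun _ => rfl) hx
    refine IsSection.glue (fun j x hx => ?_) fun j k x hx => ?_
    · have hx' := (mem_dom_chartOpen lam).1 hx
      exact ((hF _ hx'.2).pull (holAt_tr lam i j x hx'.1)).congr (key j x hx)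
    -- All expressions are transported from the `i`-th chart, so the cocycle condition supplies
    -- every glueing relation.
    · have hx' := (mem_dom_chartOpen lam).1 x.2
      have hy : (tr lam j k x).y ∈ dom (chartOpen i W) j :=
        (mem_dom_chartOpen lam).2 ⟨chartVec_tr hx hx'.1, by
          rw [(tr_tr hx hx'.1).1]; exact hx'.2⟩
      exact (pull_tr_tr hx hx'.1 (hF _ hx'.2)).symm.trans (pull_congr (key j _ hy) _ _ _)⟩

theorem tr_self_pull (lam : ℂ) (i : Fin 3) (x : ℂ × ℂ) (F : ℂ × ℂ → Grass) :
    (tr lam i i x).pull F = F x := by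
  have : tr lam i i x = ⟨x, 0, 1, 1⟩ := by fin_cases i <;> rfl
  rw [this]
  ext <;> simp [Subst.pull, pull]

theorem ofHol_apply_self {lam : ℂ} {i : Fin 3} {W : TopologicalSpace.Opens (ℂ × ℂ)}
    {F : ℂ × ℂ → Grass} (hF : ∀ x ∈ W, HolAt F x) (x : dom (chartOpen i W) i) :
    (ofHol lam i W F hF).1 i x = F x :=
  tr_self_pull lam i x F

theorem ext0_val_eventuallyEq {W : Set (ℂ × ℂ)} (hW : IsOpen W) {f : W → Grass} {G : ℂ × ℂ → Grass}
    (h : ∀ x : W, f x = G x) {y : ℂ × ℂ} (hy : y ∈ W) : ext0 f =ᶠ[𝓝 y] G :=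
  (ext0_eventuallyEq hW h hy).symm

/-- A section of the structure sheaf satisfies the glueing condition for all pairs of charts. -/
theorem IsSection.eq_pull {lam : ℂ} {V : TopologicalSpace.Opens P2} {s : ∀ i, dom V i → Grass}
    (hs : IsSection lam V s) (j k : Fin 3) (x : dom V k) (hx : chartVec k x j ≠ 0) :
    s k x = (tr lam j k x).pull (ext0 (s j)) := by
  -- A glueing relation may be reversed: by the cocycle condition, going from `k` to `j` and back is
  -- the identity change of coordinates.
  have flip (j k : Fin 3) (h : ∀ x : dom V j, chartVec j x k ≠ 0 →
      s j x = (tr lam k j x).pull (ext0 (s k))) (x : dom V k) (hx : chartVec k x j ≠ 0) :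
      s k x = (tr lam j k x).pull (ext0 (s j)) := by
    have hk : chartVec k x.1 k ≠ 0 := by rw [chartVec_self]; exact one_ne_zero
    have hy0 : chartVec j (tr lam j k x).y k ≠ 0 := chartVec_tr hx hk
    have hy : (tr lam j k x).y ∈ dom V j := by
      rw [← affineCoord_chartVec_eq_tr]
      exact mem_dom_of_smul (Units.mk0 _ hx) (smul_chartVec_affineCoord hx) x.2
    have e : ext0 (s j) =ᶠ[𝓝 (tr lam j k x).y] fun u => (tr lam k j u).pull (ext0 (s k)) := by
      filter_upwards [(isOpen_dom V j).mem_nhds hy, eventually_chartVec_ne hy0] with u hu hu0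
      rw [ext0_apply _ hu, h ⟨u, hu⟩ hu0]
    have h3 : HolAt (ext0 (s k)) (tr lam k k x).y := by
      have : (tr lam k k x).y = x := by fin_cases k <;> rfl
      rw [this]; exact hs.hol k x x.2
    rw [Subst.pull, pull_congr e]
    have := pull_tr_tr hx hk h3
    rw [Subst.pull] at this
    rw [this, tr_self_pull, ext0_apply _ x.2]
  have self (k : Fin 3) (x : dom V k) : s k x = (tr lam k k x).pull (ext0 (s k)) := by
    rw [tr_self_pull, ext0_apply _ x.2]
  fin_cases j <;> fin_cases k
  · exact self _ _
  · exact hs.glue01 x hx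
  · exact flip 0 2 (fun x hx => hs.glue20 x hx) x hx
  · exact flip 1 0 (fun x hx => hs.glue01 x hx) x hx
  · exact self _ _
  · exact hs.glue12 x hx
  · exact hs.glue20 x hx
  · exact flip 2 1 (fun x hx => hs.glue12 x hx) x hx
  · exact self _ _

/-! ### Vector fields as derivations of superfunctions -/

/-- The derivative of a superfunction in an even direction. -/
def dirDeriv (F : ℂ × ℂ → Grass) (x e : ℂ × ℂ) : Grass :=
  ⟨fderiv ℂ (fun u => (F u).body) x e, fderiv ℂ (fun u => (F u).c1) x e,
      fderiv ℂ (fun u => (F u).c2) x e, fderiv ℂ (fun u => (F u).c12) x e⟩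

theorem VectorField.apply_eq (X : VectorField) (F : ℂ × ℂ → Grass) (x : ℂ × ℂ) :
    X.apply F x = X 0 x * dirDeriv F x (1, 0) + X 1 x * dirDeriv F x (0, 1) +
      X 2 x * ⟨(F x).c1, 0, (F x).c12, 0⟩ + X 3 x * ⟨(F x).c2, -(F x).c12, 0, 0⟩ := by
  rw [VectorField.apply, Fin.sum_univ_four]
  rfl

theorem dirDeriv_congr {F G : ℂ × ℂ → Grass} {x : ℂ × ℂ} (h : F =ᶠ[𝓝 x] G) (e : ℂ × ℂ) :
    dirDeriv F x e = dirDeriv G x e := by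
  have h0 : fderiv ℂ (fun u => (F u).body) x = fderiv ℂ (fun u => (G u).body) x :=
    (h.fun_comp Grass.body).fderiv_eq
  have h1 : fderiv ℂ (fun u => (F u).c1) x = fderiv ℂ (fun u => (G u).c1) x :=
    (h.fun_comp Grass.c1).fderiv_eq
  have h2 : fderiv ℂ (fun u => (F u).c2) x = fderiv ℂ (fun u => (G u).c2) x :=
    (h.fun_comp Grass.c2).fderiv_eq
  have h3 : fderiv ℂ (fun u => (F u).c12) x = fderiv ℂ (fun u => (G u).c12) x :=
    (h.fun_comp Grass.c12).fderiv_eq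
  rw [dirDeriv, dirDeriv, h0, h1, h2, h3]

theorem dirDeriv_add {F G : ℂ × ℂ → Grass} {x : ℂ × ℂ} (hF : HolAt F x) (hG : HolAt G x)
    (e : ℂ × ℂ) : dirDeriv (F + G) x e = dirDeriv F x e + dirDeriv G x e := by
  ext <;> simp only [dirDeriv, Pi.add_apply, Grass.add_body, Grass.add_c1, Grass.add_c2,
    Grass.add_c12]
  · rw [fderiv_fun_add hF.body.differentiableAt hG.body.differentiableAt]; rfl
  · rw [fderiv_fun_add hF.c1.differentiableAt hG.c1.differentiableAt]; rfl
  · rw [fderiv_fun_add hF.c2.differentiableAt hG.c2.differentiableAt]; rfl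
  · rw [fderiv_fun_add hF.c12.differentiableAt hG.c12.differentiableAt]; rfl

theorem dirDeriv_mul {F G : ℂ × ℂ → Grass} {x : ℂ × ℂ} (hF : HolAt F x) (hG : HolAt G x)
    (e : ℂ × ℂ) : dirDeriv (F * G) x e = dirDeriv F x e * G x + F x * dirDeriv G x e := by
  have f0 := hF.body.differentiableAt.hasFDerivAt
  have f1 := hF.c1.differentiableAt.hasFDerivAt
  have f2 := hF.c2.differentiableAt.hasFDerivAt
  have f3 := hF.c12.differentiableAt.hasFDerivAt
  have g0 := hG.body.differentiableAt.hasFDerivAt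
  have g1 := hG.c1.differentiableAt.hasFDerivAt
  have g2 := hG.c2.differentiableAt.hasFDerivAt
  have g3 := hG.c12.differentiableAt.hasFDerivAt
  ext <;> simp only [dirDeriv, Pi.mul_apply, Grass.mul_body, Grass.mul_c1, Grass.mul_c2,
    Grass.mul_c12, Grass.add_body, Grass.add_c1, Grass.add_c2, Grass.add_c12]
  · rw [(f0.fun_mul g0).fderiv]
    simp; ring
  · rw [((f0.fun_mul g1).fun_add (f1.fun_mul g0)).fderiv]
    simp; ring
  · rw [((f0.fun_mul g2).fun_add (f2.fun_mul g0)).fderiv]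
    simp; ring
  · rw [((((f0.fun_mul g3).fun_add (f3.fun_mul g0)).fun_add (f1.fun_mul g2)).fun_sub
      (f2.fun_mul g1)).fderiv]
    simp; ring

theorem HolAt.dirDeriv {F : ℂ × ℂ → Grass} {x : ℂ × ℂ} (hF : HolAt F x) (e : ℂ × ℂ) :
    HolAt (fun u => dirDeriv F u e) x :=
  ⟨hF.body.fderiv.clm_apply_const e, hF.c1.fderiv.clm_apply_const e,
    hF.c2.fderiv.clm_apply_const e, hF.c12.fderiv.clm_apply_const e⟩

theorem HolAt.apply {X : VectorField} {F : ℂ × ℂ → Grass} {x : ℂ × ℂ} (hX : ∀ a, HolAt (X a) x)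
    (hF : HolAt F x) : HolAt (X.apply F) x := by
  have : X.apply F = fun u => X 0 u * SuperPlane.dirDeriv F u (1, 0) +
      X 1 u * SuperPlane.dirDeriv F u (0, 1) +
      X 2 u * ⟨(F u).c1, 0, (F u).c12, 0⟩ + X 3 u * ⟨(F u).c2, -(F u).c12, 0, 0⟩ :=
    funext fun u => X.apply_eq F u
  have h2 : HolAt (fun u => (⟨(F u).c1, 0, (F u).c12, 0⟩ : Grass)) x :=
    ⟨hF.c1, analyticAt_const, hF.c12, analyticAt_const⟩
  have h3 : HolAt (fun u => (⟨(F u).c2, -(F u).c12, 0, 0⟩ : Grass)) x :=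
    ⟨hF.c2, hF.c12.fun_neg, analyticAt_const, analyticAt_const⟩
  rw [this]
  exact ((((hX 0).mul (hF.dirDeriv _)).add ((hX 1).mul (hF.dirDeriv _))).add
    ((hX 2).mul h2)).add ((hX 3).mul h3)

theorem VectorField.apply_congr (X : VectorField) {F G : ℂ × ℂ → Grass} {x : ℂ × ℂ}
    (h : F =ᶠ[𝓝 x] G) : X.apply F x = X.apply G x := by
  simp only [X.apply_eq, dirDeriv_congr h, h.eq_of_nhds]

theorem VectorField.apply_add (X : VectorField) {F G : ℂ × ℂ → Grass} {x : ℂ × ℂ}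
    (hF : HolAt F x) (hG : HolAt G x) : X.apply (F + G) x = X.apply F x + X.apply G x := by
  simp only [X.apply_eq, dirDeriv_add hF hG]
  ext <;> simp <;> ring

theorem dirDeriv_ofBody_const (c : ℂ) (x e : ℂ × ℂ) : dirDeriv (ofBody fun _ => c) x e = 0 := by
  ext <;> simp [dirDeriv, ofBody]

theorem VectorField.apply_const (X : VectorField) (c : ℂ) (x : ℂ × ℂ) :
    X.apply (ofBody fun _ => c) x = 0 := by
  rw [X.apply_eq, dirDeriv_ofBody_const, dirDeriv_ofBody_const]
  ext <;> simp [ofBody]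

/-- The parity of the coordinates `z₁, z₂ | θ₁, θ₂`. -/
def par : Fin 4 → ZMod 2 := ![0, 0, 1, 1]

/-- The vector field `X` is homogeneous of parity `p`. -/
def VectorField.IsHomog (p : ZMod 2) (X : VectorField) : Prop :=
  ∀ a x, (X a x).IsHomog (p + par a)

theorem isHomog_zero {f : Grass} : f.IsHomog 0 ↔ f.c1 = 0 ∧ f.c2 = 0 := by
  simp [Grass.IsHomog]

theorem isHomog_one {f : Grass} : f.IsHomog 1 ↔ f.body = 0 ∧ f.c12 = 0 := by
  simp [Grass.IsHomog]

theorem zmod_two_cases (p : ZMod 2) : p = 0 ∨ p = 1 := by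
  fin_cases p
  · exact .inl rfl
  · exact .inr rfl

theorem isHomog_ofBody (f : ℂ × ℂ → ℂ) (x : ℂ × ℂ) : (ofBody f x).IsHomog 0 :=
  isHomog_zero.2 ⟨rfl, rfl⟩

theorem VectorField.isHomog_zero_iff {X : VectorField} : X.IsHomog 0 ↔
    ∀ x, ((X 0 x).c1 = 0 ∧ (X 0 x).c2 = 0) ∧ ((X 1 x).c1 = 0 ∧ (X 1 x).c2 = 0) ∧
      ((X 2 x).body = 0 ∧ (X 2 x).c12 = 0) ∧ ((X 3 x).body = 0 ∧ (X 3 x).c12 = 0) := by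
  simp only [VectorField.IsHomog, Fin.forall_fin_succ, par]
  simp [isHomog_zero, isHomog_one, forall_and]

theorem VectorField.isHomog_one_iff {X : VectorField} : X.IsHomog 1 ↔
    ∀ x, ((X 0 x).body = 0 ∧ (X 0 x).c12 = 0) ∧ ((X 1 x).body = 0 ∧ (X 1 x).c12 = 0) ∧
      ((X 2 x).c1 = 0 ∧ (X 2 x).c2 = 0) ∧ ((X 3 x).c1 = 0 ∧ (X 3 x).c2 = 0) := by
  have : (1 + 1 : ZMod 2) = 0 := rfl
  simp only [VectorField.IsHomog, Fin.forall_fin_succ, par]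
  simp [isHomog_zero, isHomog_one, forall_and, this]

theorem dirDeriv_isHomog {q : ZMod 2} {F : ℂ × ℂ → Grass} {x : ℂ × ℂ}
    (hF : ∀ᶠ u in 𝓝 x, (F u).IsHomog q) (e : ℂ × ℂ) : (dirDeriv F x e).IsHomog q := by
  have key (c : Grass → ℂ) (h : ∀ᶠ u in 𝓝 x, c (F u) = 0) : fderiv ℂ (fun u => c (F u)) x e = 0 := by
    rw [EventuallyEq.fderiv_eq (f := fun _ => (0 : ℂ)) h]
    simp
  rcases zmod_two_cases q with rfl | rfl
  · simp only [isHomog_zero, eventually_and] at hF ⊢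
    exact ⟨key _ hF.1, key _ hF.2⟩
  · simp only [isHomog_one, eventually_and] at hF ⊢
    exact ⟨key _ hF.1, key _ hF.2⟩

theorem VectorField.IsHomog.apply {p q : ZMod 2} {X : VectorField} (hX : X.IsHomog p)
    {F : ℂ × ℂ → Grass} {x : ℂ × ℂ} (hF : ∀ᶠ u in 𝓝 x, (F u).IsHomog q) :
    (X.apply F x).IsHomog (p + q) := by
  have h1 := dirDeriv_isHomog hF (1, 0)
  have h2 := dirDeriv_isHomog hF (0, 1)
  have h3 := hF.self_of_nhds
  have e : (1 + 1 : ZMod 2) = 0 := rfl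
  rw [X.apply_eq]
  rcases zmod_two_cases p with rfl | rfl
  · obtain ⟨⟨a1, a2⟩, ⟨a3, a4⟩, ⟨a5, a6⟩, a7, a8⟩ := VectorField.isHomog_zero_iff.1 hX x
    rcases zmod_two_cases q with rfl | rfl
    all_goals
      simp only [zero_add, add_zero, e, isHomog_zero, isHomog_one] at h1 h2 h3 ⊢
      simp [h1, h2, h3, a1, a2, a3, a4, a5, a6, a7, a8]
  · obtain ⟨⟨a1, a2⟩, ⟨a3, a4⟩, ⟨a5, a6⟩, a7, a8⟩ := VectorField.isHomog_one_iff.1 hX x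
    rcases zmod_two_cases q with rfl | rfl
    all_goals
      simp only [zero_add, add_zero, e, isHomog_zero, isHomog_one] at h1 h2 h3 ⊢
      simp [h1, h2, h3, a1, a2, a3, a4, a5, a6, a7, a8]

/-- The sign comes from moving `X` past `F`, so no homogeneity of `G` is needed. Homogeneity of `F`
is required near `x`, since its derivatives enter. -/
theorem VectorField.IsHomog.apply_mul {p q : ZMod 2} {X : VectorField} (hX : X.IsHomog p)
    {F G : ℂ × ℂ → Grass} {x : ℂ × ℂ} (hF : HolAt F x) (hG : HolAt G x)
    (hq : ∀ᶠ u in 𝓝 x, (F u).IsHomog q) :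
    X.apply (F * G) x = X.apply F x * G x + (-1 : ℂ) ^ (p * q).val • (F x * X.apply G x) := by
  have h1 := dirDeriv_isHomog hq (1, 0)
  have h2 := dirDeriv_isHomog hq (0, 1)
  have h3 := hq.self_of_nhds
  have e : (1 : ZMod 2).val = 1 := rfl
  simp only [X.apply_eq, dirDeriv_mul hF hG]
  rcases zmod_two_cases p with rfl | rfl
  · obtain ⟨⟨a1, a2⟩, ⟨a3, a4⟩, ⟨a5, a6⟩, a7, a8⟩ := VectorField.isHomog_zero_iff.1 hX x
    rcases zmod_two_cases q with rfl | rfl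
    all_goals
      simp only [isHomog_zero, isHomog_one] at h1 h2 h3
      simp only [mul_zero, mul_one, ZMod.val_zero, e, pow_zero, pow_one, one_smul]
      ext <;> simp [h1, h2, h3, a1, a2, a3, a4, a5, a6, a7, a8] <;> ring
  · obtain ⟨⟨a1, a2⟩, ⟨a3, a4⟩, ⟨a5, a6⟩, a7, a8⟩ := VectorField.isHomog_one_iff.1 hX x
    rcases zmod_two_cases q with rfl | rfl
    all_goals
      simp only [isHomog_zero, isHomog_one] at h1 h2 h3
      simp only [mul_zero, mul_one, ZMod.val_zero, e, pow_zero, pow_one, one_smul]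
      ext <;> simp [h1, h2, h3, a1, a2, a3, a4, a5, a6, a7, a8] <;> ring

/-- The four coordinate functions. -/
def coord : Fin 4 → ℂ × ℂ → Grass := ![z₁, z₂, θ₁, θ₂]

theorem holAt_coord (a : Fin 4) (x : ℂ × ℂ) : HolAt (coord a) x := by
  fin_cases a
  · exact holAt_z₁ x
  · exact holAt_z₂ x
  · exact holAt_θ₁ x
  · exact holAt_θ₂ x

theorem isHomog_coord (a : Fin 4) (x : ℂ × ℂ) : (coord a x).IsHomog (par a) := by
  fin_cases a <;> simp [coord, par, isHomog_zero, isHomog_one, z₁, z₂, θ₁, θ₂]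

theorem VectorField.apply_coord (X : VectorField) (a : Fin 4) (x : ℂ × ℂ) :
    X.apply (coord a) x = X a x := by
  have f1 (e : ℂ × ℂ) : fderiv ℂ (fun u : ℂ × ℂ => u.1) x e = e.1 := by
    rw [hasFDerivAt_fst.fderiv]; rfl
  have f2 (e : ℂ × ℂ) : fderiv ℂ (fun u : ℂ × ℂ => u.2) x e = e.2 := by
    rw [hasFDerivAt_snd.fderiv]; rfl
  rw [X.apply_eq]
  fin_cases a <;> ext <;> simp [coord, z₁, z₂, θ₁, θ₂, dirDeriv, f1, f2]

theorem Subst.pull_isHomog {q : ZMod 2} {F : ℂ × ℂ → Grass} (P : Subst)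
    (hF : ∀ᶠ u in 𝓝 P.y, (F u).IsHomog q) : (P.pull F).IsHomog q := by
  have h1 := hF.self_of_nhds
  have h2 := dirDeriv_isHomog hF P.ν
  rcases zmod_two_cases q with rfl | rfl
  · simp only [isHomog_zero] at h1 ⊢
    simp [Subst.pull, SuperPlane.pull, h1]
  · simp only [isHomog_one] at h1 h2 ⊢
    have h3 : fderiv ℂ (fun u => (F u).body) P.y P.ν = 0 := h2.1
    simp [Subst.pull, SuperPlane.pull, h1, h3]

/-- Vector fields that are related by a change of coordinates on the coordinate functions are
related. -/
theorem apply_pull_of_coord {p : ZMod 2} {X Y : VectorField} (hX : X.IsHomog p) (hY : Y.IsHomog p)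
    {φ : ℂ × ℂ → Subst} {x : ℂ × ℂ} (hφ : Subst.HolAt φ x) (hYh : ∀ a, HolAt (Y a) (φ x).y)
    (h : ∀ a, X.apply (fun u => (φ u).pull (coord a)) x = (φ x).pull (Y a))
    {F : ℂ × ℂ → Grass} (hF : HolAt F (φ x).y) :
    X.apply (fun u => (φ u).pull F) x = (φ x).pull (Y.apply F) := by
  have tendsto : Tendsto (fun u => (φ u).y) (𝓝 x) (𝓝 (φ x).y) := hφ.y.continuousAt
  have pull_ev {F G : ℂ × ℂ → Grass} (h : F =ᶠ[𝓝 (φ x).y] G) :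
      (fun u => (φ u).pull F) =ᶠ[𝓝 x] fun u => (φ u).pull G := by
    filter_upwards [tendsto.eventually (eventually_eventually_nhds.2 h)] with u hu
    exact pull_congr hu _ _ _
  have hol_ev {F : ℂ × ℂ → Grass} (hF : HolAt F (φ x).y) : ∀ᶠ u in 𝓝 (φ x).y, HolAt F u := by
    filter_upwards [hF.body.eventually_analyticAt, hF.c1.eventually_analyticAt,
      hF.c2.eventually_analyticAt, hF.c12.eventually_analyticAt] with u h1 h2 h3 h4
    exact ⟨h1, h2, h3, h4⟩
  have hom_ev {F : ℂ × ℂ → Grass} {q : ZMod 2} (h : ∀ u, (F u).IsHomog q) :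
      ∀ᶠ u in 𝓝 x, ((φ u).pull F).IsHomog q :=
    .of_forall fun u => (φ u).pull_isHomog (.of_forall h)
  have leib {F G : ℂ × ℂ → Grass} {q : ZMod 2} (hF : HolAt F (φ x).y) (hG : HolAt G (φ x).y)
      (hq : ∀ u, (F u).IsHomog q) :
      X.apply (fun u => (φ u).pull (F * G)) x = X.apply (fun u => (φ u).pull F) x * (φ x).pull G +
        (-1 : ℂ) ^ (p * q).val • ((φ x).pull F * X.apply (fun u => (φ u).pull G) x) ∧
      (φ x).pull (Y.apply (F * G)) = (φ x).pull (Y.apply F) * (φ x).pull G +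
        (-1 : ℂ) ^ (p * q).val • ((φ x).pull F * (φ x).pull (Y.apply G)) := by
    constructor
    · rw [← hX.apply_mul (hF.pull hφ) (hG.pull hφ) (hom_ev hq)]
      refine X.apply_congr ?_
      filter_upwards [tendsto.eventually (hol_ev hF), tendsto.eventually (hol_ev hG)] with u h1 h2
      exact pull_mul h1 h2 _ _ _
    · have e : Y.apply (F * G) =ᶠ[𝓝 (φ x).y] fun u => Y.apply F u * G u +
          algebraMap ℂ Grass ((-1 : ℂ) ^ (p * q).val) * (F u * Y.apply G u) := by
        filter_upwards [hol_ev hF, hol_ev hG] with u h1 h2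
        rw [hY.apply_mul h1 h2 (.of_forall hq), Algebra.smul_def]
      have k1 := HolAt.apply hYh hF
      have k2 := HolAt.apply hYh hG
      have k3 := HolAt.algebraMap ((-1 : ℂ) ^ (p * q).val) (φ x).y
      refine (pull_congr e _ _ _).trans ?_
      rw [pull_add (k1.mul hG) (k3.mul (hF.mul k2)), pull_mul k1 hG, pull_mul k3 (hF.mul k2),
        pull_mul hF k2, pull_algebraMap, Algebra.smul_def]
      rfl
  -- The difference `F ↦ X(φ*F) - φ*(Y F)` is a derivation along `φ*`: the fields have the same
  -- parity, so the signs in both Leibniz rules agree. By `h` it kills the coordinates.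
  refine sub_eq_zero.1 (IsDerivAlong.eq_zero (E := fun F => X.apply (fun u => (φ u).pull F) x -
    (φ x).pull (Y.apply F)) (y := (φ x).y) (ν := (φ x).ν) (a := (φ x).a) (b := (φ x).b)
    { congr := ?_, add := ?_, leibniz := ?_, odd_mul := ?_, const := ?_ } ?_ ?_ ?_ ?_ hF)
  · intro F G hF hFG
    have : Y.apply F =ᶠ[𝓝 (φ x).y] Y.apply G := by
      filter_upwards [eventually_eventually_nhds.2 hFG] with u hu using Y.apply_congr hu
    have := pull_congr this (φ x).ν (φ x).a (φ x).b
    simp only [Subst.pull] at this ⊢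
    rw [this]
    congr 1
    exact X.apply_congr (pull_ev hFG)
  · intro F G hF hG
    have e1 : (fun u => (φ u).pull (F + G)) =ᶠ[𝓝 x]
        (fun u => (φ u).pull F) + fun u => (φ u).pull G := by
      filter_upwards [tendsto.eventually (hol_ev hF), tendsto.eventually (hol_ev hG)] with u h1 h2
      exact pull_add h1 h2 _ _ _
    have e2 : Y.apply (F + G) =ᶠ[𝓝 (φ x).y] fun u => Y.apply F u + Y.apply G u := by
      filter_upwards [hol_ev hF, hol_ev hG] with u h1 h2 using Y.apply_add h1 h2
    have e3 : (φ x).pull (Y.apply (F + G)) = (φ x).pull (Y.apply F) + (φ x).pull (Y.apply G) :=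
      (pull_congr e2 _ _ _).trans (pull_add (HolAt.apply hYh hF) (HolAt.apply hYh hG) _ _ _)
    rw [X.apply_congr e1, X.apply_add (hF.pull hφ) (hG.pull hφ), e3]
    abel
  · intro f G hf hG
    obtain ⟨h1, h2⟩ := leib (.ofBody hf) hG (isHomog_ofBody f)
    rw [h1, h2, mul_zero, ZMod.val_zero, pow_zero, one_smul, one_smul, sub_mul, mul_sub]
    simp only [Subst.pull]
    abel
  · intro h3 h4
    obtain ⟨h1, h2⟩ := leib (holAt_θ₁ _) (holAt_θ₂ _) (isHomog_coord 2)
    rw [h1, h2, sub_eq_zero.1 h3, sub_eq_zero.1 h4, sub_self]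
  · intro c
    have e1 : (fun u => (φ u).pull (ofBody fun _ => c)) = ofBody fun _ => c :=
      funext fun u => pull_algebraMap c _ _ _ _
    have e2 : Y.apply (ofBody fun _ => c) = fun _ => algebraMap ℂ Grass 0 :=
      funext fun u => by rw [Y.apply_const, map_zero]
    rw [e1, X.apply_const, e2, Subst.pull, pull_algebraMap, map_zero, sub_zero]
  all_goals rw [sub_eq_zero]
  · exact (h 0).trans (by congr 1; exact funext fun u => (Y.apply_coord 0 u).symm)
  · exact (h 1).trans (by congr 1; exact funext fun u => (Y.apply_coord 1 u).symm)
  · exact (h 2).trans (by congr 1; exact funext fun u => (Y.apply_coord 2 u).symm)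
  · exact (h 3).trans (by congr 1; exact funext fun u => (Y.apply_coord 3 u).symm)

/-! ### Global vector fields from compatible triples -/

/-- Three vector fields on `ℂ^{2|2}` that are the local expressions of a global vector field. -/
structure IsGlobal (lam : ℂ) (p : ZMod 2) (X : Fin 3 → VectorField) : Prop where
  hol : ∀ i a x, HolAt (X i a) x
  homog : ∀ i, (X i).IsHomog p
  glue01 : ∀ x : ℂ × ℂ, x.1 ≠ 0 → ∀ a,
    (X 1).apply (fun u => (tr lam 0 1 u).pull (coord a)) x = (tr lam 0 1 x).pull (X 0 a)
  glue12 : ∀ x : ℂ × ℂ, x.2 ≠ 0 → ∀ a,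
    (X 2).apply (fun u => (tr lam 1 2 u).pull (coord a)) x = (tr lam 1 2 x).pull (X 1 a)
  glue20 : ∀ x : ℂ × ℂ, x.2 ≠ 0 → ∀ a,
    (X 0).apply (fun u => (tr lam 2 0 u).pull (coord a)) x = (tr lam 2 0 x).pull (X 2 a)

theorem ext0_add_eventuallyEq {W : Set (ℂ × ℂ)} (hW : IsOpen W) (f g : W → Grass) {y : ℂ × ℂ}
    (hy : y ∈ W) : ext0 (f + g) =ᶠ[𝓝 y] ext0 f + ext0 g :=
  ext0_val_eventuallyEq hW
    (fun x => by rw [Pi.add_apply, Pi.add_apply, ext0_apply _ x.2, ext0_apply _ x.2]) hy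

theorem ext0_mul_eventuallyEq {W : Set (ℂ × ℂ)} (hW : IsOpen W) (f g : W → Grass) {y : ℂ × ℂ}
    (hy : y ∈ W) : ext0 (f * g) =ᶠ[𝓝 y] ext0 f * ext0 g :=
  ext0_val_eventuallyEq hW
    (fun x => by rw [Pi.mul_apply, Pi.mul_apply, ext0_apply _ x.2, ext0_apply _ x.2]) hy

theorem ext0_res_eventuallyEq {lam : ℂ} {V' V : TopologicalSpace.Opens P2} (h : V' ≤ V)
    (f : structureSheaf lam V) (i : Fin 3) {y : ℂ × ℂ} (hy : y ∈ dom V' i) :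
    ext0 ((res h f).1 i) =ᶠ[𝓝 y] ext0 (f.1 i) :=
  ext0_val_eventuallyEq (isOpen_dom V' i) (fun x => (ext0_apply _ (dom_mono h i x.2)).symm) hy

theorem IsHomogSection.eventually {lam : ℂ} {V : TopologicalSpace.Opens P2} {q : ZMod 2}
    {f : structureSheaf lam V} (hf : IsHomogSection q f) (i : Fin 3) {y : ℂ × ℂ}
    (hy : y ∈ dom V i) : ∀ᶠ u in 𝓝 y, (ext0 (f.1 i) u).IsHomog q := by
  filter_upwards [(isOpen_dom V i).mem_nhds hy] with u hu
  rw [ext0_apply _ hu]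
  exact hf i _

theorem apply_smul_ext0 (X : VectorField) (r : ℂ) {W : Set (ℂ × ℂ)} (hW : IsOpen W) {f : W → Grass}
    (hf : IsHol f) {y : ℂ × ℂ} (hy : y ∈ W) :
    X.apply (ext0 (r • f)) y = r • X.apply (ext0 f) y := by
  have e : ext0 (r • f) =ᶠ[𝓝 y] (ofBody fun _ => r) * ext0 f :=
    ext0_val_eventuallyEq hW (fun x => by
      rw [Pi.smul_apply, Pi.mul_apply, ext0_apply _ x.2, Algebra.smul_def]; rfl) hy
  have h := hf y hy
  have d (e : ℂ × ℂ) : dirDeriv ((ofBody fun _ => r) * ext0 f) y e = r • dirDeriv (ext0 f) y e := by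
    rw [dirDeriv_mul (.ofBody analyticAt_const) h, dirDeriv_ofBody_const, zero_mul, zero_add,
      Algebra.smul_def]
    rfl
  rw [X.apply_congr e, X.apply_eq, X.apply_eq, d, d]
  ext <;> simp [ofBody] <;> ring

/-- The action of a global vector field on sections of the structure sheaf. -/
def IsGlobal.act {lam : ℂ} {p : ZMod 2} {X : Fin 3 → VectorField} (hX : IsGlobal lam p X)
    (V : TopologicalSpace.Opens P2) : Module.End ℂ (structureSheaf lam V) where
  toFun f := ⟨fun i x => (X i).apply (ext0 (f.1 i)) x, by
    have key (i : Fin 3) (y : ℂ × ℂ) (hy : y ∈ dom V i) : (X i).apply (ext0 (f.1 i)) =ᶠ[𝓝 y]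
        ext0 (W := dom V i) (fun x => (X i).apply (ext0 (f.1 i)) x) :=
      ext0_eventuallyEq (isOpen_dom V i) (fun _ => rfl) hy
    have glue (j k : Fin 3) (hjk : ∀ x : ℂ × ℂ, chartVec k x j ≠ 0 → ∀ a,
        (X k).apply (fun u => (tr lam j k u).pull (coord a)) x = (tr lam j k x).pull (X j a))
        (x : dom V k) (hx : chartVec k x j ≠ 0) : (X k).apply (ext0 (f.1 k)) x =
          (tr lam j k x).pull (ext0 fun x : dom V j => (X j).apply (ext0 (f.1 j)) x) := by
      have hy : (tr lam j k x).y ∈ dom V j := by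
        rw [← affineCoord_chartVec_eq_tr]
        exact mem_dom_of_smul (Units.mk0 _ hx) (smul_chartVec_affineCoord hx) x.2
      have e : ext0 (f.1 k) =ᶠ[𝓝 x.1] fun u => (tr lam j k u).pull (ext0 (f.1 j)) := by
        filter_upwards [(isOpen_dom V k).mem_nhds x.2, eventually_chartVec_ne hx] with u hu hu0
        rw [ext0_apply _ hu, f.2.eq_pull j k ⟨u, hu⟩ hu0]
      rw [(X k).apply_congr e, apply_pull_of_coord (hX.homog k) (hX.homog j) (holAt_tr lam j k x hx)
        (fun a => hX.hol j a _) (hjk x hx) (f.2.hol j _ hy)]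
      exact pull_congr (key j _ hy) _ _ _
    exact ⟨fun i y hy => (HolAt.apply (fun a => hX.hol i a y) (f.2.hol i y hy)).congr (key i y hy),
      glue 0 1 hX.glue01, glue 1 2 hX.glue12, glue 2 0 hX.glue20⟩⟩
  map_add' f g := Subtype.ext <| funext fun i => funext fun x => by
    have hy := x.2
    exact ((X i).apply_congr (ext0_add_eventuallyEq (isOpen_dom V i) _ _ hy)).trans
      ((X i).apply_add (f.2.hol i x hy) (g.2.hol i x hy))
  map_smul' r f := Subtype.ext <| funext fun i => funext fun x =>
    apply_smul_ext0 (X i) r (isOpen_dom V i) (f.2.hol i) x.2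

/-- The element of `H⁰(𝒯_M)` with given local expressions. -/
def IsGlobal.toH0T {lam : ℂ} {p : ZMod 2} {X : Fin 3 → VectorField} (hX : IsGlobal lam p X) :
    H0T lam p :=
  ⟨fun V => hX.act V.1, by
    refine ⟨fun V V' h f => ?_, fun V q f hf i x => ?_, fun V q f g hf => ?_⟩
    · refine Subtype.ext (funext fun i => funext fun x => ?_)
      exact ((X i).apply_congr (ext0_res_eventuallyEq h f i x.2)).symm
    · exact (hX.homog i).apply (hf.eventually i x.2)
    · refine Subtype.ext (funext fun i => funext fun x => ?_)
      have hy := x.2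
      refine ((X i).apply_congr (ext0_mul_eventuallyEq (isOpen_dom V.1 i) _ _ hy)).trans ?_
      rw [(hX.homog i).apply_mul (f.2.hol i x hy) (g.2.hol i x hy) (hf.eventually i hy),
        ext0_apply _ hy, ext0_apply _ hy]
      rfl⟩

theorem IsGlobal.toH0T_isGivenInU0 {lam : ℂ} {p : ZMod 2} {X : Fin 3 → VectorField}
    (hX : IsGlobal lam p X) : IsGivenInU0 hX.toH0T (X 0) := fun _ _ _ => rfl

/-! ### Local expressions of a global vector field -/

/-- The open set lies inside the `i`-th chart, so glueing recovers the other two expressions at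
every point. -/
theorem section_ext_of_chart {lam : ℂ} {i : Fin 3} {W : TopologicalSpace.Opens (ℂ × ℂ)}
    {s t : structureSheaf lam (chartOpen i W)} (h : s.1 i = t.1 i) : s = t := by
  refine Subtype.ext (funext fun j => funext fun x => ?_)
  have hx := ((mem_dom_chartOpen lam).1 x.2).1
  rw [s.2.eq_pull i j x hx, t.2.eq_pull i j x hx, h]

/-- The value at a point of `D f` only depends on the germ of `f` at the point. -/
theorem H0T.apply_congr {lam : ℂ} {p : ZMod 2} (D : H0T lam p) {i : Fin 3}
    {V V' : TopologicalSpace.Opens P2} (f : structureSheaf lam V) (g : structureSheaf lam V')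
    {y : ℂ × ℂ} (hy : y ∈ dom V i) (hy' : y ∈ dom V' i) (h : ext0 (f.1 i) =ᶠ[𝓝 y] ext0 (g.1 i)) :
    (D.1 ⟨V, le_top⟩ f).1 i ⟨y, hy⟩ = (D.1 ⟨V', le_top⟩ g).1 i ⟨y, hy'⟩ := by
  -- On a small neighbourhood inside the chart both sections restrict to the same section, and `D`
  -- commutes with restriction.
  obtain ⟨W, hW, hWo, hyW⟩ := mem_nhds_iff.1 (h.and (((isOpen_dom V i).eventually_mem hy).and
    ((isOpen_dom V' i).eventually_mem hy')))
  let W' : TopologicalSpace.Opens (ℂ × ℂ) := ⟨W, hWo⟩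
  have h1 : chartOpen i W' ≤ V := chartOpen_le fun u hu => (hW hu).2.1
  have h2 : chartOpen i W' ≤ V' := chartOpen_le fun u hu => (hW hu).2.2
  have hyd : y ∈ dom (chartOpen i W') i := by rw [dom_chartOpen_self]; exact hyW
  have e : res h1 f = res h2 g := by
    refine section_ext_of_chart (funext fun x => ?_)
    have hx : x.1 ∈ W := (dom_chartOpen_self i W').le x.2
    obtain ⟨h3, h4, h5⟩ : ext0 (f.1 i) x.1 = ext0 (g.1 i) x.1 ∧ x.1 ∈ dom V i ∧ x.1 ∈ dom V' i :=
      hW hx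
    exact (ext0_apply _ h4).symm.trans (h3.trans (ext0_apply _ h5))
  have k1 := D.2.1 ⟨V, le_top⟩ ⟨chartOpen i W', le_top⟩ h1 f
  have k2 := D.2.1 ⟨V', le_top⟩ ⟨chartOpen i W', le_top⟩ h2 g
  have k3 : (res h1 (D.1 ⟨V, le_top⟩ f)).1 i ⟨y, hyd⟩ = (res h2 (D.1 ⟨V', le_top⟩ g)).1 i ⟨y, hyd⟩ := by
    rw [k1, k2, e]
  exact k3

theorem HolAt.eventually {F : ℂ × ℂ → Grass} {y : ℂ × ℂ} (hF : HolAt F y) :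
    ∀ᶠ u in 𝓝 y, HolAt F u := by
  filter_upwards [hF.body.eventually_analyticAt, hF.c1.eventually_analyticAt,
    hF.c2.eventually_analyticAt, hF.c12.eventually_analyticAt] with u h1 h2 h3 h4
  exact ⟨h1, h2, h3, h4⟩

open Classical in
/-- The value at `y` of `D F` for a germ `F` of a superfunction at the point `y` of the `i`-th
chart. -/
def H0T.germ {lam : ℂ} {p : ZMod 2} (D : H0T lam p) (i : Fin 3) (y : ℂ × ℂ)
    (F : ℂ × ℂ → Grass) : Grass :=
  if h : ∃ W : TopologicalSpace.Opens (ℂ × ℂ), y ∈ W ∧ ∀ x ∈ W, HolAt F x then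
    ext0 ((D.1 ⟨chartOpen i h.choose, le_top⟩ (ofHol lam i h.choose F h.choose_spec.2)).1 i) y
  else 0

theorem ext0_ofHol_eventuallyEq {lam : ℂ} {i : Fin 3} {W : TopologicalSpace.Opens (ℂ × ℂ)}
    {F : ℂ × ℂ → Grass} (hF : ∀ x ∈ W, HolAt F x) {y : ℂ × ℂ} (hy : y ∈ W) :
    ext0 ((ofHol lam i W F hF).1 i) =ᶠ[𝓝 y] F :=
  ext0_val_eventuallyEq (isOpen_dom _ i) (ofHol_apply_self hF)
    (by rw [dom_chartOpen_self]; exact hy)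

theorem HolAt.exists_opens {F : ℂ × ℂ → Grass} {y : ℂ × ℂ} (hF : HolAt F y) :
    ∃ W : TopologicalSpace.Opens (ℂ × ℂ), y ∈ W ∧ ∀ x ∈ W, HolAt F x := by
  obtain ⟨W, hW, hWo, hyW⟩ := mem_nhds_iff.1 hF.eventually
  exact ⟨⟨W, hWo⟩, hyW, fun x hx => hW hx⟩

/-- The arbitrary neighbourhood chosen in `H0T.germ` is harmless: any section with the germ `F`
computes the same value, by locality. -/
theorem H0T.germ_eq {lam : ℂ} {p : ZMod 2} (D : H0T lam p) {i : Fin 3} {y : ℂ × ℂ}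
    {F : ℂ × ℂ → Grass} {V : TopologicalSpace.Opens P2} (f : structureSheaf lam V)
    (hy : y ∈ dom V i) (h : ext0 (f.1 i) =ᶠ[𝓝 y] F) :
    H0T.germ D i y F = (D.1 ⟨V, le_top⟩ f).1 i ⟨y, hy⟩ := by
  have hF : HolAt F y := (f.2.hol i y hy).congr h
  have hW := hF.exists_opens
  have hyW : y ∈ dom (chartOpen i hW.choose) i := by
    rw [dom_chartOpen_self]; exact hW.choose_spec.1
  rw [H0T.germ, dif_pos hW, ext0_apply _ hyW]
  exact H0T.apply_congr D _ _ hyW hy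
    ((ext0_ofHol_eventuallyEq hW.choose_spec.2 hW.choose_spec.1).trans h.symm)

theorem isHomogSection_ofHol {lam : ℂ} {i : Fin 3} {W : TopologicalSpace.Opens (ℂ × ℂ)}
    {F : ℂ × ℂ → Grass} (hF : ∀ x ∈ W, HolAt F x) {q : ZMod 2} (h : ∀ x, (F x).IsHomog q) :
    IsHomogSection q (ofHol lam i W F hF) :=
  fun j x => (tr lam i j x).pull_isHomog (.of_forall h)

/-- The section over `{X_i ≠ 0}` given by a coordinate function. -/
def coordSection (lam : ℂ) (i : Fin 3) (a : Fin 4) : structureSheaf lam (chartOpen i ⊤) :=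
  ofHol lam i ⊤ (coord a) fun x _ => holAt_coord a x

theorem mem_dom_chartOpen_top (i : Fin 3) (x : ℂ × ℂ) : x ∈ dom (chartOpen i ⊤) i := by
  rw [dom_chartOpen_self]; trivial

/-- The coefficients of the local expression of a global vector field. -/
def H0T.coeff {lam : ℂ} {p : ZMod 2} (D : H0T lam p) (i : Fin 3) : VectorField :=
  fun a x => (D.1 ⟨chartOpen i ⊤, le_top⟩ (coordSection lam i a)).1 i ⟨x, mem_dom_chartOpen_top i x⟩

theorem H0T.holAt_coeff {lam : ℂ} {p : ZMod 2} (D : H0T lam p) (i : Fin 3) (a : Fin 4)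
    (x : ℂ × ℂ) : HolAt (H0T.coeff D i a) x := by
  have hx := mem_dom_chartOpen_top i x
  refine ((D.1 ⟨chartOpen i ⊤, le_top⟩ (coordSection lam i a)).2.hol i x hx).congr
    (ext0_val_eventuallyEq (G := H0T.coeff D i a) (isOpen_dom _ i) (fun _ => rfl) hx)

theorem H0T.isHomog_coeff {lam : ℂ} {p : ZMod 2} (D : H0T lam p) (i : Fin 3) :
    (H0T.coeff D i).IsHomog p := fun a x =>
  D.2.2.1 ⟨chartOpen i ⊤, le_top⟩ (par a) (coordSection lam i a)
    (isHomogSection_ofHol _ (isHomog_coord a)) i ⟨x, mem_dom_chartOpen_top i x⟩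

theorem H0T.germ_coord {lam : ℂ} {p : ZMod 2} (D : H0T lam p) (i : Fin 3) (a : Fin 4)
    (x : ℂ × ℂ) : H0T.germ D i x (coord a) = H0T.coeff D i a x :=
  H0T.germ_eq D (coordSection lam i a) _ (ext0_ofHol_eventuallyEq _ trivial)

theorem H0T.germ_mul {lam : ℂ} {p : ZMod 2} (D : H0T lam p) (i : Fin 3) {y : ℂ × ℂ}
    {F G : ℂ × ℂ → Grass} (hF : HolAt F y) (hG : HolAt G y) {q : ZMod 2}
    (hq : ∀ x, (F x).IsHomog q) : H0T.germ D i y (F * G) =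
      H0T.germ D i y F * G y + (-1 : ℂ) ^ (p * q).val • (F y * H0T.germ D i y G) := by
  obtain ⟨W, hW, hWo, hyW⟩ := mem_nhds_iff.1 (hF.eventually.and hG.eventually)
  let W' : TopologicalSpace.Opens (ℂ × ℂ) := ⟨W, hWo⟩
  have hF' : ∀ x ∈ W', HolAt F x := fun x hx => (hW hx).1
  have hG' : ∀ x ∈ W', HolAt G x := fun x hx => (hW hx).2
  have hy : y ∈ dom (chartOpen i W') i := by rw [dom_chartOpen_self]; exact hyW
  have hyW' : y ∈ W' := hyW
  let f := ofHol lam i W' F hF'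
  let g := ofHol lam i W' G hG'
  have h1 : ext0 ((f * g).1 i) =ᶠ[𝓝 y] F * G :=
    (ext0_mul_eventuallyEq (isOpen_dom _ i) _ _ hy).trans
      ((ext0_ofHol_eventuallyEq hF' hyW').mul (ext0_ofHol_eventuallyEq hG' hyW'))
  rw [H0T.germ_eq D (f * g) hy h1, H0T.germ_eq D f hy (ext0_ofHol_eventuallyEq hF' hyW'),
    H0T.germ_eq D g hy (ext0_ofHol_eventuallyEq hG' hyW'),
    D.2.2.2 ⟨chartOpen i W', le_top⟩ q f g (isHomogSection_ofHol hF' hq)]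
  have e1 : f.1 i ⟨y, hy⟩ = F y := ofHol_apply_self hF' ⟨y, hy⟩
  have e2 : g.1 i ⟨y, hy⟩ = G y := ofHol_apply_self hG' ⟨y, hy⟩
  rw [← e1, ← e2]
  rfl

theorem H0T.germ_add {lam : ℂ} {p : ZMod 2} (D : H0T lam p) (i : Fin 3) {y : ℂ × ℂ}
    {F G : ℂ × ℂ → Grass} (hF : HolAt F y) (hG : HolAt G y) :
    H0T.germ D i y (F + G) = H0T.germ D i y F + H0T.germ D i y G := by
  obtain ⟨W, hW, hWo, hyW⟩ := mem_nhds_iff.1 (hF.eventually.and hG.eventually)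
  let W' : TopologicalSpace.Opens (ℂ × ℂ) := ⟨W, hWo⟩
  have hF' : ∀ x ∈ W', HolAt F x := fun x hx => (hW hx).1
  have hG' : ∀ x ∈ W', HolAt G x := fun x hx => (hW hx).2
  have hy : y ∈ dom (chartOpen i W') i := by rw [dom_chartOpen_self]; exact hyW
  have hyW' : y ∈ W' := hyW
  let f := ofHol lam i W' F hF'
  let g := ofHol lam i W' G hG'
  have h1 : ext0 ((f + g).1 i) =ᶠ[𝓝 y] F + G :=
    (ext0_add_eventuallyEq (isOpen_dom _ i) _ _ hy).trans
      ((ext0_ofHol_eventuallyEq hF' hyW').add (ext0_ofHol_eventuallyEq hG' hyW'))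
  rw [H0T.germ_eq D (f + g) hy h1, H0T.germ_eq D f hy (ext0_ofHol_eventuallyEq hF' hyW'),
    H0T.germ_eq D g hy (ext0_ofHol_eventuallyEq hG' hyW'), map_add]
  rfl

/-- The Leibniz rule for `1 · 1 = 1` gives `D 1 = 2 D 1`, hence `D 1 = 0`. Linearity handles the
other constants. -/
theorem H0T.germ_const {lam : ℂ} {p : ZMod 2} (D : H0T lam p) (i : Fin 3) (y : ℂ × ℂ) (c : ℂ) :
    H0T.germ D i y (ofBody fun _ => c) = 0 := by
  have hc (c : ℂ) : HolAt (ofBody fun _ => c) y := .ofBody analyticAt_const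
  have h1 : H0T.germ D i y (ofBody fun _ => 1) = 0 := by
    have h := H0T.germ_mul D i (hc 1) (hc 1) (isHomog_ofBody _)
    have e : ((ofBody fun _ => 1) * ofBody fun _ => 1) = ofBody fun _ => 1 := by
      funext u; simp [ofBody]
    rw [e] at h
    simpa [ofBody] using h
  let f : structureSheaf lam ⊤ := algebraMap ℂ _ c
  let g : structureSheaf lam ⊤ := 1
  have hf : ext0 (f.1 i) =ᶠ[𝓝 y] ofBody fun _ => c :=
    ext0_val_eventuallyEq (G := ofBody fun _ => c) (isOpen_dom ⊤ i) (fun _ => rfl) trivial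
  have hg : ext0 (g.1 i) =ᶠ[𝓝 y] ofBody fun _ => 1 :=
    ext0_val_eventuallyEq (isOpen_dom ⊤ i) (fun x => (map_one (algebraMap ℂ Grass)).symm) trivial
  have e : f = c • g := Algebra.algebraMap_eq_smul_one c
  rw [H0T.germ_eq D g trivial hg] at h1
  rw [H0T.germ_eq D f trivial hf, e, map_smul]
  change c • (D.1 ⟨⊤, le_top⟩ g).1 i ⟨y, trivial⟩ = 0
  rw [h1, smul_zero]

/-- A global vector field is given by its coefficients. -/
theorem H0T.apply_eq {lam : ℂ} {p : ZMod 2} (D : H0T lam p) (i : Fin 3)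
    {V : TopologicalSpace.Opens P2} (f : structureSheaf lam V) (x : dom V i) :
    (D.1 ⟨V, le_top⟩ f).1 i x = (H0T.coeff D i).apply (ext0 (f.1 i)) x := by
  have pull_id (F : ℂ × ℂ → Grass) (y : ℂ × ℂ) : pull F y 0 1 1 = F y := by ext <;> simp [pull]
  have hom := H0T.isHomog_coeff D i
  rw [← H0T.germ_eq D f x.2 (EventuallyEq.refl _ _), ← sub_eq_zero]
  -- The parameters `ν = 0`, `a = b = 1` describe the identity morphism, along which the difference
  -- is a derivation that vanishes on the coordinates.
  refine IsDerivAlong.eq_zero (E := fun F => H0T.germ D i x F - (H0T.coeff D i).apply F x) (y := x) (ν := 0)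
    (a := 1) (b := 1) { congr := ?_, add := ?_, leibniz := ?_, odd_mul := ?_, const := ?_ }
    ?_ ?_ ?_ ?_ (f.2.hol i x x.2)
  · intro F G hF hFG
    obtain ⟨W, hxW, hW⟩ := hF.exists_opens
    have hx : x.1 ∈ dom (chartOpen i W) i := by rw [dom_chartOpen_self]; exact hxW
    have h1 : ext0 ((ofHol lam i W F hW).1 i) =ᶠ[𝓝 x.1] F := ext0_ofHol_eventuallyEq hW hxW
    rw [H0T.germ_eq D _ hx h1, H0T.germ_eq D _ hx (h1.trans hFG), (H0T.coeff D i).apply_congr hFG]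
  · intro F G hF hG
    rw [H0T.germ_add D i hF hG, (H0T.coeff D i).apply_add hF hG]
    abel
  · intro g G hg hG
    rw [H0T.germ_mul D i (.ofBody hg) hG (isHomog_ofBody g),
      hom.apply_mul (.ofBody hg) hG (.of_forall (isHomog_ofBody g)), pull_id, pull_id, mul_zero,
      ZMod.val_zero, pow_zero, one_smul, one_smul, sub_mul, mul_sub]
    abel
  · intro h1 h2
    rw [H0T.germ_mul D i (holAt_θ₁ _) (holAt_θ₂ _) (isHomog_coord 2),
      hom.apply_mul (holAt_θ₁ _) (holAt_θ₂ _) (.of_forall (isHomog_coord 2)), sub_eq_zero.1 h1,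
      sub_eq_zero.1 h2, sub_self]
  · intro c
    rw [H0T.germ_const D, (H0T.coeff D i).apply_const, sub_zero]
  all_goals rw [sub_eq_zero]
  · exact (H0T.germ_coord D i 0 x).trans ((H0T.coeff D i).apply_coord 0 x).symm
  · exact (H0T.germ_coord D i 1 x).trans ((H0T.coeff D i).apply_coord 1 x).symm
  · exact (H0T.germ_coord D i 2 x).trans ((H0T.coeff D i).apply_coord 2 x).symm
  · exact (H0T.germ_coord D i 3 x).trans ((H0T.coeff D i).apply_coord 3 x).symm

theorem H0T.coeff_eq_of_isGivenInU0 {lam : ℂ} {p : ZMod 2} {D : H0T lam p} {X : VectorField}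
    (h : IsGivenInU0 D X) : H0T.coeff D 0 = X := by
  funext a x
  rw [← X.apply_coord a x, H0T.coeff, h]
  exact X.apply_congr (ext0_ofHol_eventuallyEq _ trivial)

/-- Apply `D` to the coordinates of chart `j`, viewed as sections over `{X_j ≠ 0}`. The result is
again a section, and its glueing relation with chart `k` is the asserted equation. -/
theorem H0T.glue {lam : ℂ} {p : ZMod 2} (D : H0T lam p) (j k : Fin 3) (x : ℂ × ℂ)
    (hx : chartVec k x j ≠ 0) (a : Fin 4) :
    (H0T.coeff D k).apply (fun u => (tr lam j k u).pull (coord a)) x =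
      (tr lam j k x).pull (H0T.coeff D j a) := by
  have hx' : x ∈ dom (chartOpen j ⊤) k := (mem_dom_chartOpen lam).2 ⟨hx, trivial⟩
  have h1 := (D.1 ⟨chartOpen j ⊤, le_top⟩ (coordSection lam j a)).2.eq_pull j k ⟨x, hx'⟩ hx
  rw [H0T.apply_eq D] at h1
  refine Eq.trans ((H0T.coeff D k).apply_congr ?_) (h1.trans (pull_congr ?_ _ _ _))
  · exact (ext0_val_eventuallyEq (isOpen_dom _ k) (fun _ => rfl) hx').symm
  · exact ext0_val_eventuallyEq (G := H0T.coeff D j a) (isOpen_dom _ j) (fun _ => rfl)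
      (mem_dom_chartOpen_top j _)

/-- A section of the structure sheaf is determined by its restriction to the first chart. -/
theorem section_ext_of_chart0 {lam : ℂ} {V : TopologicalSpace.Opens P2} {s t : structureSheaf lam V}
    (h : s.1 0 = t.1 0) : s = t := by
  refine Subtype.ext (funext fun k => funext fun x => ?_)
  have hol {F G : ℂ × ℂ → ℂ} (hF : AnalyticAt ℂ F x) (hG : AnalyticAt ℂ G x)
      (h : ∀ u ∈ dom V k, chartVec k u 0 ≠ 0 → F u = G u) : F x = G x := by
    by_cases h0 : chartVec k x 0 ≠ 0
    · exact h x x.2 h0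
    -- In charts 1 and 2 the part outside `U₀` is the line `u₁ = 0`, whose complement is dense;
    -- equality passes to the line by continuity.
    have hd : x.1 ∈ closure {u : ℂ × ℂ | chartVec k u 0 ≠ 0} := by
      have hden : Dense {u : ℂ × ℂ | u.1 ≠ 0} :=
        (dense_compl_singleton (0 : ℂ)).preimage isOpenMap_fst
      fin_cases k
      · exact absurd one_ne_zero h0
      · exact hden x.1
      · exact hden x.1
    have hfreq : ∃ᶠ u in 𝓝 x.1, F u - G u = 0 := by
      refine ((mem_closure_iff_frequently.1 hd).and_eventually
        ((isOpen_dom V k).mem_nhds x.2)).mono fun u hu => ?_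
      exact sub_eq_zero.2 (h u hu.2 hu.1)
    have := (isClosed_singleton (x := (0 : ℂ))).mem_of_frequently_of_tendsto hfreq
      (hF.sub hG).continuousAt
    exact sub_eq_zero.1 this
  have hs := s.2.hol k x x.2
  have ht := t.2.hol k x x.2
  have key (u : ℂ × ℂ) (hu : u ∈ dom V k) (h0 : chartVec k u 0 ≠ 0) :
      ext0 (s.1 k) u = ext0 (t.1 k) u := by
    rw [ext0_apply _ hu, ext0_apply _ hu, s.2.eq_pull 0 k ⟨u, hu⟩ h0, t.2.eq_pull 0 k ⟨u, hu⟩ h0, h]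
  refine (ext0_apply (s.1 k) x.2).symm.trans (Eq.trans ?_ (ext0_apply (t.1 k) x.2))
  ext
  · exact hol hs.body ht.body fun u hu h0 => congrArg _ (key u hu h0)
  · exact hol hs.c1 ht.c1 fun u hu h0 => congrArg _ (key u hu h0)
  · exact hol hs.c2 ht.c2 fun u hu h0 => congrArg _ (key u hu h0)
  · exact hol hs.c12 ht.c12 fun u hu h0 => congrArg _ (key u hu h0)

/-- A global vector field is determined by its local expression in the first chart. -/
theorem H0T.ext_of_coeff {lam : ℂ} {p : ZMod 2} {D E : H0T lam p} (h : H0T.coeff D 0 = H0T.coeff E 0) :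
    D = E := by
  refine Subtype.ext (funext fun V => LinearMap.ext fun f => section_ext_of_chart0 ?_)
  funext x
  exact (H0T.apply_eq D 0 f x).trans ((h ▸ rfl : _ = _).trans (H0T.apply_eq E 0 f x).symm)

/-! ### Explicit form of the changes of coordinates on vector fields -/

theorem Subst.pull_coord (P : Subst) : P.pull (coord 0) = ⟨P.y.1, 0, 0, P.ν.1⟩ ∧
    P.pull (coord 1) = ⟨P.y.2, 0, 0, P.ν.2⟩ ∧ P.pull (coord 2) = ⟨0, P.a, 0, 0⟩ ∧
    P.pull (coord 3) = ⟨0, 0, P.b, 0⟩ := by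
  have f1 : fderiv ℂ (fun u : ℂ × ℂ => u.1) P.y P.ν = P.ν.1 := by
    rw [hasFDerivAt_fst.fderiv]; rfl
  have f2 : fderiv ℂ (fun u : ℂ × ℂ => u.2) P.y P.ν = P.ν.2 := by
    rw [hasFDerivAt_snd.fderiv]; rfl
  refine ⟨?_, ?_, ?_, ?_⟩ <;> ext <;>
    simp [Subst.pull, SuperPlane.pull, coord, z₁, z₂, θ₁, θ₂, f1, f2]

theorem VectorField.apply_even (X : VectorField) {f g : ℂ × ℂ → ℂ} {x : ℂ × ℂ}
    {f' g' : ℂ × ℂ →L[ℂ] ℂ} (hf : HasFDerivAt f f' x) (hg : HasFDerivAt g g' x) :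
    X.apply (fun u => ⟨f u, 0, 0, g u⟩) x = X 0 x * ⟨f' (1, 0), 0, 0, g' (1, 0)⟩ +
      X 1 x * ⟨f' (0, 1), 0, 0, g' (0, 1)⟩ + X 2 x * ⟨0, 0, g x, 0⟩ + X 3 x * ⟨0, -g x, 0, 0⟩ := by
  simp [X.apply_eq, dirDeriv, hf.fderiv, hg.fderiv]

theorem VectorField.apply_odd₁ (X : VectorField) {f : ℂ × ℂ → ℂ} {x : ℂ × ℂ}
    {f' : ℂ × ℂ →L[ℂ] ℂ} (hf : HasFDerivAt f f' x) :
    X.apply (fun u => ⟨0, f u, 0, 0⟩) x = X 0 x * ⟨0, f' (1, 0), 0, 0⟩ +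
      X 1 x * ⟨0, f' (0, 1), 0, 0⟩ + X 2 x * ⟨f x, 0, 0, 0⟩ := by
  rw [X.apply_eq]
  ext <;> simp [dirDeriv, hf.fderiv]

theorem VectorField.apply_odd₂ (X : VectorField) {f : ℂ × ℂ → ℂ} {x : ℂ × ℂ}
    {f' : ℂ × ℂ →L[ℂ] ℂ} (hf : HasFDerivAt f f' x) :
    X.apply (fun u => ⟨0, 0, f u, 0⟩) x = X 0 x * ⟨0, 0, f' (1, 0), 0⟩ +
      X 1 x * ⟨0, 0, f' (0, 1), 0⟩ + X 3 x * ⟨f x, 0, 0, 0⟩ := by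
  rw [X.apply_eq]
  ext <;> simp [dirDeriv, hf.fderiv]

/-- The image of `1 / z₁` under a vector field with `z₁`- and `z₂`-coefficients `p` and `q`, if
`z₁ = r` at the point in question. -/
def invCoeff (p : Grass) (r : ℂ) : Grass := p * ⟨-(1 / r ^ 2), 0, 0, 0⟩

/-- The image of `t / r + s θ₁θ₂ / r²` under the vector field `p ∂_r + q ∂_t + c ∂_θ₁ + d ∂_θ₂`. -/
def quotCoeff (s : ℂ) (p q c d : Grass) (r t : ℂ) : Grass :=
  p * ⟨-(t / r ^ 2), 0, 0, -(2 * s / r ^ 3)⟩ + q * ⟨1 / r, 0, 0, 0⟩ + c * ⟨0, 0, s / r ^ 2, 0⟩ +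
    d * ⟨0, -(s / r ^ 2), 0, 0⟩

/-- The image of `θ₁ / r` under the vector field `p ∂_r + c ∂_θ₁`. -/
def oddCoeff₁ (p c : Grass) (r : ℂ) : Grass := p * ⟨0, -(1 / r ^ 2), 0, 0⟩ + c * ⟨1 / r, 0, 0, 0⟩

/-- The image of `θ₂ / r²` under the vector field `p ∂_r + d ∂_θ₂`. -/
def oddCoeff₂ (p d : Grass) (r : ℂ) : Grass :=
  p * ⟨0, 0, -(2 / r ^ 3), 0⟩ + d * ⟨1 / r ^ 2, 0, 0, 0⟩

section

variable (X : VectorField) (lam : ℂ) {x : ℂ × ℂ}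

theorem apply_fst_inv (h : x.1 ≠ 0) :
    X.apply (fun u => ⟨1 / u.1, 0, 0, 0⟩) x = invCoeff (X 0 x) x.1 := by
  rw [X.apply_even (hasFDerivAt_one_div_fst h) (hasFDerivAt_const 0 x)]
  ext <;> simp [invCoeff]

theorem apply_snd_inv (h : x.2 ≠ 0) :
    X.apply (fun u => ⟨1 / u.2, 0, 0, 0⟩) x = invCoeff (X 1 x) x.2 := by
  rw [X.apply_even (hasFDerivAt_one_div_snd h) (hasFDerivAt_const 0 x)]
  ext <;> simp [invCoeff]

theorem apply_fst_quot (s : ℂ) (h : x.1 ≠ 0) :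
    X.apply (fun u => ⟨u.2 / u.1, 0, 0, s / u.1 ^ 2⟩) x =
      quotCoeff s (X 0 x) (X 1 x) (X 2 x) (X 3 x) x.1 x.2 := by
  rw [X.apply_even (hasFDerivAt_snd_div_fst h) (hasFDerivAt_div_fst_sq s h)]
  ext <;> simp [quotCoeff]

theorem apply_snd_quot (s : ℂ) (h : x.2 ≠ 0) :
    X.apply (fun u => ⟨u.1 / u.2, 0, 0, s / u.2 ^ 2⟩) x =
      quotCoeff s (X 1 x) (X 0 x) (X 2 x) (X 3 x) x.2 x.1 := by
  rw [X.apply_even (hasFDerivAt_fst_div_snd h) (hasFDerivAt_div_snd_sq s h)]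
  ext <;> simp [quotCoeff] <;> ring

theorem apply_fst_odd₁ (h : x.1 ≠ 0) :
    X.apply (fun u => ⟨0, 1 / u.1, 0, 0⟩) x = oddCoeff₁ (X 0 x) (X 2 x) x.1 := by
  rw [X.apply_odd₁ (hasFDerivAt_one_div_fst h)]
  ext <;> simp [oddCoeff₁]

theorem apply_snd_odd₁ (h : x.2 ≠ 0) :
    X.apply (fun u => ⟨0, 1 / u.2, 0, 0⟩) x = oddCoeff₁ (X 1 x) (X 2 x) x.2 := by
  rw [X.apply_odd₁ (hasFDerivAt_one_div_snd h)]
  ext <;> simp [oddCoeff₁]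

theorem apply_fst_odd₂ (h : x.1 ≠ 0) :
    X.apply (fun u => ⟨0, 0, 1 / u.1 ^ 2, 0⟩) x = oddCoeff₂ (X 0 x) (X 3 x) x.1 := by
  rw [X.apply_odd₂ (hasFDerivAt_div_fst_sq 1 h)]
  ext <;> simp [oddCoeff₂]

theorem apply_snd_odd₂ (h : x.2 ≠ 0) :
    X.apply (fun u => ⟨0, 0, 1 / u.2 ^ 2, 0⟩) x = oddCoeff₂ (X 1 x) (X 3 x) x.2 := by
  rw [X.apply_odd₂ (hasFDerivAt_div_snd_sq 1 h)]
  ext <;> simp [oddCoeff₂]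

end

/-- The equations between the coefficients of a vector field in two charts, where the change of
coordinates is given by `1 / r`, `t / r + s θ₁θ₂ / r²`, `θ₁ / r`, `θ₂ / r²`. -/
def Related (s : ℂ) (P Q C D : Grass) (p q c d : Grass) (r t : ℂ) : Prop :=
  P = invCoeff p r ∧ Q = quotCoeff s p q c d r t ∧ C = oddCoeff₁ p c r ∧ D = oddCoeff₂ p d r

theorem forall_coord_iff (φ : ℂ × ℂ → Subst) (X : VectorField) (x : ℂ × ℂ) (Z : Fin 4 → Grass) :
    (∀ a, X.apply (fun u => (φ u).pull (coord a)) x = Z a) ↔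
      Z 0 = X.apply (fun u => ⟨(φ u).y.1, 0, 0, (φ u).ν.1⟩) x ∧
      Z 1 = X.apply (fun u => ⟨(φ u).y.2, 0, 0, (φ u).ν.2⟩) x ∧
      Z 2 = X.apply (fun u => ⟨0, (φ u).a, 0, 0⟩) x ∧
      Z 3 = X.apply (fun u => ⟨0, 0, (φ u).b, 0⟩) x := by
  simp only [← (fun u => (φ u).pull_coord.1 : ∀ u, _), ← (fun u => (φ u).pull_coord.2.1 : ∀ u, _),
    ← (fun u => (φ u).pull_coord.2.2.1 : ∀ u, _), ← (fun u => (φ u).pull_coord.2.2.2 : ∀ u, _)]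
  refine ⟨fun h => ⟨(h 0).symm, (h 1).symm, (h 2).symm, (h 3).symm⟩, ?_⟩
  rintro ⟨h0, h1, h2, h3⟩ a
  fin_cases a
  · exact h0.symm
  · exact h1.symm
  · exact h2.symm
  · exact h3.symm

theorem glue01_iff (lam : ℂ) (X Y : VectorField) {x : ℂ × ℂ} (h : x.1 ≠ 0) :
    (∀ a, X.apply (fun u => (tr lam 0 1 u).pull (coord a)) x = (tr lam 0 1 x).pull (Y a)) ↔
      Related lam ((tr lam 0 1 x).pull (Y 0)) ((tr lam 0 1 x).pull (Y 1))
        ((tr lam 0 1 x).pull (Y 2)) ((tr lam 0 1 x).pull (Y 3)) (X 0 x) (X 1 x) (X 2 x) (X 3 x)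
        x.1 x.2 := by
  rw [forall_coord_iff]
  simp only [tr]
  rw [apply_fst_inv X h, apply_fst_quot X lam h, apply_fst_odd₁ X h, apply_fst_odd₂ X h, Related]

/-- The inverse of the third transition has the shape of the first, with `-λ` in place of `λ` and
the even coordinates of `U₀` exchanged. This lets the classification treat both neighbours of `U₀`
by the same equations. -/
theorem glue02_iff (lam : ℂ) (X Y : VectorField) {x : ℂ × ℂ} (h : x.1 ≠ 0) :
    (∀ a, X.apply (fun u => (tr lam 0 2 u).pull (coord a)) x = (tr lam 0 2 x).pull (Y a)) ↔
      Related (-lam) ((tr lam 0 2 x).pull (Y 1)) ((tr lam 0 2 x).pull (Y 0))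
        ((tr lam 0 2 x).pull (Y 2)) ((tr lam 0 2 x).pull (Y 3)) (X 0 x) (X 1 x) (X 2 x) (X 3 x)
        x.1 x.2 := by
  rw [forall_coord_iff]
  simp only [tr]
  rw [apply_fst_inv X h, apply_fst_quot X (-lam) h, apply_fst_odd₁ X h, apply_fst_odd₂ X h, Related]
  exact and_left_comm

theorem glue12_iff (lam : ℂ) (X Y : VectorField) {x : ℂ × ℂ} (h : x.2 ≠ 0) :
    (∀ a, X.apply (fun u => (tr lam 1 2 u).pull (coord a)) x = (tr lam 1 2 x).pull (Y a)) ↔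
      Related lam ((tr lam 1 2 x).pull (Y 1)) ((tr lam 1 2 x).pull (Y 0))
        ((tr lam 1 2 x).pull (Y 2)) ((tr lam 1 2 x).pull (Y 3)) (X 1 x) (X 0 x) (X 2 x) (X 3 x)
        x.2 x.1 := by
  rw [forall_coord_iff]
  simp only [tr]
  rw [apply_snd_inv X h, apply_snd_quot X lam h, apply_snd_odd₁ X h, apply_snd_odd₂ X h, Related]
  exact and_left_comm

theorem glue20_iff (lam : ℂ) (X Y : VectorField) {x : ℂ × ℂ} (h : x.2 ≠ 0) :
    (∀ a, X.apply (fun u => (tr lam 2 0 u).pull (coord a)) x = (tr lam 2 0 x).pull (Y a)) ↔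
      Related lam ((tr lam 2 0 x).pull (Y 0)) ((tr lam 2 0 x).pull (Y 1))
        ((tr lam 2 0 x).pull (Y 2)) ((tr lam 2 0 x).pull (Y 3)) (X 1 x) (X 0 x) (X 2 x) (X 3 x)
        x.2 x.1 := by
  rw [forall_coord_iff]
  simp only [tr]
  rw [apply_snd_inv X h, apply_snd_quot X lam h, apply_snd_odd₁ X h, apply_snd_odd₂ X h, Related]

/-- The component equations expressing `Related` for an even vector field. -/
structure EvenRel (s : ℂ) (P Q C D : ℂ × ℂ → Grass) (z ν : ℂ × ℂ) (p q c d : Grass) (r t : ℂ) :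
    Prop where
  p0 : r ^ 2 * (P z).body = -p.body
  q0 : r ^ 2 * (Q z).body = r * q.body - t * p.body
  c1 : r * (C z).c1 = r * c.c1 - p.body
  c2 : (C z).c2 = r * c.c2
  d1 : r * (D z).c1 = d.c1
  d2 : r * (D z).c2 = r * d.c2 - 2 * p.body
  p12 : (P z).c12 + r ^ 3 * fderiv ℂ (fun u => (P u).body) z ν = -(r * p.c12)
  q12 : (Q z).c12 + r ^ 3 * fderiv ℂ (fun u => (Q u).body) z ν =
    r ^ 2 * q.c12 - r * t * p.c12 - 2 * s * p.body + s * r * (c.c1 + d.c2)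

/-- The component equations expressing `Related` for an odd vector field. -/
structure OddRel (s : ℂ) (P Q C D : ℂ × ℂ → Grass) (z ν : ℂ × ℂ) (p q c d : Grass) (r t : ℂ) :
    Prop where
  p1 : r * (P z).c1 = -p.c1
  p2 : (P z).c2 = -p.c2
  q1 : r * (Q z).c1 = r * q.c1 - t * p.c1 - s * d.body
  q2 : (Q z).c2 = r * q.c2 - t * p.c2 + s * c.body
  c0 : r * (C z).body = c.body
  d0 : r ^ 2 * (D z).body = d.body
  c12 : (C z).c12 + r ^ 3 * fderiv ℂ (fun u => (C u).body) z ν = r ^ 2 * c.c12 + r * p.c2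
  d12 : (D z).c12 + r ^ 3 * fderiv ℂ (fun u => (D u).body) z ν = r * d.c12 - 2 * p.c1

section

variable {s : ℂ} {P Q C D : ℂ × ℂ → Grass} {z ν : ℂ × ℂ} {p q c d : Grass} {r t : ℂ}

/-- Parity removes half of the sixteen component equations; in the rest the denominators are
cleared. The hypotheses on `fderiv` are separate because homogeneity at the single point `z` does
not control derivatives there. -/
theorem related_iff_evenRel (hr : r ≠ 0) (hp : p.IsHomog 0) (hq : q.IsHomog 0) (hc : c.IsHomog 1)
    (hd : d.IsHomog 1) (hP : (P z).IsHomog 0) (hQ : (Q z).IsHomog 0) (hC : (C z).IsHomog 1)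
    (hD : (D z).IsHomog 1) (hC' : fderiv ℂ (fun u => (C u).body) z ν = 0)
    (hD' : fderiv ℂ (fun u => (D u).body) z ν = 0) :
    Related s (pull P z ν (1 / r) (1 / r ^ 2)) (pull Q z ν (1 / r) (1 / r ^ 2))
      (pull C z ν (1 / r) (1 / r ^ 2)) (pull D z ν (1 / r) (1 / r ^ 2)) p q c d r t ↔
    EvenRel s P Q C D z ν p q c d r t := by
  rw [isHomog_zero] at hp hq hP hQ
  rw [isHomog_one] at hc hd hC hD
  constructor
  · rintro ⟨h1, h2, h3, h4⟩
    simp only [Grass.ext_iff, pull, invCoeff, quotCoeff, oddCoeff₁, oddCoeff₂, Grass.mul_body,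
      Grass.mul_c1, Grass.mul_c2, Grass.mul_c12, Grass.add_body, Grass.add_c1, Grass.add_c2,
      Grass.add_c12] at h1 h2 h3 h4
    simp only [hp, hq, hc, hd, hP, hQ, hC, hD, hC', hD', mul_zero, zero_mul, add_zero, zero_add,
      sub_zero] at h1 h2 h3 h4
    field_simp at h1 h2 h3 h4
    constructor <;> grind
  · rintro ⟨h1, h2, h3, h4, h5, h6, h7, h8⟩
    refine ⟨?_, ?_, ?_, ?_⟩ <;> ext <;>
    simp only [pull, invCoeff, quotCoeff, oddCoeff₁, oddCoeff₂, Grass.mul_body,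
      Grass.mul_c1, Grass.mul_c2, Grass.mul_c12, Grass.add_body, Grass.add_c1, Grass.add_c2,
      Grass.add_c12, hp, hq, hc, hd, hP, hQ, hC, hD, hC', hD', mul_zero, zero_mul, add_zero,
      zero_add, sub_zero] <;> field_simp <;> grind

theorem related_iff_oddRel (hr : r ≠ 0) (hp : p.IsHomog 1) (hq : q.IsHomog 1) (hc : c.IsHomog 0)
    (hd : d.IsHomog 0) (hP : (P z).IsHomog 1) (hQ : (Q z).IsHomog 1) (hC : (C z).IsHomog 0)
    (hD : (D z).IsHomog 0) (hP' : fderiv ℂ (fun u => (P u).body) z ν = 0)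
    (hQ' : fderiv ℂ (fun u => (Q u).body) z ν = 0) :
    Related s (pull P z ν (1 / r) (1 / r ^ 2)) (pull Q z ν (1 / r) (1 / r ^ 2))
      (pull C z ν (1 / r) (1 / r ^ 2)) (pull D z ν (1 / r) (1 / r ^ 2)) p q c d r t ↔
    OddRel s P Q C D z ν p q c d r t := by
  rw [isHomog_one] at hp hq hP hQ
  rw [isHomog_zero] at hc hd hC hD
  constructor
  · rintro ⟨h1, h2, h3, h4⟩
    simp only [Grass.ext_iff, pull, invCoeff, quotCoeff, oddCoeff₁, oddCoeff₂, Grass.mul_body,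
      Grass.mul_c1, Grass.mul_c2, Grass.mul_c12, Grass.add_body, Grass.add_c1, Grass.add_c2,
      Grass.add_c12] at h1 h2 h3 h4
    simp only [hp, hq, hc, hd, hP, hQ, hC, hD, hP', hQ', mul_zero, zero_mul, add_zero, zero_add,
      sub_zero] at h1 h2 h3 h4
    field_simp at h1 h2 h3 h4
    constructor <;> grind
  · rintro ⟨h1, h2, h3, h4, h5, h6, h7, h8⟩
    refine ⟨?_, ?_, ?_, ?_⟩ <;> ext <;>
    simp only [pull, invCoeff, quotCoeff, oddCoeff₁, oddCoeff₂, Grass.mul_body,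
      Grass.mul_c1, Grass.mul_c2, Grass.mul_c12, Grass.add_body, Grass.add_c1, Grass.add_c2,
      Grass.add_c12, hp, hq, hc, hd, hP, hQ, hC, hD, hP', hQ', mul_zero, zero_mul, add_zero,
      zero_add, sub_zero] <;> field_simp <;> grind

end

/-! ### The explicit global vector fields -/

/-- The general polynomial of degree at most two on `ℂ²`. -/
def quad (a b c d e f : ℂ) (u : ℂ × ℂ) : ℂ :=
  a + b * u.1 + c * u.2 + d * u.1 ^ 2 + e * (u.1 * u.2) + f * u.2 ^ 2

theorem analyticAt_quad (a b c d e f : ℂ) (x : ℂ × ℂ) : AnalyticAt ℂ (quad a b c d e f) x := by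
  have p1 : AnalyticAt ℂ (fun u : ℂ × ℂ => u.1) x := analyticAt_fst
  have p2 : AnalyticAt ℂ (fun u : ℂ × ℂ => u.2) x := analyticAt_snd
  have k (r : ℂ) : AnalyticAt ℂ (fun _ : ℂ × ℂ => r) x := analyticAt_const
  exact (((((k a).fun_add ((k b).fun_mul p1)).fun_add ((k c).fun_mul p2)).fun_add
    ((k d).fun_mul (p1.fun_pow 2))).fun_add ((k e).fun_mul (p1.fun_mul p2))).fun_add
    ((k f).fun_mul (p2.fun_pow 2))

theorem fderiv_quad (a b c d e f : ℂ) (x v : ℂ × ℂ) : fderiv ℂ (quad a b c d e f) x v =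
    b * v.1 + c * v.2 + 2 * d * x.1 * v.1 + e * (x.1 * v.2 + x.2 * v.1) + 2 * f * x.2 * v.2 := by
  have p1 : HasFDerivAt (fun u : ℂ × ℂ => u.1) (ContinuousLinearMap.fst ℂ ℂ ℂ) x := hasFDerivAt_fst
  have p2 : HasFDerivAt (fun u : ℂ × ℂ => u.2) (ContinuousLinearMap.snd ℂ ℂ ℂ) x := hasFDerivAt_snd
  have e1 : quad a b c d e f = fun u => a + b * u.1 + c * u.2 + d * (u.1 * u.1) + e * (u.1 * u.2) +
      f * (u.2 * u.2) := by funext u; simp only [quad]; ring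
  have h : HasFDerivAt (quad a b c d e f) _ x := e1 ▸
    (((((p1.const_mul b).const_add a).fun_add (p2.const_mul c)).fun_add
      ((p1.fun_mul p1).const_mul d)).fun_add ((p1.fun_mul p2).const_mul e)).fun_add
      ((p2.fun_mul p2).const_mul f)
  rw [h.fderiv]
  simp
  ring

/-- The even vector field with given components. -/
def evenVF (A A' B B' C C' D D' : ℂ × ℂ → ℂ) : VectorField :=
  ![fun u => ⟨A u, 0, 0, A' u⟩, fun u => ⟨B u, 0, 0, B' u⟩, fun u => ⟨0, C u, C' u, 0⟩,
    fun u => ⟨0, D u, D' u, 0⟩]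

/-- The odd vector field with given components. -/
def oddVF (A A' B B' C C' D D' : ℂ × ℂ → ℂ) : VectorField :=
  ![fun u => ⟨0, A u, A' u, 0⟩, fun u => ⟨0, B u, B' u, 0⟩, fun u => ⟨C u, 0, 0, C' u⟩,
    fun u => ⟨D u, 0, 0, D' u⟩]

section

variable {A A' B B' C C' D D' : ℂ × ℂ → ℂ}

theorem isHomog_evenVF : (evenVF A A' B B' C C' D D').IsHomog 0 :=
  VectorField.isHomog_zero_iff.2 fun _ => by simp [evenVF]

theorem isHomog_oddVF : (oddVF A A' B B' C C' D D').IsHomog 1 :=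
  VectorField.isHomog_one_iff.2 fun _ => by simp [oddVF]

theorem holAt_evenVF {x : ℂ × ℂ} (h1 : AnalyticAt ℂ A x) (h2 : AnalyticAt ℂ A' x)
    (h3 : AnalyticAt ℂ B x) (h4 : AnalyticAt ℂ B' x) (h5 : AnalyticAt ℂ C x)
    (h6 : AnalyticAt ℂ C' x) (h7 : AnalyticAt ℂ D x) (h8 : AnalyticAt ℂ D' x) (a : Fin 4) :
    HolAt (evenVF A A' B B' C C' D D' a) x := by
  fin_cases a
  · exact ⟨h1, analyticAt_const, analyticAt_const, h2⟩
  · exact ⟨h3, analyticAt_const, analyticAt_const, h4⟩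
  · exact ⟨analyticAt_const, h5, h6, analyticAt_const⟩
  · exact ⟨analyticAt_const, h7, h8, analyticAt_const⟩

theorem holAt_oddVF {x : ℂ × ℂ} (h1 : AnalyticAt ℂ A x) (h2 : AnalyticAt ℂ A' x)
    (h3 : AnalyticAt ℂ B x) (h4 : AnalyticAt ℂ B' x) (h5 : AnalyticAt ℂ C x)
    (h6 : AnalyticAt ℂ C' x) (h7 : AnalyticAt ℂ D x) (h8 : AnalyticAt ℂ D' x) (a : Fin 4) :
    HolAt (oddVF A A' B B' C C' D D' a) x := by
  fin_cases a
  · exact ⟨analyticAt_const, h1, h2, analyticAt_const⟩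
  · exact ⟨analyticAt_const, h3, h4, analyticAt_const⟩
  · exact ⟨h5, analyticAt_const, analyticAt_const, h6⟩
  · exact ⟨h7, analyticAt_const, analyticAt_const, h8⟩

end

/-- The local expressions of the general even global vector field. -/
def evenGlobal (lam : ℂ) (c : Fin 12 → ℂ) : Fin 3 → VectorField
  -- The parameter `c k` is the coefficient of the `(k+1)`-st listed field. The expressions in
  -- charts 1 and 2 are forced by the transition equations.
  | 0 => evenVF (quad (c 0) (c 4) (c 2) (c 10) (c 11) 0) (quad (-lam * c 11) 0 0 0 0 0)
      (quad (c 1) (c 3) (-c 4 + c 8 + c 9) 0 (c 10) (c 11)) (quad (lam * c 10) 0 0 0 0 0)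
      (quad (c 8) (c 10) (c 11) 0 0 0) (quad 0 0 0 0 0 0)
      (quad (c 5) (c 6) (c 7) 0 0 0) (quad (c 9) (2 * c 10) (2 * c 11) 0 0 0)
  | 1 => evenVF (quad (-c 10) (-c 4) (-c 11) (-c 0) (-c 2) 0) (quad (-lam * c 2) 0 0 0 0 0)
      (quad (c 3) (c 1) (c 8 + c 9 - 2 * c 4) 0 (-c 0) (-c 2)) (quad (lam * c 0) 0 0 0 0 0)
      (quad (c 8 - c 4) (-c 0) (-c 2) 0 0 0) (quad 0 0 0 0 0 0)
      (quad (c 6) (c 5) (c 7) 0 0 0) (quad (c 9 - 2 * c 4) (-2 * c 0) (-2 * c 2) 0 0 0)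
  | 2 => evenVF (quad (-c 11) (c 4 - c 8 - c 9) (-c 10) (-c 1) (-c 3) 0)
      (quad (lam * c 3) 0 0 0 0 0)
      (quad (c 2) (c 0) (2 * c 4 - c 8 - c 9) 0 (-c 1) (-c 3)) (quad (-lam * c 1) 0 0 0 0 0)
      (quad (c 4 - c 9) (-c 1) (-c 3) 0 0 0) (quad 0 0 0 0 0 0)
      (quad (c 7) (c 5) (c 6) 0 0 0) (quad (2 * c 4 - 2 * c 8 - c 9) (-2 * c 1) (-2 * c 3) 0 0 0)

/-- The local expressions of the general odd global vector field. -/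
def oddGlobal (lam : ℂ) (c : Fin 12 → ℂ) : Fin 3 → VectorField
  | 0 => oddVF (quad (c 2) (c 10) (lam * c 7) 0 0 0) (quad (lam * c 9) 0 0 0 0 0)
      (quad (c 3) (-lam * c 6) (c 10 - lam * c 11) 0 0 0) (quad (lam * c 8) 0 0 0 0 0)
      (quad (c 0) (c 8) (-c 9) 0 0 0) (quad 0 0 0 0 0 0)
      (quad (c 1) (c 4) (c 5) (c 6) (c 11) (c 7)) (quad (2 * c 10 - lam * c 11) 0 0 0 0 0)
  | 1 => oddVF (quad (-c 10) (-c 2) (-lam * c 7) 0 0 0) (quad (-lam * c 9) 0 0 0 0 0)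
      (quad (c 3 + lam * c 4) (lam * c 1) (lam * c 5 - c 2) 0 0 0) (quad (-lam * c 0) 0 0 0 0 0)
      (quad (c 8) (c 0) (-c 9) 0 0 0) (quad 0 0 0 0 0 0)
      (quad (c 6) (c 4) (c 11) (c 1) (c 5) (c 7)) (quad (lam * c 5 - 2 * c 2) 0 0 0 0 0)
  | 2 => oddVF (quad (lam * c 11 - c 10) (-c 3) (lam * c 6) 0 0 0) (quad (-lam * c 8) 0 0 0 0 0)
      (quad (c 2 - lam * c 5) (-lam * c 1) (-c 3 - lam * c 4) 0 0 0) (quad (lam * c 0) 0 0 0 0 0)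
      (quad (-c 9) (c 0) (c 8) 0 0 0) (quad 0 0 0 0 0 0)
      (quad (c 7) (c 5) (c 11) (c 1) (c 4) (c 6)) (quad (-lam * c 4 - 2 * c 3) 0 0 0 0 0)

/-- The existence half, valid for every `λ`. All components are polynomials of degree at most two,
so each component of the glueing equations is an identity of rational functions. -/
theorem isGlobal_evenGlobal (lam : ℂ) (c : Fin 12 → ℂ) : IsGlobal lam 0 (evenGlobal lam c) := by
  have homog (i : Fin 3) : (evenGlobal lam c i).IsHomog 0 := by
    fin_cases i <;> exact isHomog_evenVF
  refine ⟨fun i a x => ?_, homog, fun x hx => ?_, fun x hx => ?_, fun x hx => ?_⟩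
  · fin_cases i <;> exact holAt_evenVF (analyticAt_quad ..) (analyticAt_quad ..)
      (analyticAt_quad ..) (analyticAt_quad ..) (analyticAt_quad ..) (analyticAt_quad ..)
      (analyticAt_quad ..) (analyticAt_quad ..) a
  · refine (glue01_iff lam _ _ hx).2 ((related_iff_evenRel hx (homog 1 0 _) (homog 1 1 _)
      (homog 1 2 _) (homog 1 3 _) (homog 0 0 _) (homog 0 1 _) (homog 0 2 _) (homog 0 3 _)
      ?_ ?_).2 ?_)
    · simp [evenGlobal, evenVF]
    · simp [evenGlobal, evenVF]
    · constructor <;> 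
        simp [evenGlobal, evenVF, fderiv_quad, tr] <;> simp [quad] <;> field_simp <;> ring
  · refine (glue12_iff lam _ _ hx).2 ((related_iff_evenRel hx (homog 2 1 _) (homog 2 0 _)
      (homog 2 2 _) (homog 2 3 _) (homog 1 1 _) (homog 1 0 _) (homog 1 2 _) (homog 1 3 _)
      ?_ ?_).2 ?_)
    · simp [evenGlobal, evenVF]
    · simp [evenGlobal, evenVF]
    · constructor <;> 
        simp [evenGlobal, evenVF, fderiv_quad, tr] <;> simp [quad] <;> field_simp <;> ring
  · refine (glue20_iff lam _ _ hx).2 ((related_iff_evenRel hx (homog 0 1 _) (homog 0 0 _)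
      (homog 0 2 _) (homog 0 3 _) (homog 2 0 _) (homog 2 1 _) (homog 2 2 _) (homog 2 3 _)
      ?_ ?_).2 ?_)
    · simp [evenGlobal, evenVF]
    · simp [evenGlobal, evenVF]
    · constructor <;> 
        simp [evenGlobal, evenVF, fderiv_quad, tr] <;> simp [quad] <;> field_simp <;> ring

theorem isGlobal_oddGlobal (lam : ℂ) (c : Fin 12 → ℂ) : IsGlobal lam 1 (oddGlobal lam c) := by
  have homog (i : Fin 3) : (oddGlobal lam c i).IsHomog 1 := by
    fin_cases i <;> exact isHomog_oddVF
  refine ⟨fun i a x => ?_, homog, fun x hx => ?_, fun x hx => ?_, fun x hx => ?_⟩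
  · fin_cases i <;> exact holAt_oddVF (analyticAt_quad ..) (analyticAt_quad ..)
      (analyticAt_quad ..) (analyticAt_quad ..) (analyticAt_quad ..) (analyticAt_quad ..)
      (analyticAt_quad ..) (analyticAt_quad ..) a
  · refine (glue01_iff lam _ _ hx).2 ((related_iff_oddRel hx (homog 1 0 _) (homog 1 1 _)
      (homog 1 2 _) (homog 1 3 _) (homog 0 0 _) (homog 0 1 _) (homog 0 2 _) (homog 0 3 _)
      ?_ ?_).2 ?_)
    · simp [oddGlobal, oddVF]
    · simp [oddGlobal, oddVF]
    · constructor <;> 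
        simp [oddGlobal, oddVF, fderiv_quad, tr] <;> simp [quad] <;> field_simp <;> ring
  · refine (glue12_iff lam _ _ hx).2 ((related_iff_oddRel hx (homog 2 1 _) (homog 2 0 _)
      (homog 2 2 _) (homog 2 3 _) (homog 1 1 _) (homog 1 0 _) (homog 1 2 _) (homog 1 3 _)
      ?_ ?_).2 ?_)
    · simp [oddGlobal, oddVF]
    · simp [oddGlobal, oddVF]
    · constructor <;> 
        simp [oddGlobal, oddVF, fderiv_quad, tr] <;> simp [quad] <;> field_simp <;> ring
  · refine (glue20_iff lam _ _ hx).2 ((related_iff_oddRel hx (homog 0 1 _) (homog 0 0 _)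
      (homog 0 2 _) (homog 0 3 _) (homog 2 0 _) (homog 2 1 _) (homog 2 2 _) (homog 2 3 _)
      ?_ ?_).2 ?_)
    · simp [oddGlobal, oddVF]
    · simp [oddGlobal, oddVF]
    · constructor <;> 
        simp [oddGlobal, oddVF, fderiv_quad, tr] <;> simp [quad] <;> field_simp <;> ring

/-- The expression in the first chart of the general even global vector field. -/
def evenLin (lam : ℂ) : (Fin 12 → ℂ) →ₗ[ℂ] VectorField where
  toFun c := evenGlobal lam c 0
  map_add' c d := by
    funext a u
    fin_cases a <;> ext <;> simp [evenGlobal, evenVF, quad] <;> ring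
  map_smul' r c := by
    funext a u
    fin_cases a <;> ext <;> simp [evenGlobal, evenVF, quad] <;> ring

/-- The expression in the first chart of the general odd global vector field. -/
def oddLin (lam : ℂ) : (Fin 12 → ℂ) →ₗ[ℂ] VectorField where
  toFun c := oddGlobal lam c 0
  map_add' c d := by
    funext a u
    fin_cases a <;> ext <;> simp [oddGlobal, oddVF, quad] <;> ring
  map_smul' r c := by
    funext a u
    fin_cases a <;> ext <;> simp [oddGlobal, oddVF, quad] <;> ring

theorem Grass.two_eq : (2 : Grass) = ⟨2, 0, 0, 0⟩ := by
  rw [← one_add_one_eq_two]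
  (ext <;> simp); norm_num

theorem coordField_eq : dz₁ = ![1, 0, 0, 0] ∧ dz₂ = ![0, 1, 0, 0] ∧ dθ₁ = ![0, 0, 1, 0] ∧
    dθ₂ = ![0, 0, 0, 1] := by
  refine ⟨?_, ?_, ?_, ?_⟩ <;> funext a <;> fin_cases a <;> rfl

theorem evenLin_single (lam : ℂ) (k : Fin 12) : evenLin lam (Pi.single k 1) = evenField lam k := by
  obtain ⟨h1, h2, h3, h4⟩ := coordField_eq
  change evenGlobal lam (Pi.single k 1) 0 = evenField lam k
  rw [evenField, h1, h2, h3, h4]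
  fin_cases k <;>
    simp only [Fin.reduceFinMk, Fin.zero_eta, Fin.mk_one, Fin.isValue, evenGlobal, evenVF,
      Pi.single_apply, Fin.reduceEq, ↓reduceIte, mul_zero, mul_one, add_zero, zero_add, neg_zero,
      Matrix.cons_val, Matrix.cons_val_zero, Matrix.cons_val_one] <;>
    funext a u <;> fin_cases a <;> ext <;>
    simp [quad, z₁, z₂, θ₁, θ₂, pow_two, Grass.two_eq]

theorem oddLin_single (lam : ℂ) (k : Fin 12) : oddLin lam (Pi.single k 1) = oddField lam k := by
  obtain ⟨h1, h2, h3, h4⟩ := coordField_eq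
  change oddGlobal lam (Pi.single k 1) 0 = oddField lam k
  rw [oddField, h1, h2, h3, h4]
  fin_cases k <;>
    simp only [Fin.reduceFinMk, Fin.zero_eta, Fin.mk_one, Fin.isValue, oddGlobal, oddVF,
      Pi.single_apply, Fin.reduceEq, ↓reduceIte, mul_zero, mul_one, neg_zero,
      sub_zero, zero_sub, Matrix.cons_val, Matrix.cons_val_zero, Matrix.cons_val_one] <;>
    funext a u <;> fin_cases a <;> ext <;>
    simp [quad, z₁, z₂, θ₁, θ₂, pow_two, Grass.two_eq]

/-! ### Classification of the global vector fields -/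

/-- This converts regularity of a coefficient of chart 1 into an equation: an expression that must
be divisible by `w₁` vanishes on the line `w₁ = 0`. -/
theorem eq_zero_on_line {F G : ℂ × ℂ → ℂ} (hF : Continuous F) (hG : Continuous G)
    (h : ∀ w : ℂ × ℂ, w.1 ≠ 0 → F w = w.1 * G w) (t : ℂ) : F (0, t) = 0 := by
  rw [eq_of_eq_off_line hF (continuous_fst.mul hG) h]
  simp

/-- The reduced transition between charts 0 and 1 is an involution, so the equations at a point of
chart 1 can be read at a given point `z` of chart 0. -/
theorem involution_eq {z : ℂ × ℂ} (hz : z.1 ≠ 0) :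
    ((1 / (1 / z.1), z.2 / z.1 / (1 / z.1)) : ℂ × ℂ) = z := by
  ext <;> field_simp

theorem involution_swap_eq {z : ℂ × ℂ} (hz : z.2 ≠ 0) :
    ((z.1 / z.2 / (1 / z.2), 1 / (1 / z.2)) : ℂ × ℂ) = z := by
  ext <;> field_simp

theorem VectorField.IsHomog.of_add_eq {p q : ZMod 2} {X : VectorField} (h : X.IsHomog p) {a : Fin 4}
    (hq : p + par a = q) (x : ℂ × ℂ) : (X a x).IsHomog q := hq ▸ h a x

namespace H0T

variable {lam : ℂ} {p : ZMod 2}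

theorem coeff_add (D E : H0T lam p) (i : Fin 3) : coeff (D + E) i = coeff D i + coeff E i := rfl

theorem coeff_smul (r : ℂ) (D : H0T lam p) (i : Fin 3) : coeff (r • D) i = r • coeff D i := rfl

theorem continuous_body (D : H0T lam p) (i : Fin 3) (a : Fin 4) :
    Continuous fun w => (coeff D i a w).body :=
  continuous_iff_continuousAt.2 fun w => (holAt_coeff D i a w).body.continuousAt

theorem continuous_c1 (D : H0T lam p) (i : Fin 3) (a : Fin 4) :
    Continuous fun w => (coeff D i a w).c1 :=
  continuous_iff_continuousAt.2 fun w => (holAt_coeff D i a w).c1.continuousAt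

theorem continuous_c2 (D : H0T lam p) (i : Fin 3) (a : Fin 4) :
    Continuous fun w => (coeff D i a w).c2 :=
  continuous_iff_continuousAt.2 fun w => (holAt_coeff D i a w).c2.continuousAt

theorem continuous_c12 (D : H0T lam p) (i : Fin 3) (a : Fin 4) :
    Continuous fun w => (coeff D i a w).c12 :=
  continuous_iff_continuousAt.2 fun w => (holAt_coeff D i a w).c12.continuousAt

theorem evenRel01 (D : H0T lam 0) {w : ℂ × ℂ} (hw : w.1 ≠ 0) :
    EvenRel lam (coeff D 0 0) (coeff D 0 1) (coeff D 0 2) (coeff D 0 3) (1 / w.1, w.2 / w.1)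
      (tr lam 0 1 w).ν (coeff D 1 0 w) (coeff D 1 1 w) (coeff D 1 2 w) (coeff D 1 3 w) w.1 w.2 := by
  have hom i := isHomog_coeff D i
  have b (a : Fin 4) (h : (0 : ZMod 2) + par a = 1) : (fun u => (coeff D 0 a u).body) = fun _ => 0 :=
    funext fun u => (isHomog_one.1 ((hom 0).of_add_eq h u)).1
  refine (related_iff_evenRel hw (hom 1 0 w) (hom 1 1 w) (hom 1 2 w) (hom 1 3 w) (hom 0 0 _)
    (hom 0 1 _) (hom 0 2 _) (hom 0 3 _) ?_ ?_).1
      ((glue01_iff lam _ _ hw).1 (glue D 0 1 w (by simpa [chartVec] using hw)))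
  · rw [b 2 rfl]; simp
  · rw [b 3 rfl]; simp

theorem evenRel02 (D : H0T lam 0) {w : ℂ × ℂ} (hw : w.1 ≠ 0) :
    EvenRel (-lam) (coeff D 0 1) (coeff D 0 0) (coeff D 0 2) (coeff D 0 3) (w.2 / w.1, 1 / w.1)
      (tr lam 0 2 w).ν (coeff D 2 0 w) (coeff D 2 1 w) (coeff D 2 2 w) (coeff D 2 3 w) w.1 w.2 := by
  have hom i := isHomog_coeff D i
  have b (a : Fin 4) (h : (0 : ZMod 2) + par a = 1) : (fun u => (coeff D 0 a u).body) = fun _ => 0 :=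
    funext fun u => (isHomog_one.1 ((hom 0).of_add_eq h u)).1
  refine (related_iff_evenRel hw (hom 2 0 w) (hom 2 1 w) (hom 2 2 w) (hom 2 3 w) (hom 0 1 _)
    (hom 0 0 _) (hom 0 2 _) (hom 0 3 _) ?_ ?_).1
      ((glue02_iff lam _ _ hw).1 (glue D 0 2 w (by simpa [chartVec] using hw)))
  · rw [b 2 rfl]; simp
  · rw [b 3 rfl]; simp

theorem oddRel01 (D : H0T lam 1) {w : ℂ × ℂ} (hw : w.1 ≠ 0) :
    OddRel lam (coeff D 0 0) (coeff D 0 1) (coeff D 0 2) (coeff D 0 3) (1 / w.1, w.2 / w.1)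
      (tr lam 0 1 w).ν (coeff D 1 0 w) (coeff D 1 1 w) (coeff D 1 2 w) (coeff D 1 3 w) w.1 w.2 := by
  have hom i := isHomog_coeff D i
  have b (a : Fin 4) (h : (1 : ZMod 2) + par a = 1) : (fun u => (coeff D 0 a u).body) = fun _ => 0 :=
    funext fun u => (isHomog_one.1 ((hom 0).of_add_eq h u)).1
  refine (related_iff_oddRel hw (hom 1 0 w) (hom 1 1 w) (hom 1 2 w) (hom 1 3 w) (hom 0 0 _)
    (hom 0 1 _) (hom 0 2 _) (hom 0 3 _) ?_ ?_).1
      ((glue01_iff lam _ _ hw).1 (glue D 0 1 w (by simpa [chartVec] using hw)))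
  · rw [b 0 rfl]; simp
  · rw [b 1 rfl]; simp

theorem oddRel02 (D : H0T lam 1) {w : ℂ × ℂ} (hw : w.1 ≠ 0) :
    OddRel (-lam) (coeff D 0 1) (coeff D 0 0) (coeff D 0 2) (coeff D 0 3) (w.2 / w.1, 1 / w.1)
      (tr lam 0 2 w).ν (coeff D 2 0 w) (coeff D 2 1 w) (coeff D 2 2 w) (coeff D 2 3 w) w.1 w.2 := by
  have hom i := isHomog_coeff D i
  have b (a : Fin 4) (h : (1 : ZMod 2) + par a = 1) : (fun u => (coeff D 0 a u).body) = fun _ => 0 :=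
    funext fun u => (isHomog_one.1 ((hom 0).of_add_eq h u)).1
  refine (related_iff_oddRel hw (hom 2 0 w) (hom 2 1 w) (hom 2 2 w) (hom 2 3 w) (hom 0 1 _)
    (hom 0 0 _) (hom 0 2 _) (hom 0 3 _) ?_ ?_).1
      ((glue02_iff lam _ _ hw).1 (glue D 0 2 w (by simpa [chartVec] using hw)))
  · rw [b 1 rfl]; simp
  · rw [b 0 rfl]; simp

/-- The shift `ν` may be forgotten: later uses involve only equations without it, or ones in which
the differentiated body vanishes identically. -/
theorem evenRel01' (D : H0T lam 0) {z : ℂ × ℂ} (hz : z.1 ≠ 0) :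
    ∃ ν, EvenRel lam (coeff D 0 0) (coeff D 0 1) (coeff D 0 2) (coeff D 0 3) z ν
      (coeff D 1 0 (1 / z.1, z.2 / z.1)) (coeff D 1 1 (1 / z.1, z.2 / z.1))
      (coeff D 1 2 (1 / z.1, z.2 / z.1)) (coeff D 1 3 (1 / z.1, z.2 / z.1)) (1 / z.1) (z.2 / z.1) := by
  have h := evenRel01 D (w := (1 / z.1, z.2 / z.1)) (one_div_ne_zero hz)
  rw [involution_eq hz] at h
  exact ⟨_, h⟩

theorem evenRel02' (D : H0T lam 0) {z : ℂ × ℂ} (hz : z.2 ≠ 0) :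
    ∃ ν, EvenRel (-lam) (coeff D 0 1) (coeff D 0 0) (coeff D 0 2) (coeff D 0 3) z ν
      (coeff D 2 0 (1 / z.2, z.1 / z.2)) (coeff D 2 1 (1 / z.2, z.1 / z.2))
      (coeff D 2 2 (1 / z.2, z.1 / z.2)) (coeff D 2 3 (1 / z.2, z.1 / z.2)) (1 / z.2) (z.1 / z.2) := by
  have h := evenRel02 D (w := (1 / z.2, z.1 / z.2)) (one_div_ne_zero hz)
  rw [involution_swap_eq hz] at h
  exact ⟨_, h⟩

theorem oddRel01' (D : H0T lam 1) {z : ℂ × ℂ} (hz : z.1 ≠ 0) :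
    ∃ ν, OddRel lam (coeff D 0 0) (coeff D 0 1) (coeff D 0 2) (coeff D 0 3) z ν
      (coeff D 1 0 (1 / z.1, z.2 / z.1)) (coeff D 1 1 (1 / z.1, z.2 / z.1))
      (coeff D 1 2 (1 / z.1, z.2 / z.1)) (coeff D 1 3 (1 / z.1, z.2 / z.1)) (1 / z.1) (z.2 / z.1) := by
  have h := oddRel01 D (w := (1 / z.1, z.2 / z.1)) (one_div_ne_zero hz)
  rw [involution_eq hz] at h
  exact ⟨_, h⟩

theorem oddRel02' (D : H0T lam 1) {z : ℂ × ℂ} (hz : z.2 ≠ 0) :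
    ∃ ν, OddRel (-lam) (coeff D 0 1) (coeff D 0 0) (coeff D 0 2) (coeff D 0 3) z ν
      (coeff D 2 0 (1 / z.2, z.1 / z.2)) (coeff D 2 1 (1 / z.2, z.1 / z.2))
      (coeff D 2 2 (1 / z.2, z.1 / z.2)) (coeff D 2 3 (1 / z.2, z.1 / z.2)) (1 / z.2) (z.1 / z.2) := by
  have h := oddRel02 D (w := (1 / z.2, z.1 / z.2)) (one_div_ne_zero hz)
  rw [involution_swap_eq hz] at h
  exact ⟨_, h⟩

/-- Vanishing of an even global vector field. -/
theorem coeff_eq_zero_of_even (hlam : lam ≠ 0) (E : H0T lam 0)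
    (hA : ∀ z, (coeff E 0 0 z).body = 0) (hB : ∀ z, (coeff E 0 1 z).body = 0)
    (hC : ∀ z, (coeff E 0 2 z).c1 = 0) (hD : ∀ z, (coeff E 0 3 z).c1 = 0) {d : ℂ}
    (hd : ∀ z, (coeff E 0 3 z).c2 = d) : coeff E 0 = 0 := by
  have fA : (fun u => (coeff E 0 0 u).body) = fun _ => 0 := funext hA
  have fB : (fun u => (coeff E 0 1 u).body) = fun _ => 0 := funext hB
  have hol a z := holAt_coeff E 0 a z
  -- With the leading terms zero, the `θ₁θ₂`-components of the even coefficients carry a factor `1 /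
  -- z₁`. The leftover scaling `d` enters only through `λ d`.
  have k1 {z : ℂ × ℂ} (hz : z.1 ≠ 0) : (coeff E 0 0 z).c12 =
      1 / z.1 * -(coeff E 1 0 (1 / z.1, z.2 / z.1)).c12 ∧ (coeff E 0 1 z).c12 =
      1 / z.1 * (1 / z.1 * (coeff E 1 1 (1 / z.1, z.2 / z.1)).c12 -
        z.2 / z.1 * (coeff E 1 0 (1 / z.1, z.2 / z.1)).c12 + lam * d) := by
    obtain ⟨ν, h⟩ := evenRel01' E hz
    have h1 := h.p12
    have h2 := h.q12
    have h3 := h.p0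
    have h4 := h.c1
    have h5 := h.d2
    simp only [fB, hA, hC, hd, fderiv_fun_const, Pi.zero_apply, zero_apply,
      mul_zero, add_zero] at h1 h2 h3 h4 h5
    refine ⟨by rw [h1]; ring, ?_⟩
    have h3' := neg_eq_zero.1 h3.symm
    rw [h3'] at h2 h4 h5
    rw [h2]
    linear_combination (-lam) * h4 - lam * h5
  have k2 {z : ℂ × ℂ} (hz : z.2 ≠ 0) : (coeff E 0 1 z).c12 =
      1 / z.2 * -(coeff E 2 0 (1 / z.2, z.1 / z.2)).c12 ∧ (coeff E 0 0 z).c12 =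
      1 / z.2 * (1 / z.2 * (coeff E 2 1 (1 / z.2, z.1 / z.2)).c12 -
        z.1 / z.2 * (coeff E 2 0 (1 / z.2, z.1 / z.2)).c12 - lam * d) := by
    obtain ⟨ν, h⟩ := evenRel02' E hz
    have h1 := h.p12
    have h2 := h.q12
    have h3 := h.p0
    have h4 := h.c1
    have h5 := h.d2
    simp only [fA, hB, hC, hd, fderiv_fun_const, Pi.zero_apply, zero_apply,
      mul_zero, add_zero] at h1 h2 h3 h4 h5
    refine ⟨by rw [h1]; ring, ?_⟩
    have h3' := neg_eq_zero.1 h3.symm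
    rw [h3'] at h2 h4 h5
    rw [h2]
    linear_combination lam * h4 + lam * h5
  have A12 z : (coeff E 0 0 z).c12 = 0 :=
    eq_zero_of_decay (f := fun z => (coeff E 0 0 z).c12) (g := fun w => -(coeff E 1 0 w).c12)
      (h := fun w => w.1 * (coeff E 2 1 w).c12 - w.2 * (coeff E 2 0 w).c12 - lam * d)
      (fun z => (hol 0 z).c12) (continuous_c12 E 1 0).neg
      (((continuous_fst.mul (continuous_c12 E 2 1)).sub
        (continuous_snd.mul (continuous_c12 E 2 0))).sub continuous_const)
      (fun z hz => (k1 hz).1) (fun z hz => (k2 hz).2) z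
  have B12 z : (coeff E 0 1 z).c12 = 0 :=
    eq_zero_of_decay (f := fun z => (coeff E 0 1 z).c12)
      (g := fun w => w.1 * (coeff E 1 1 w).c12 - w.2 * (coeff E 1 0 w).c12 + lam * d)
      (h := fun w => -(coeff E 2 0 w).c12)
      (fun z => (hol 1 z).c12)
      (((continuous_fst.mul (continuous_c12 E 1 1)).sub
        (continuous_snd.mul (continuous_c12 E 1 0))).add continuous_const)
      (continuous_c12 E 2 0).neg
      (fun z hz => (k1 hz).2) (fun z hz => (k2 hz).1) z
  have C2 z : (coeff E 0 2 z).c2 = 0 := by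
    refine eq_zero_of_decay (f := fun z => (coeff E 0 2 z).c2) (fun z => (hol 2 z).c2)
      (continuous_c2 E 1 2) (continuous_c2 E 2 2) (fun z hz => ?_) (fun z hz => ?_) z
    · obtain ⟨ν, h⟩ := evenRel01' E hz
      exact h.c2
    · obtain ⟨ν, h⟩ := evenRel02' E hz
      exact h.c2
  -- The only use of `λ ≠ 0`. All other terms being zero, the `θ₁θ₂`-equation becomes `-λ d = w₁ ·
  -- (coeff E 1 1 w).c12`, which at `w₁ = 0` gives `λ d = 0`: a pure rescaling of `θ₂` does not
  -- preserve `ω`.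
  have hd0 : d = 0 := by
    have h := eq_zero_on_line (F := fun _ => -(lam * d)) (G := fun w => (coeff E 1 1 w).c12)
      continuous_const (continuous_c12 E 1 1) (fun w hw => by
        have hz : ((1 / w.1, w.2 / w.1) : ℂ × ℂ).1 ≠ 0 := one_div_ne_zero hw
        obtain ⟨h1, h2⟩ := k1 hz
        rw [A12, involution_eq hw] at h1
        rw [B12, involution_eq hw] at h2
        simp only [zero_eq_mul, div_eq_zero_iff, one_ne_zero, hw, false_or, neg_eq_zero] at h1 h2
        simp only [h1] at h2
        rw [one_div_one_div] at h2
        linear_combination -h2) 0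
    simpa [hlam] using h
  have hom := isHomog_coeff E 0
  funext a z
  have h0 := fun h : (0 : ZMod 2) + par a = 0 => isHomog_zero.1 (h ▸ hom a z)
  have h1 := fun h : (0 : ZMod 2) + par a = 1 => isHomog_one.1 (h ▸ hom a z)
  fin_cases a
  · exact Grass.ext (hA z) (h0 rfl).1 (h0 rfl).2 (A12 z)
  · exact Grass.ext (hB z) (h0 rfl).1 (h0 rfl).2 (B12 z)
  · exact Grass.ext (h1 rfl).1 (hC z) (C2 z) (h1 rfl).2
  · exact Grass.ext (h1 rfl).1 (hD z) ((hd z).trans hd0) (h1 rfl).2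

/-- Vanishing of an odd global vector field. -/
theorem coeff_eq_zero_of_odd (E : H0T lam 1)
    (hA1 : ∀ z, (coeff E 0 0 z).c1 = 0) (hA2 : ∀ z, (coeff E 0 0 z).c2 = 0)
    (hB1 : ∀ z, (coeff E 0 1 z).c1 = 0) (hB2 : ∀ z, (coeff E 0 1 z).c2 = 0)
    (hC : ∀ z, (coeff E 0 2 z).body = 0) (hD : ∀ z, (coeff E 0 3 z).body = 0) :
    coeff E 0 = 0 := by
  have fC : (fun u => (coeff E 0 2 u).body) = fun _ => 0 := funext hC
  have fD : (fun u => (coeff E 0 3 u).body) = fun _ => 0 := funext hD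
  have hol a z := holAt_coeff E 0 a z
  -- What remains transforms like sections of `𝒪(-2)` and `𝒪(-1)`, whatever the value of `λ`.
  have key {s : ℂ} {p q c d : Grass} {F G : ℂ × ℂ → Grass} {z ν : ℂ × ℂ} {r t : ℂ}
      (h : OddRel s F G (coeff E 0 2) (coeff E 0 3) z ν p q c d r t)
      (h1 : (F z).c1 = 0) (h2 : (F z).c2 = 0) : (coeff E 0 2 z).c12 = r * (r * c.c12) ∧
        (coeff E 0 3 z).c12 = r * d.c12 := by
    have k1 := h.p1
    have k2 := h.p2
    have k3 := h.c12
    have k4 := h.d12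
    simp only [fC, fD, h1, h2, fderiv_fun_const, Pi.zero_apply, zero_apply,
      mul_zero, add_zero] at k1 k2 k3 k4
    exact ⟨by linear_combination k3 + r * k2, by linear_combination k4 - 2 * k1⟩
  have C12 z : (coeff E 0 2 z).c12 = 0 := by
    refine eq_zero_of_decay (f := fun z => (coeff E 0 2 z).c12) (g := fun w => w.1 * (coeff E 1 2 w).c12)
      (h := fun w => w.1 * (coeff E 2 2 w).c12) (fun z => (hol 2 z).c12)
      (continuous_fst.mul (continuous_c12 E 1 2)) (continuous_fst.mul (continuous_c12 E 2 2))
      (fun z hz => ?_) (fun z hz => ?_) z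
    · obtain ⟨ν, h⟩ := oddRel01' E hz
      exact (key h (hA1 z) (hA2 z)).1
    · obtain ⟨ν, h⟩ := oddRel02' E hz
      exact (key h (hB1 z) (hB2 z)).1
  have D12 z : (coeff E 0 3 z).c12 = 0 := by
    refine eq_zero_of_decay (f := fun z => (coeff E 0 3 z).c12) (fun z => (hol 3 z).c12)
      (continuous_c12 E 1 3) (continuous_c12 E 2 3) (fun z hz => ?_) (fun z hz => ?_) z
    · obtain ⟨ν, h⟩ := oddRel01' E hz
      exact (key h (hA1 z) (hA2 z)).2
    · obtain ⟨ν, h⟩ := oddRel02' E hz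
      exact (key h (hB1 z) (hB2 z)).2
  have hom := isHomog_coeff E 0
  funext a z
  have h0 := fun h : (1 : ZMod 2) + par a = 0 => isHomog_zero.1 (h ▸ hom a z)
  have h1 := fun h : (1 : ZMod 2) + par a = 1 => isHomog_one.1 (h ▸ hom a z)
  fin_cases a
  · exact Grass.ext (h1 rfl).1 (hA1 z) (hA2 z) (h1 rfl).2
  · exact Grass.ext (h1 rfl).1 (hB1 z) (hB2 z) (h1 rfl).2
  · exact Grass.ext (hC z) (h0 rfl).1 (h0 rfl).2 (C12 z)
  · exact Grass.ext (hD z) (h0 rfl).1 (h0 rfl).2 (D12 z)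

end H0T

/-! ### Polynomial form of the leading components -/

/-- Here `r = 1 / x`, so the exponent of `x` is the pole order at infinity, in the form that
`exists_growth_bound` expects. -/
theorem EvenRel.growth {s x t : ℂ} {P Q C D : ℂ × ℂ → Grass} {z ν : ℂ × ℂ} {p q c d : Grass}
    (hx : x ≠ 0) (h : EvenRel s P Q C D z ν p q c d (1 / x) t) :
    (P z).body = x ^ 2 * -p.body ∧ (Q z).body = x ^ 2 * (1 / x * q.body - t * p.body) ∧
    (C z).c1 = x ^ 1 * (1 / x * c.c1 - p.body) ∧ (D z).c1 = x ^ 1 * d.c1 ∧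
    (D z).c2 = x ^ 1 * (1 / x * d.c2 - 2 * p.body) := by
  rw [← h.p0, ← h.q0, ← h.c1, ← h.d1, ← h.d2]
  refine ⟨?_, ?_, ?_, ?_, ?_⟩ <;> field_simp

theorem OddRel.growth {s x t : ℂ} {P Q C D : ℂ × ℂ → Grass} {z ν : ℂ × ℂ} {p q c d : Grass}
    (hx : x ≠ 0) (h : OddRel s P Q C D z ν p q c d (1 / x) t) :
    (P z).c1 = x ^ 1 * -p.c1 ∧ (P z).c2 = x ^ 0 * -p.c2 ∧
    (Q z).c1 = x ^ 1 * (1 / x * q.c1 - t * p.c1 - s * d.body) ∧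
    (Q z).c2 = x ^ 0 * (1 / x * q.c2 - t * p.c2 + s * c.body) ∧
    (C z).body = x ^ 1 * c.body ∧ (D z).body = x ^ 2 * d.body := by
  rw [← h.p1, ← h.q1, ← h.p2, ← h.q2, ← h.c0, ← h.d0]
  refine ⟨?_, ?_, ?_, ?_, ?_, ?_⟩ <;> field_simp

namespace H0T

variable {lam : ℂ}

/-- Growth makes the leading components polynomial, and regularity in chart 1 ties their top
coefficients together. Subtracting the explicit field with the same parameters leaves one possible
constant, which `coeff_eq_zero_of_even` excludes. -/
theorem exists_coeff_eq_evenGlobal (hlam : lam ≠ 0) (D : H0T lam 0) :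
    ∃ c, coeff D 0 = evenGlobal lam c 0 := by
  have hol a z := holAt_coeff D 0 a z
  have r1 {z : ℂ × ℂ} (hz : z.1 ≠ 0) := (evenRel01' D hz).choose_spec.growth hz
  have r2 {z : ℂ × ℂ} (hz : z.2 ≠ 0) := (evenRel02' D hz).choose_spec.growth hz
  have b := continuous_body D
  have cc1 := continuous_c1 D
  have cc2 := continuous_c2 D
  have x1 : Continuous fun w : ℂ × ℂ => w.1 := continuous_fst
  have x2 : Continuous fun w : ℂ × ℂ => w.2 := continuous_snd
  obtain ⟨CA, hCA⟩ := exists_growth_bound (f := fun z => (coeff D 0 0 z).body)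
    (g := fun w => -(coeff D 1 0 w).body)
    (h := fun w => w.1 * (coeff D 2 1 w).body - w.2 * (coeff D 2 0 w).body)
    (b 0 0) (b 1 0).neg ((x1.mul (b 2 1)).sub (x2.mul (b 2 0))) 2
    (fun z hz => (r1 hz).1) (fun z hz => (r2 hz).2.1)
  obtain ⟨a0, a1, a2, a11, a12, a22, hA⟩ := eq_quadratic_of_growth (fun z => (hol 0 z).body) hCA
  obtain ⟨CB, hCB⟩ := exists_growth_bound (f := fun z => (coeff D 0 1 z).body)
    (g := fun w => w.1 * (coeff D 1 1 w).body - w.2 * (coeff D 1 0 w).body)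
    (h := fun w => -(coeff D 2 0 w).body)
    (b 0 1) ((x1.mul (b 1 1)).sub (x2.mul (b 1 0))) (b 2 0).neg 2
    (fun z hz => (r1 hz).2.1) (fun z hz => (r2 hz).1)
  obtain ⟨b0, b1, b2, b11, b12, b22, hB⟩ := eq_quadratic_of_growth (fun z => (hol 1 z).body) hCB
  obtain ⟨CC, hCC⟩ := exists_growth_bound (f := fun z => (coeff D 0 2 z).c1)
    (g := fun w => w.1 * (coeff D 1 2 w).c1 - (coeff D 1 0 w).body)
    (h := fun w => w.1 * (coeff D 2 2 w).c1 - (coeff D 2 0 w).body)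
    (cc1 0 2) ((x1.mul (cc1 1 2)).sub (b 1 0)) ((x1.mul (cc1 2 2)).sub (b 2 0)) 1
    (fun z hz => (r1 hz).2.2.1) (fun z hz => (r2 hz).2.2.1)
  obtain ⟨c0, c1, c2, hC⟩ := eq_affine_of_growth (fun z => (hol 2 z).c1) hCC
  obtain ⟨CE, hCE⟩ := exists_growth_bound (f := fun z => (coeff D 0 3 z).c1)
    (cc1 0 3) (cc1 1 3) (cc1 2 3) 1 (fun z hz => (r1 hz).2.2.2.1) (fun z hz => (r2 hz).2.2.2.1)
  obtain ⟨e0, e1, e2, hE⟩ := eq_affine_of_growth (fun z => (hol 3 z).c1) hCE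
  obtain ⟨CD, hCD⟩ := exists_growth_bound (f := fun z => (coeff D 0 3 z).c2)
    (g := fun w => w.1 * (coeff D 1 3 w).c2 - 2 * (coeff D 1 0 w).body)
    (h := fun w => w.1 * (coeff D 2 3 w).c2 - 2 * (coeff D 2 0 w).body)
    (cc2 0 3) ((x1.mul (cc2 1 3)).sub (continuous_const.mul (b 1 0)))
    ((x1.mul (cc2 2 3)).sub (continuous_const.mul (b 2 0))) 1
    (fun z hz => (r1 hz).2.2.2.2) (fun z hz => (r2 hz).2.2.2.2)
  obtain ⟨d0, d1, d2, hD⟩ := eq_affine_of_growth (fun z => (hol 3 z).c2) hCD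
  -- The transition equation gives this coefficient as a polynomial off `w₁ = 0`, hence by
  -- continuity also on that line.
  have hp (t : ℂ) : (coeff D 1 0 (0, t)).body = -(a11 + a12 * t + a22 * t ^ 2) := by
    have h := congrFun (eq_of_eq_off_line (b 1 0)
      (h := fun w => -(a0 * w.1 ^ 2 + a1 * w.1 + a2 * (w.1 * w.2) + a11 + a12 * w.2 + a22 * w.2 ^ 2))
      (by fun_prop) fun w hw => by
        have h := (evenRel01 D hw).p0
        rw [hA] at h
        field_simp at h
        linear_combination h) (0, t)
    simpa using h
  have hq (t : ℂ) : t * (coeff D 1 0 (0, t)).body + (b11 + b12 * t + b22 * t ^ 2) = 0 := by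
    have h := eq_zero_on_line
      (F := fun w => w.2 * (coeff D 1 0 w).body +
        (b0 * w.1 ^ 2 + b1 * w.1 + b2 * (w.1 * w.2) + b11 + b12 * w.2 + b22 * w.2 ^ 2))
      ((x2.mul (b 1 0)).add (by fun_prop)) (b 1 1) (fun w hw => by
        have h := (evenRel01 D hw).q0
        rw [hB] at h
        field_simp at h
        linear_combination h) t
    simpa using h
  have hc (t : ℂ) : (coeff D 1 0 (0, t)).body + (c1 + c2 * t) = 0 := by
    have h := eq_zero_on_line
      (F := fun w => (coeff D 1 0 w).body + (c0 * w.1 + c1 + c2 * w.2))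
      ((b 1 0).add (by fun_prop)) (cc1 1 2) (fun w hw => by
        have h := (evenRel01 D hw).c1
        rw [hC] at h
        field_simp at h
        linear_combination h) t
    simpa using h
  have hd (t : ℂ) : 2 * (coeff D 1 0 (0, t)).body + (d1 + d2 * t) = 0 := by
    have h := eq_zero_on_line
      (F := fun w => 2 * (coeff D 1 0 w).body + (d0 * w.1 + d1 + d2 * w.2))
      ((continuous_const.mul (b 1 0)).add (by fun_prop)) (cc2 1 3) (fun w hw => by
        have h := (evenRel01 D hw).d2
        rw [hD] at h
        field_simp at h
        linear_combination h) t
    simpa using h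
  simp only [hp] at hq hc hd
  -- The relation `hq` is a cubic in `t`, so four sample points determine its coefficients; the
  -- third difference isolates `a22`. The relations `hc` and `hd` are sampled at two points, once
  -- `a22 = 0` is known.
  have q0 := hq 0
  have q1 := hq 1
  have q2 := hq (-1)
  have q3 := hq 2
  have s0 := hc 0
  have s1 := hc 1
  have t0 := hd 0
  have t1 := hd 1
  have eb11 : b11 = 0 := by linear_combination q0
  have ea22 : a22 = 0 := by linear_combination -(q3 - 3 * q1 + 3 * q0 - q2) / 6
  have eb12 : b12 = a11 := by linear_combination (q1 - q2) / 2 + ea22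
  have eb22 : b22 = a12 := by linear_combination (q1 + q2) / 2 - q0
  have ec1 : c1 = a11 := by linear_combination s0
  have ec2 : c2 = a12 := by linear_combination s1 - s0 + ea22
  have ed1 : d1 = 2 * a11 := by linear_combination t0
  have ed2 : d2 = 2 * a12 := by linear_combination t1 - t0 + 2 * ea22
  -- The entry `b2 + a1 - c0` solves `b2 = -c 4 + c 8 + c 9`, the `z₂`-coefficient of the explicit
  -- field.
  let c : Fin 12 → ℂ := ![a0, b0, a2, b1, a1, e0, e1, e2, c0, b2 + a1 - c0, a11, a12]
  have hG := coeff_eq_of_isGivenInU0 (isGlobal_evenGlobal lam c).toH0T_isGivenInU0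
  have h0 := coeff_eq_zero_of_even hlam (D + (-1 : ℂ) • (isGlobal_evenGlobal lam c).toH0T)
    (fun z => by
      simp [coeff_add, coeff_smul, hG, evenGlobal, evenVF, quad, hA, ea22, c])
    (fun z => by
      simp [coeff_add, coeff_smul, hG, evenGlobal, evenVF, quad, hB, eb11, eb12, eb22, c])
    (fun z => by
      simp [coeff_add, coeff_smul, hG, evenGlobal, evenVF, quad, hC, ec1, ec2, c])
    (fun z => by
      simp [coeff_add, coeff_smul, hG, evenGlobal, evenVF, quad, hE, c])
    -- The discrepancy between the scaling of `θ₂` and the value required by the trace condition `c0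
    -- + d0 = a1 + b2`.
    (d := d0 - (b2 + a1 - c0))
    (fun z => by
      simp [coeff_add, coeff_smul, hG, evenGlobal, evenVF, quad, hD, ed1, ed2, c]
      ring)
  rw [coeff_add, coeff_smul, hG, neg_one_smul, add_neg_eq_zero] at h0
  exact ⟨c, h0⟩

/-- The bodies of the `∂_{θ₁}`- and `∂_{θ₂}`-coefficients are free. Regularity in chart 1 expresses
the `θ₂`-parts of the even coefficients, and all but three parameters of their `θ₁`-parts, through
them. -/
theorem exists_coeff_eq_oddGlobal (D : H0T lam 1) : ∃ c, coeff D 0 = oddGlobal lam c 0 := by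
  have hol a z := holAt_coeff D 0 a z
  have r1 {z : ℂ × ℂ} (hz : z.1 ≠ 0) := (oddRel01' D hz).choose_spec.growth hz
  have r2 {z : ℂ × ℂ} (hz : z.2 ≠ 0) := (oddRel02' D hz).choose_spec.growth hz
  have b := continuous_body D
  have cc1 := continuous_c1 D
  have cc2 := continuous_c2 D
  have x1 : Continuous fun w : ℂ × ℂ => w.1 := continuous_fst
  have x2 : Continuous fun w : ℂ × ℂ => w.2 := continuous_snd
  have k (r : ℂ) : Continuous fun _ : ℂ × ℂ => r := continuous_const
  obtain ⟨CC, hCC⟩ := exists_growth_bound (f := fun z => (coeff D 0 2 z).body)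
    (b 0 2) (b 1 2) (b 2 2) 1 (fun z hz => (r1 hz).2.2.2.2.1) (fun z hz => (r2 hz).2.2.2.2.1)
  obtain ⟨c0, c1, c2, hC⟩ := eq_affine_of_growth (fun z => (hol 2 z).body) hCC
  obtain ⟨CD, hCD⟩ := exists_growth_bound (f := fun z => (coeff D 0 3 z).body)
    (b 0 3) (b 1 3) (b 2 3) 2 (fun z hz => (r1 hz).2.2.2.2.2) (fun z hz => (r2 hz).2.2.2.2.2)
  obtain ⟨d0, d1, d2, d11, d12, d22, hD⟩ := eq_quadratic_of_growth (fun z => (hol 3 z).body) hCD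
  obtain ⟨CA, hCA⟩ := exists_growth_bound (f := fun z => (coeff D 0 0 z).c1)
    (g := fun w => -(coeff D 1 0 w).c1)
    (h := fun w => w.1 * (coeff D 2 1 w).c1 - w.2 * (coeff D 2 0 w).c1 - -lam * (coeff D 2 3 w).body)
    (cc1 0 0) (cc1 1 0).neg
    (((x1.mul (cc1 2 1)).sub (x2.mul (cc1 2 0))).sub ((k _).mul (b 2 3))) 1
    (fun z hz => (r1 hz).1) (fun z hz => (r2 hz).2.2.1)
  obtain ⟨a0, a1, a2, hA⟩ := eq_affine_of_growth (fun z => (hol 0 z).c1) hCA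
  obtain ⟨CB, hCB⟩ := exists_growth_bound (f := fun z => (coeff D 0 1 z).c1)
    (g := fun w => w.1 * (coeff D 1 1 w).c1 - w.2 * (coeff D 1 0 w).c1 - lam * (coeff D 1 3 w).body)
    (h := fun w => -(coeff D 2 0 w).c1)
    (cc1 0 1) (((x1.mul (cc1 1 1)).sub (x2.mul (cc1 1 0))).sub ((k _).mul (b 1 3)))
    (cc1 2 0).neg 1
    (fun z hz => (r1 hz).2.2.1) (fun z hz => (r2 hz).1)
  obtain ⟨b0, b1, b2, hB⟩ := eq_affine_of_growth (fun z => (hol 1 z).c1) hCB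
  obtain ⟨CA', hCA'⟩ := exists_growth_bound (f := fun z => (coeff D 0 0 z).c2)
    (g := fun w => -(coeff D 1 0 w).c2)
    (h := fun w => w.1 * (coeff D 2 1 w).c2 - w.2 * (coeff D 2 0 w).c2 + -lam * (coeff D 2 2 w).body)
    (cc2 0 0) (cc2 1 0).neg
    (((x1.mul (cc2 2 1)).sub (x2.mul (cc2 2 0))).add ((k _).mul (b 2 2))) 0
    (fun z hz => (r1 hz).2.1) (fun z hz => (r2 hz).2.2.2.1)
  obtain ⟨a', hA'⟩ := eq_const_of_growth (fun z => (hol 0 z).c2.differentiableAt) hCA'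
  obtain ⟨CB', hCB'⟩ := exists_growth_bound (f := fun z => (coeff D 0 1 z).c2)
    (g := fun w => w.1 * (coeff D 1 1 w).c2 - w.2 * (coeff D 1 0 w).c2 + lam * (coeff D 1 2 w).body)
    (h := fun w => -(coeff D 2 0 w).c2)
    (cc2 0 1) (((x1.mul (cc2 1 1)).sub (x2.mul (cc2 1 0))).add ((k _).mul (b 1 2)))
    (cc2 2 0).neg 0
    (fun z hz => (r1 hz).2.2.2.1) (fun z hz => (r2 hz).2.1)
  obtain ⟨b', hB'⟩ := eq_const_of_growth (fun z => (hol 1 z).c2.differentiableAt) hCB'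
  -- This relation and the next produce the `λ`-corrections in the listed odd fields.
  have h1 (t : ℂ) : t * -(a1 + a2 * t) + lam * (d11 + d12 * t + d22 * t ^ 2) + (b1 + b2 * t) = 0 := by
    have h := eq_zero_on_line
      (F := fun w => w.2 * -(a0 * w.1 + a1 + a2 * w.2) + lam * (d0 * w.1 ^ 2 + d1 * w.1 +
        d2 * (w.1 * w.2) + d11 + d12 * w.2 + d22 * w.2 ^ 2) + (b0 * w.1 + b1 + b2 * w.2))
      (by fun_prop) (cc1 1 1) (fun w hw => by
        have h1 := (oddRel01 D hw).p1
        have h2 := (oddRel01 D hw).q1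
        have h3 := (oddRel01 D hw).d0
        rw [hA] at h1
        rw [hB] at h2
        rw [hD] at h3
        field_simp at h1 h2 h3
        linear_combination h2 - w.2 * h1 + lam * h3) t
    simpa using h
  have h2 (t : ℂ) : t * a' + lam * (c1 + c2 * t) - b' = 0 := by
    have h := eq_zero_on_line
      (F := fun w => -(w.2 * a') - lam * (c0 * w.1 + c1 + c2 * w.2) + b')
      (by fun_prop) (cc2 1 1) (fun w hw => by
        have h1 := (oddRel01 D hw).p2
        have h2 := (oddRel01 D hw).q2
        have h3 := (oddRel01 D hw).c0
        rw [hA'] at h1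
        rw [hB'] at h2
        rw [hC] at h3
        field_simp at h3
        linear_combination h2 - w.2 * h1 - lam * h3) t
    simp only [mul_zero, zero_add] at h
    linear_combination -h
  -- Three sample points for a quadratic relation and two for an affine one.
  have s0 := h1 0
  have s1 := h1 1
  have s2 := h1 (-1)
  have t0 := h2 0
  have t1 := h2 1
  have eb1 : b1 = -lam * d11 := by linear_combination s0
  have eb2 : b2 = a1 - lam * d12 := by linear_combination (s1 - s2) / 2
  have ea2 : a2 = lam * d22 := by linear_combination -(s1 + s2) / 2 + s0
  have eb' : b' = lam * c1 := by linear_combination -t0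
  have ea' : a' = lam * -c2 := by linear_combination t1 - t0
  let c : Fin 12 → ℂ := ![c0, d0, a0, b0, d1, d2, d11, d22, c1, -c2, a1, d12]
  have hG := coeff_eq_of_isGivenInU0 (isGlobal_oddGlobal lam c).toH0T_isGivenInU0
  have h0 := coeff_eq_zero_of_odd (D + (-1 : ℂ) • (isGlobal_oddGlobal lam c).toH0T)
    (fun z => by
      simp [coeff_add, coeff_smul, hG, oddGlobal, oddVF, quad, hA, ea2, c])
    (fun z => by
      simp [coeff_add, coeff_smul, hG, oddGlobal, oddVF, quad, hA', ea', c])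
    (fun z => by
      simp [coeff_add, coeff_smul, hG, oddGlobal, oddVF, quad, hB, eb1, eb2, c])
    (fun z => by
      simp [coeff_add, coeff_smul, hG, oddGlobal, oddVF, quad, hB', eb', c])
    (fun z => by
      simp [coeff_add, coeff_smul, hG, oddGlobal, oddVF, quad, hC, c])
    (fun z => by
      simp [coeff_add, coeff_smul, hG, oddGlobal, oddVF, quad, hD, c])
  rw [coeff_add, coeff_smul, hG, neg_one_smul, add_neg_eq_zero] at h0
  exact ⟨c, h0⟩

/-! ### From the parametrization to a basis -/

/-- A linear parametrization of the local expressions in the first chart yields a basis. -/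
theorem exists_basis {p : ZMod 2} (X : (Fin 12 → ℂ) →ₗ[ℂ] VectorField)
    (hX : ∀ c, X c = 0 → c = 0) (h1 : ∀ c, ∃ D : H0T lam p, coeff D 0 = X c)
    (h2 : ∀ D : H0T lam p, ∃ c, coeff D 0 = X c) {F : Fin 12 → VectorField}
    (hF : ∀ k, X (Pi.single k 1) = F k) :
    ∃ B : Module.Basis (Fin 12) ℂ (H0T lam p), ∀ k, IsGivenInU0 (B k) (F k) := by
  choose D hD using h1
  -- The chosen preimages depend linearly on the parameters because a global field is determined by
  -- its expression in the first chart.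
  let φ : (Fin 12 → ℂ) →ₗ[ℂ] H0T lam p :=
    { toFun := D
      map_add' := fun c d => ext_of_coeff (by rw [coeff_add, hD, hD, hD, map_add])
      map_smul' := fun r c => ext_of_coeff (by
        rw [RingHom.id_apply, coeff_smul, hD, hD, map_smul]) }
  have hφ : Function.Bijective φ := by
    constructor
    · intro c d h
      have h' : X c = X d := by rw [← hD, ← hD]; exact congrArg (coeff · 0) h
      exact sub_eq_zero.1 (hX _ (by rw [map_sub, h', sub_self]))
    · intro E
      obtain ⟨c, hc⟩ := h2 E
      exact ⟨c, ext_of_coeff ((hD c).trans hc.symm)⟩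
  refine ⟨.ofEquivFun (LinearEquiv.ofBijective φ hφ).symm, fun k V f x => ?_⟩
  have hB : coeff (D (Pi.single k 1)) 0 = F k := (hD _).trans (hF k)
  rw [Module.Basis.coe_ofEquivFun, ← hB]
  exact apply_eq (D (Pi.single k 1)) 0 f x

end H0T

/-- The leading components alone separate the parameters, and the values at the origin and the two
unit points suffice. -/
theorem evenLin_eq_zero {lam : ℂ} {c : Fin 12 → ℂ} (h : evenLin lam c = 0) : c = 0 := by
  have e (a : Fin 4) (x y : ℂ) : evenGlobal lam c 0 a (x, y) = 0 := congrFun (congrFun h a) (x, y)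
  have A (x y : ℂ) := congrArg Grass.body (e 0 x y)
  have B (x y : ℂ) := congrArg Grass.body (e 1 x y)
  have C (x y : ℂ) := congrArg Grass.c1 (e 2 x y)
  have D (x y : ℂ) := congrArg Grass.c1 (e 3 x y)
  have D' (x y : ℂ) := congrArg Grass.c2 (e 3 x y)
  simp [evenGlobal, evenVF, quad] at A B C D D'
  have A0 := A 0 0
  have B0 := B 0 0
  have C0 := C 0 0
  have C1 := C 1 0
  have C2 := C 0 1
  have D0 := D 0 0
  have D1 := D 1 0
  have D2 := D 0 1
  have E0 := D' 0 0
  have A1 := A 1 0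
  have A2 := A 0 1
  have B1 := B 1 0
  clear h e A B C D D'
  funext k
  fin_cases k <;> dsimp <;> grind

/-- As in the even case, except that the quadratic body of the `∂_{θ₂}`-coefficient needs six sample
points. -/
theorem oddLin_eq_zero {lam : ℂ} {c : Fin 12 → ℂ} (h : oddLin lam c = 0) : c = 0 := by
  have e (a : Fin 4) (x y : ℂ) : oddGlobal lam c 0 a (x, y) = 0 := congrFun (congrFun h a) (x, y)
  have A (x y : ℂ) := congrArg Grass.c1 (e 0 x y)
  have B (x y : ℂ) := congrArg Grass.c1 (e 1 x y)
  have C (x y : ℂ) := congrArg Grass.body (e 2 x y)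
  have D (x y : ℂ) := congrArg Grass.body (e 3 x y)
  simp [oddGlobal, oddVF, quad] at A B C D
  have A0 := A 0 0
  have A1 := A 1 0
  have B0 := B 0 0
  have C0 := C 0 0
  have C1 := C 1 0
  have C2 := C 0 1
  have D0 := D 0 0
  have D1 := D 1 0
  have D2 := D 0 1
  have D3 := D (-1) 0
  have D4 := D 0 (-1)
  have D5 := D 1 1
  clear h e A B C D
  funext k
  fin_cases k <;> dsimp <;> grind

end SuperPlane

end

theorem mainTheorem2 (lam : ℂ) (hlam : lam ≠ 0) :
    (∃ 𝒱 : Module.Basis (Fin 12) ℂ (SuperPlane.H0T lam 0),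
      ∀ k, SuperPlane.IsGivenInU0 (𝒱 k) (SuperPlane.evenField lam k)) ∧
    (∃ Ξ : Module.Basis (Fin 12) ℂ (SuperPlane.H0T lam 1),
      ∀ k, SuperPlane.IsGivenInU0 (Ξ k) (SuperPlane.oddField lam k)) :=
  ⟨SuperPlane.H0T.exists_basis (SuperPlane.evenLin lam) (fun _ => SuperPlane.evenLin_eq_zero)
    (fun c => ⟨_, SuperPlane.H0T.coeff_eq_of_isGivenInU0
      (SuperPlane.isGlobal_evenGlobal lam c).toH0T_isGivenInU0⟩)
    (SuperPlane.H0T.exists_coeff_eq_evenGlobal hlam) (SuperPlane.evenLin_single lam),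
   SuperPlane.H0T.exists_basis (SuperPlane.oddLin lam) (fun _ => SuperPlane.oddLin_eq_zero)
    (fun c => ⟨_, SuperPlane.H0T.coeff_eq_of_isGivenInU0
      (SuperPlane.isGlobal_oddGlobal lam c).toH0T_isGivenInU0⟩)
    SuperPlane.H0T.exists_coeff_eq_oddGlobal (SuperPlane.oddLin_single lam)⟩
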